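/- Let $k$ be a field, $N\ge 0$, $R=k[x_0,\dots,x_N]$, $S=k[x_1,\dots,x_N]\subset R$. Let $I\subset R$ be a homogeneous ideal, $X\subset\mathbb P^N_k$ the subscheme defined by $I$, and $q\in X$ a $k$-rational point at which $X$ is smooth over $k$. For $A=R$ or $A=S$ and a graded $A$-module $M$ put $\beta^A_{p,j}(M)=\dim_k\operatorname{Tor}^A_p(M,k)_{p+j}$ and $\operatorname{reg}_A(M)=\sup\{j:\beta^A_{p,j}(M)\ne 0\text{ for some }p\ge 0\}$ (with $\operatorname{reg}_A(0)=-\infty$). The ideal $I$ satisfies property $\mathbf N_{d,p_0}$ as an $R$-module if $\beta^R_{i,j}(I)=0$ for all $0\le i<p_0$ and all $j>d$. After a linear change of coordinates (any one may be chosen) assume $q=(1:0:\cdots:0)$. For $i\in\mathbb Z$ let $\widetilde K_i(I)=\bigl(\bigoplus_{0\le a\le i}S\,x_0^a\bigr)\cap I$, a graded $S$-module (zero for $i<0$), and for $i\ge 0$ let $K_i(I)\subset S$ be the ideal generated by the coefficients of $x_0^i$ in the elements of $\widetilde K_i(I)$. Let $s=\min\{i\ge 0: K_i(I)=K_{i+1}(I)=\cdots\}$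 be the stabilization number. Then: (a) If $I$ satisfies $\mathbf N_{d,p_0}$ as an $R$-module for some $d\ge s$ and $p_0\ge 1$, then $\beta^S_{p,j}(\widetilde K_{s-1}(I))=0$ for all $0\le p<p_0-1$ and $j>d$. (b) If for some $d\ge s+1$ and $p_0\ge 1$ one has $\beta^S_{p,j}(\widetilde K_{s-1}(I))=0$ for all $0\le p<p_0$ and $j>d$, then $I$ satisfies $\mathbf N_{d,p_0}$ as an $R$-module. (c) If $I\ne 0$, then $\operatorname{reg}_R(I)=\max\{\operatorname{reg}_S(\widetilde K_{s-1}(I)),\,s+1\}$. -/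

import Mathlib

open scoped LinearAlgebra.Projectivization

universe u

noncomputable section

namespace PartialElimination

open MvPolynomial

/-! ### Graded free modules and graded free resolutions over a polynomial ring -/

section Resolutions

variable {σ : Type} {k : Type u} [Field k]

/-- `dim_k (Z / B)` for subspaces `B ≤ Z` of a vector space. -/
def subquotientDim {V : Type u} [AddCommGroup V] [Module k V] (Z B : Submodule k V) :
    Cardinal.{u} :=
  Module.rank k (Z ⧸ B.submoduleOf Z)

/-- The graded free module `⨁ a, A(-deg a)` over `A = k[σ]` is `ι →₀ A`, whose basis vector `e_a`
has degree `deg a`. This is its homogeneous part of degree `j`: in the coordinate `a` only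
monomials of degree `j - deg a` occur. -/
def freeGrading {ι : Type u} (deg : ι → ℕ) (j : ℕ) : Submodule k (ι →₀ MvPolynomial σ k) where
  carrier := {v | ∀ a, ∀ m ∈ (v a).support, deg a + m.degree = j}
  zero_mem' := by intro a m hm; simp at hm
  add_mem' := by
    classical
    intro v w hv hw a m hm
    rcases Finset.mem_union.1 (MvPolynomial.support_add hm) with h | h
    · exact hv a m h
    · exact hw a m h
  smul_mem' := by
    intro c v hv a m hm
    exact hv a m (MvPolynomial.support_smul hm)

/-- A graded free resolution `⋯ → F₂ → F₁ → F₀ → M → 0` of a module `M` over `A = k[σ]`, graded by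
the family `ℳ` of its homogeneous parts. Here `F_p = ⨁ a : ι p, A(-deg p a)` and all maps are
homogeneous of degree `0`. -/
structure GradedFreeResolution (σ : Type) (k : Type u) [Field k] {M : Type u} [AddCommGroup M]
    [Module (MvPolynomial σ k) M] (ℳ : ℕ → AddSubgroup M) where
  ι : ℕ → Type u
  deg : ∀ p, ι p → ℕ
  ε : (ι 0 →₀ MvPolynomial σ k) →ₗ[MvPolynomial σ k] M
  d : ∀ p, (ι (p + 1) →₀ MvPolynomial σ k) →ₗ[MvPolynomial σ k] (ι p →₀ MvPolynomial σ k)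
  ε_deg : ∀ a, ε (Finsupp.single a 1) ∈ ℳ (deg 0 a)
  d_deg : ∀ p a, d p (Finsupp.single a 1) ∈ freeGrading (deg p) (deg (p + 1) a)
  ε_surjective : Function.Surjective ε
  exact_zero : Function.Exact (d 0) ε
  exact_succ : ∀ p, Function.Exact (d (p + 1)) (d p)

namespace GradedFreeResolution

variable {M : Type u} [AddCommGroup M] [Module (MvPolynomial σ k) M] {ℳ : ℕ → AddSubgroup M}

/-- The differential `F_{p+1} ⊗ k → F_p ⊗ k`, where `k = A / (σ)` and `F_p ⊗ k = ι p →₀ k`: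
the entries of the matrix of `d p` are replaced by their constant terms. -/
def dBar (F : GradedFreeResolution σ k ℳ) (p : ℕ) : (F.ι (p + 1) →₀ k) →ₗ[k] (F.ι p →₀ k) :=
  Finsupp.linearCombination k fun a =>
    (F.d p (Finsupp.single a 1)).mapRange constantCoeff (map_zero _)

/-- The cycles of `F_• ⊗ k` in homological degree `p`. -/
def cycles (F : GradedFreeResolution σ k ℳ) : ∀ p, Submodule k (F.ι p →₀ k)
  | 0 => ⊤
  | p + 1 => LinearMap.ker (F.dBar p)

/-- The homogeneous part of degree `j` of `F_p ⊗ k`. -/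
def degreePart (F : GradedFreeResolution σ k ℳ) (p j : ℕ) : Submodule k (F.ι p →₀ k) :=
  Finsupp.supported k k {a | F.deg p a = j}

/-- The cycles of `F_• ⊗ k` in homological degree `p` and internal degree `j`. -/
def gradedCycles (F : GradedFreeResolution σ k ℳ) (p j : ℕ) : Submodule k (F.ι p →₀ k) :=
  F.cycles p ⊓ F.degreePart p j

/-- The boundaries of `F_• ⊗ k` in homological degree `p` and internal degree `j`. -/
def gradedBoundaries (F : GradedFreeResolution σ k ℳ) (p j : ℕ) : Submodule k (F.ι p →₀ k) :=
  (F.degreePart (p + 1) j).map (F.dBar p)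

/-- `dim_k Tor_p(M, k)_j = dim_k H_p(F_• ⊗ k)_j`, as a cardinal number. -/
def torDim (F : GradedFreeResolution σ k ℳ) (p j : ℕ) : Cardinal.{u} :=
  subquotientDim (F.gradedCycles p j) (F.gradedBoundaries p j)

end GradedFreeResolution

section Existence

variable {ι : Type u} (deg : ι → ℕ)

def comp (j : ℕ) : (ι →₀ MvPolynomial σ k) →+ (ι →₀ MvPolynomial σ k) :=
  Finsupp.liftAddHom fun a => (Finsupp.singleAddHom a).comp
    (if deg a ≤ j then (homogeneousComponent (j - deg a)).toAddMonoidHom else 0)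

lemma comp_single (j : ℕ) (a : ι) (m : σ →₀ ℕ) (c : k) :
    comp deg j (Finsupp.single a (monomial m c)) =
      if deg a + m.degree = j then Finsupp.single a (monomial m c) else 0 := by
  have hm := isHomogeneous_monomial (σ := σ) (R := k) (d := m) c rfl
  rw [comp, Finsupp.liftAddHom_apply_single]
  by_cases h1 : deg a ≤ j
  · have h2 := homogeneousComponent_of_mem (m := j - deg a) hm
    have h3 : (j - deg a = m.degree) ↔ (deg a + m.degree = j) := by omega
    simp only [h1, if_true, AddMonoidHom.comp_apply, Finsupp.singleAddHom_apply,
      LinearMap.toAddMonoidHom_coe, h2, h3]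
    split_ifs <;> simp
  · have h3 : ¬ (deg a + m.degree = j) := by omega
    simp [h1, h3]

lemma free_induction {P : (ι →₀ MvPolynomial σ k) → Prop} (h0 : P 0)
    (hadd : ∀ v w, P v → P w → P (v + w))
    (hs : ∀ a m c, P (Finsupp.single a (monomial m c))) (v) : P v := by
  induction v using Finsupp.induction_linear with
  | zero => exact h0
  | add v w hv hw => exact hadd v w hv hw
  | single a f =>
    induction f using MvPolynomial.induction_on' with
    | monomial m c => exact hs a m c
    | add f g hf hg => rw [Finsupp.single_add]; exact hadd _ _ hf hg

lemma single_mem (a : ι) (m : σ →₀ ℕ) (c : k) :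
    Finsupp.single a (monomial m c) ∈ freeGrading (σ := σ) (k := k) deg (deg a + m.degree) := by
  classical
  intro b n hn
  by_cases hb : a = b
  · subst hb
    rw [Finsupp.single_eq_same] at hn
    have := support_monomial_subset hn
    rw [Finset.mem_singleton] at this
    rw [this]
  · rw [Finsupp.single_eq_of_ne (Ne.symm hb)] at hn
    simp at hn

lemma comp_mem (j : ℕ) (v : ι →₀ MvPolynomial σ k) :
    comp deg j v ∈ freeGrading (σ := σ) (k := k) deg j := by
  induction v using free_induction with
  | h0 => simp
  | hadd v w hv hw => rw [map_add]; exact add_mem hv hw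
  | hs a m c =>
    rw [comp_single]
    split_ifs with h
    · exact h ▸ single_mem deg a m c
    · exact zero_mem _

lemma sum_comp (v : ι →₀ MvPolynomial σ k) :
    ∃ n, ∀ N, n ≤ N → ∑ j ∈ Finset.range N, comp deg j v = v := by
  induction v using free_induction with
  | h0 => exact ⟨0, by simp⟩
  | hadd v w hv hw =>
    obtain ⟨n, hn⟩ := hv
    obtain ⟨n', hn'⟩ := hw
    refine ⟨max n n', fun N hN => ?_⟩
    simp only [map_add, Finset.sum_add_distrib]
    rw [hn N (le_trans (le_max_left _ _) hN), hn' N (le_trans (le_max_right _ _) hN)]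
  | hs a m c =>
    refine ⟨deg a + m.degree + 1, fun N hN => ?_⟩
    simp only [comp_single]
    rw [Finset.sum_ite_eq, if_pos (Finset.mem_range.2 (by omega))]

lemma ker_span {E : Type u} [AddCommGroup E] [Module (MvPolynomial σ k) E]
    (φ : (ι →₀ MvPolynomial σ k) →ₗ[MvPolynomial σ k] E) (pr : ℕ → E →+ E)
    (H : ∀ j a m c, pr j (φ (Finsupp.single a (monomial m c))) =
      if deg a + m.degree = j then φ (Finsupp.single a (monomial m c)) else 0)
    (v) (hv : φ v = 0) :
    v ∈ Submodule.span (MvPolynomial σ k) {w | φ w = 0 ∧ ∃ j, w ∈ freeGrading deg j} := by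
  have key : ∀ j w, pr j (φ w) = φ (comp deg j w) := by
    intro j w
    induction w using free_induction with
    | h0 => simp
    | hadd v w hv hw => simp [hv, hw]
    | hs a m c =>
      rw [H, comp_single]
      split_ifs <;> simp
  obtain ⟨n, hn⟩ := sum_comp deg v
  rw [← hn n le_rfl]
  refine Submodule.sum_mem _ fun j _ => Submodule.subset_span ⟨?_, j, comp_mem deg j v⟩
  rw [← key, hv, map_zero]

structure Stage (σ : Type) (k : Type u) [Field k] where
  ι : Type u
  deg : ι → ℕ
  Z : Submodule (MvPolynomial σ k) (ι →₀ MvPolynomial σ k)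
  hZ : ∀ v ∈ Z, v ∈ Submodule.span (MvPolynomial σ k) {w | w ∈ Z ∧ ∃ j, w ∈ freeGrading deg j}

abbrev Stage.gens (s : Stage σ k) : Type u :=
  {x : ℕ × (s.ι →₀ MvPolynomial σ k) // x.2 ∈ s.Z ∧ x.2 ∈ freeGrading s.deg x.1}

def Stage.map (s : Stage σ k) :
    (s.gens →₀ MvPolynomial σ k) →ₗ[MvPolynomial σ k] (s.ι →₀ MvPolynomial σ k) :=
  Finsupp.linearCombination _ fun x => x.1.2

lemma Stage.range_map (s : Stage σ k) : LinearMap.range s.map = s.Z := by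
  rw [Stage.map, Finsupp.range_linearCombination]
  apply le_antisymm
  · rw [Submodule.span_le]
    rintro _ ⟨x, rfl⟩
    exact x.2.1
  · intro v hv
    refine Submodule.span_mono ?_ (s.hZ v hv)
    rintro w ⟨hw, j, hj⟩
    exact ⟨⟨(j, w), hw, hj⟩, rfl⟩

lemma Stage.mem_Z_iff (s : Stage σ k) (v) : v ∈ s.Z ↔ v ∈ Set.range s.map := by
  rw [← Stage.range_map]
  rfl

lemma smul_free {n j : ℕ} {m : σ →₀ ℕ} (c : k) (hm : m.degree = n)
    {v : ι →₀ MvPolynomial σ k} (hv : v ∈ freeGrading (σ := σ) (k := k) deg j) :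
    (monomial m c) • v ∈ freeGrading (σ := σ) (k := k) deg (j + n) := by
  classical
  intro a l hl
  rw [Finsupp.smul_apply, smul_eq_mul] at hl
  obtain ⟨x, hx, y, hy, rfl⟩ := Finset.mem_add.1 (support_mul _ _ hl)
  have := support_monomial_subset hx
  rw [Finset.mem_singleton] at this
  have h2 := hv a y hy
  subst this
  rw [map_add]
  omega

lemma comp_of_mem {i j : ℕ} {v : ι →₀ MvPolynomial σ k}
    (hv : v ∈ freeGrading (σ := σ) (k := k) deg i) :
    comp deg j v = if i = j then v else 0 := by
  have h : comp deg j v = ∑ a ∈ v.support, ∑ m ∈ (v a).support,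
      comp deg j (Finsupp.single a (monomial m (coeff m (v a)))) := by
    conv_lhs => rw [← Finsupp.sum_single v]
    rw [Finsupp.sum, map_sum]
    refine Finset.sum_congr rfl fun a _ => ?_
    conv_lhs => rw [(v a).as_sum]
    rw [← Finsupp.singleAddHom_apply, map_sum, map_sum]
    rfl
  have h' : v = ∑ a ∈ v.support, ∑ m ∈ (v a).support,
      (Finsupp.single a (monomial m (coeff m (v a)))) := by
    conv_lhs => rw [← Finsupp.sum_single v]
    rw [Finsupp.sum]
    refine Finset.sum_congr rfl fun a _ => ?_
    conv_lhs => rw [(v a).as_sum]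
    rw [← Finsupp.singleAddHom_apply, map_sum]
    rfl
  rw [h]
  split_ifs with hij
  · conv_rhs => rw [h']
    refine Finset.sum_congr rfl fun a _ => Finset.sum_congr rfl fun m hm => ?_
    rw [comp_single, if_pos ((hv a m hm).trans hij)]
  · refine Finset.sum_eq_zero fun a _ => Finset.sum_eq_zero fun m hm => ?_
    rw [comp_single, if_neg (fun e => hij ((hv a m hm).symm.trans e))]

def Stage.next (s : Stage σ k) : Stage σ k where
  ι := s.gens
  deg x := x.1.1
  Z := LinearMap.ker s.map
  hZ := by
    intro v hv
    refine ker_span (fun x : s.gens => x.1.1) s.map (fun j => comp s.deg j) ?_ v hv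
    intro j a m c
    have : s.map (Finsupp.single a (monomial m c)) = monomial m c • a.1.2 := by
      simp [Stage.map]
    rw [this]
    exact comp_of_mem s.deg (smul_free s.deg c rfl a.2.2)

def Stage.iter (s : Stage σ k) : ℕ → Stage σ k
  | 0 => s
  | n + 1 => (Stage.iter s n).next

/-- Every graded module over `k[σ]` has a graded free resolution. -/
theorem GradedFreeResolution.exists_resolution {M : Type u} [AddCommGroup M]
    [Module (MvPolynomial σ k) M] (ℳ : ℕ → AddSubgroup M) [DirectSum.Decomposition ℳ]
    [SetLike.GradedSMul (homogeneousSubmodule σ k) ℳ] :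
    Nonempty (GradedFreeResolution σ k ℳ) := by
  classical
  let G : Type u := {x : ℕ × M // x.2 ∈ ℳ x.1}
  let ε : (G →₀ MvPolynomial σ k) →ₗ[MvPolynomial σ k] M :=
    Finsupp.linearCombination _ fun x => x.1.2
  let s : Stage σ k :=
    { ι := G
      deg := fun x => x.1.1
      Z := LinearMap.ker ε
      hZ := by
        intro v hv
        refine ker_span (fun x : G => x.1.1) ε
          (fun j => ((ℳ j).subtype.comp
            ((DFinsupp.evalAddMonoidHom j).comp (DirectSum.decomposeAddEquiv ℳ).toAddMonoidHom))) ?_ v hv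
        intro j a m c
        have h1 : ε (Finsupp.single a (monomial m c)) = monomial m c • a.1.2 := by
          simp [ε]
        have h2 : monomial m c • a.1.2 ∈ ℳ (a.1.1 + m.degree) := by
          rw [add_comm]
          exact SetLike.GradedSMul.smul_mem
            (A := homogeneousSubmodule σ k) (isHomogeneous_monomial c rfl) a.2
        rw [h1]
        split_ifs with h
        · exact DirectSum.decompose_of_mem_same ℳ (h ▸ h2)
        · exact DirectSum.decompose_of_mem_ne ℳ h2 h }
  refine ⟨{ ι := fun p => (s.iter p).ι
            deg := fun p => (s.iter p).deg
            ε := ε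
            d := fun p => (s.iter p).map
            ε_deg := ?_, d_deg := ?_, ε_surjective := ?_, exact_zero := ?_, exact_succ := ?_ }⟩
  · intro a
    have : ε (Finsupp.single a 1) = a.1.2 := by
      simp only [ε]
      exact (Finsupp.linearCombination_single _ _ _).trans (one_smul _ _)
    exact this ▸ a.2
  · intro p a
    have : (s.iter p).map (Finsupp.single a 1) = a.1.2 :=
      (Finsupp.linearCombination_single _ _ _).trans (one_smul _ _)
    exact this ▸ a.2.2
  · have h : ∀ x, x ∈ LinearMap.range ε := by
      intro x
      rw [← DirectSum.sum_support_decompose ℳ x]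
      refine Submodule.sum_mem _ fun j _ => ?_
      exact ⟨Finsupp.single ⟨(j, (DirectSum.decompose ℳ x j : M)), SetLike.coe_mem _⟩ 1,
        by simp [ε]⟩
    exact h
  · exact fun v => Stage.mem_Z_iff s v
  · exact fun p v => Stage.mem_Z_iff (s.iter (p + 1)) v

end Existence

/-! ### Graded Betti numbers, regularity, property `N_{d,p}` -/

variable {M : Type u} [AddCommGroup M]

/-- `dim_k Tor_p^A(M, k)_j` for `A = k[σ]`, computed from a graded free resolution of `M`
(the choice is immaterial, and one exists by `GradedFreeResolution.exists_resolution`). -/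
def torDim (σ : Type) (k : Type u) [Field k] [Module (MvPolynomial σ k) M]
    (ℳ : ℕ → AddSubgroup M) (p j : ℕ) : Cardinal.{u} :=
  open Classical in
  if h : Nonempty (GradedFreeResolution σ k ℳ) then h.some.torDim p j else 0

/-- The graded Betti number `β_{p,q}(M) = dim_k Tor_p^A(M, k)_{p+q}`, with `A = k[σ]`. -/
def gradedBetti (σ : Type) (k : Type u) [Field k] [Module (MvPolynomial σ k) M]
    (ℳ : ℕ → AddSubgroup M) (p q : ℕ) : Cardinal.{u} :=
  torDim σ k ℳ p (p + q)

/-- Castelnuovo–Mumford regularity `sup {q | β_{p,q}(M) ≠ 0 for some p}`; it is `⊥` (that is, `-∞`)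
if all Betti numbers vanish. As `M` lives in degrees `≥ 0`, `Tor_p(M, k)` lives in degrees `≥ p`,
so that only `q ≥ 0` matters. -/
def regularity (σ : Type) (k : Type u) [Field k] [Module (MvPolynomial σ k) M]
    (ℳ : ℕ → AddSubgroup M) : WithBot ℕ∞ :=
  ⨆ (p : ℕ) (q : ℕ) (_ : gradedBetti σ k ℳ p q ≠ 0), ((q : ℕ∞) : WithBot ℕ∞)

/-- The homogeneous parts of an ideal of `k[σ]`. -/
def idealGrading (I : Ideal (MvPolynomial σ k)) (j : ℕ) : AddSubgroup I :=
  (homogeneousSubmodule σ k j).toAddSubgroup.comap I.subtype.toAddMonoidHom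

/-- Property `N_{d,p}`: `β_{i,j}(I) = 0` for all `0 ≤ i < p` and `j > d`. -/
def PropertyN (I : Ideal (MvPolynomial σ k)) (d p : ℕ) : Prop :=
  ∀ i j, i < p → d < j → gradedBetti σ k (idealGrading I) i j = 0

end Resolutions

/-! ### Partial elimination ideals -/

section PEI

variable {k : Type u} [Field k] {N : ℕ}

/-- `R = k[x_0, …, x_N]`. -/
abbrev R (k : Type u) [Field k] (N : ℕ) : Type u := MvPolynomial (Fin (N + 1)) k

/-- `S = k[x_1, …, x_N]`; the variable `x_{i+1}` of `R` is the variable `X i` of `S`.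
The isomorphism `finSuccEquiv k N : R ≃ S[x_0]` separates the variable `x_0`. -/
abbrev S (k : Type u) [Field k] (N : ℕ) : Type u := MvPolynomial (Fin N) k

/-- `K̃_i(I) = (⨁_{a ≤ i} S x_0^a) ∩ I`, as an `S`-submodule of `S[x_0] = R`;
it is zero for `i < 0`. -/
def KTilde (I : Ideal (R k N)) (i : ℤ) : Submodule (S k N) (Polynomial (S k N)) :=
  Polynomial.degreeLT (S k N) (i + 1).toNat ⊓
    (I.comap (finSuccEquiv k N).symm.toRingEquiv.toRingHom).restrictScalars (S k N)

/-- The homogeneous parts of `K̃_i(I)`, for the total degree in `x_0, …, x_N`. -/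
def KTildeGrading (I : Ideal (R k N)) (i : ℤ) (j : ℕ) : AddSubgroup (KTilde I i) :=
  (homogeneousSubmodule (Fin (N + 1)) k j).toAddSubgroup.comap
    ((finSuccEquiv k N).symm.toRingEquiv.toRingHom.toAddMonoidHom.comp
      (KTilde I i).subtype.toAddMonoidHom)

/-- The partial elimination ideal `K_i(I)`: the ideal of `S` generated by the coefficients of
`x_0^i` in the elements of `K̃_i(I)`. -/
def K (I : Ideal (R k N)) (i : ℕ) : Ideal (S k N) :=
  Ideal.span ((fun f : Polynomial (S k N) => f.coeff i) '' (KTilde I i : Set _))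

/-- The stabilization number `s(I) = min {i | K_i(I) = K_{i+1}(I) = ⋯}`. -/
def stabilizationNumber (I : Ideal (R k N)) : ℕ :=
  sInf {i | ∀ j, i ≤ j → K I j = K I i}

end PEI

/-! ### Coordinates, points and smoothness -/

section Geometry

variable {k : Type u} [Field k] {N : ℕ}

/-- The linear substitution `f ↦ f(g x)`, i.e. `x_i ↦ ∑ j, g i j * x_j`. -/
def linearSubst (g : GL (Fin (N + 1)) k) : R k N →ₐ[k] R k N :=
  aeval fun i => ∑ j, C (g.1 i j) * X j

/-- The ideal `{f(g x) | f ∈ I}` of the subscheme defined by `I`, in the new coordinates in which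
the point `g (1 : 0 : ⋯ : 0)` becomes `(1 : 0 : ⋯ : 0)`. -/
def changeCoords (g : GL (Fin (N + 1)) k) (I : Ideal (R k N)) : Ideal (R k N) :=
  I.map (linearSubst g)

/-- `g` moves `(1 : 0 : ⋯ : 0)` to `q`. -/
def Adapted (g : GL (Fin (N + 1)) k) (q : ℙ k (Fin (N + 1) → k)) : Prop :=
  g.1.mulVec (Pi.single 0 1) ∈ q.submodule

/-- The ideal in `S = k[x_1, …, x_N]` of the affine part `X ∩ {x_0 ≠ 0}` of the subscheme `X`
defined by `I`, obtained by setting `x_0 = 1`. -/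
def affineIdeal (I : Ideal (R k N)) : Ideal (S k N) :=
  I.map (aeval (Fin.cons 1 X) : R k N →ₐ[k] S k N)

/-- The point `(1 : 0 : ⋯ : 0)` lies on the subscheme `X` defined by `I`, and `X` is smooth over `k`
there: the affine part `X ∩ {x_0 ≠ 0}`, which is the spectrum of `S / affineIdeal I`, contains the
origin (the prime given by the polynomials without constant term) and is smooth at it. -/
def IsSmoothPointAtOrigin (I : Ideal (R k N)) : Prop :=
  ∃ P ∈ Algebra.smoothLocus k (S k N ⧸ affineIdeal I),
    P.asIdeal.comap (Ideal.Quotient.mk (affineIdeal I)) = RingHom.ker (constantCoeff (σ := Fin N))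

end Geometry

end PartialElimination

end

/-! Let `J` be the ideal in the coordinates where `q = (1 : 0 : ⋯ : 0)`, and put `M = K̃_{s-1}(J)`,
`M' = K̃_s(J)`. Because the `K_i` are constant from `s` on, the leading coefficient of an element of
`J` of `x₀`-degree above `s` already occurs one `x₀`-degree lower, so `J = M' + x₀ J`. Moreover `M`
consists of the `f ∈ J` with `x₀ f ∈ M'`. Hence `0 → M(-1)[x₀] → M'[x₀] → J → 0` is exact
(`isPencil_elimParts`), and there are exact sequences `Tor^S_p(M') → Tor^R_p(J) → Tor^S_{p-1}(M)(-1)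
→ Tor^S_{p-1}(M')`. A second sequence, `0 → M → M' → K_s(-s) → 0`, compares `M` with `M'`.

Geometry enters only through `K_s`. Its elements are spanned by initial forms at the origin of the
equations of the affine part of `X`, so it describes the tangent cone. At a smooth rational point
formal smoothness forces the tangent cone to be the tangent space (`mem_span_linearParts`), so `K_s`
is generated by linear forms (`K_stabilizationNumber_eq_span`) and has a linear resolution
(`koszulExact_of_span_linear`). After the twist by `s` it can only affect the row `j = s + 1`: in
every other row vanishing for `M` gives vanishing for `M'` (`koszulExact_elimParts_succ`).

Part (b) then reads off the first sequence. Part (a) is a descending induction on `j`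
(`koszulExact_elimParts`): the vanishing of `β_{p+1,j}(J)` embeds `Tor_p(M)` in row `j` into
`Tor_p(M')` in row `j + 1`, and finite generation starts the induction. Part (c) needs in addition
that `J` has a minimal generator of degree `s + 1` (`not_koszulExact_stabilizationNumber`), as
otherwise `s` would not be minimal.

All `Tor` groups are handled through Koszul complexes: `KoszulExact x W p c` says that Koszul
homology vanishes in homological degree `p` with coefficients in degree `c`, hence in internal
degree `p + c`. For any graded free resolution this is equivalent to `β_{p,c} = 0`
(`GradedFreeResolution.torDim_eq_zero_iff`). The long exact sequences become diagram chases with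
subgroups of one polynomial ring. -/

namespace PartialElimination

/-! ### The Koszul complex of commuting operators, as an iterated mapping cone -/

section Koszul

variable {V V' : Type u} [AddCommGroup V] [AddCommGroup V']

/-- The Koszul chains, in all homological degrees, of `n` operators on `V`. -/
def Kos (V : Type u) : ℕ → Type u
  | 0 => V
  | n + 1 => Kos V n × Kos V n

instance Kos.addCommGroup : ∀ n, AddCommGroup (Kos V n)
  | 0 => inferInstanceAs (AddCommGroup V)
  | n + 1 =>
    letI := Kos.addCommGroup n
    inferInstanceAs (AddCommGroup (Kos V n × Kos V n))

namespace Kos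

/-- The chain of the mapping cone with components `a` and `b`. -/
def mk {n : ℕ} (a b : Kos V n) : Kos V (n + 1) := (a, b)

lemma mk_add {n : ℕ} (a b a' b' : Kos V n) : mk a b + mk a' b' = mk (a + a') (b + b') := rfl

lemma mk_zero {n : ℕ} : mk (0 : Kos V n) 0 = 0 := rfl

lemma exists_eq_mk {n : ℕ} (z : Kos V (n + 1)) : ∃ a b, z = mk a b := ⟨z.1, z.2, rfl⟩

lemma mk_inj {n : ℕ} {a b a' b' : Kos V n} : mk a b = mk a' b' ↔ a = a' ∧ b = b' := Prod.ext_iff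

lemma mk_eq_zero {n : ℕ} {a b : Kos V n} : mk a b = 0 ↔ a = 0 ∧ b = 0 := mk_inj

/-- The map of Koszul chains induced by a map of coefficients. -/
def map (φ : V →+ V') : ∀ n, Kos V n →+ Kos V' n
  | 0 => φ
  | n + 1 => AddMonoidHom.prodMap (map φ n) (map φ n)

/-- The Koszul differential. -/
def diff : ∀ n, (Fin n → V →+ V) → (Kos V n →+ Kos V n)
  | 0, _ => 0
  | n + 1, x => AddMonoidHom.prod ((diff n (Fin.tail x)).coprod (map (x 0) n))
      ((-diff n (Fin.tail x)).comp (AddMonoidHom.snd _ _))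

/-- The Koszul chains of homological degree `p` with values in a subgroup `U`. -/
def chains (U : AddSubgroup V) : ∀ n, ℤ → AddSubgroup (Kos V n)
  | 0, p => if p = 0 then U else ⊥
  | n + 1, p => (chains U n p).prod (chains U n (p - 1))

lemma map_succ (φ : V →+ V') (n : ℕ) (a b : Kos V n) :
    map φ (n + 1) (mk a b) = mk (map φ n a) (map φ n b) := rfl

lemma diff_succ (n : ℕ) (x : Fin (n + 1) → V →+ V) (a b : Kos V n) :
    diff (n + 1) x (mk a b) =
      mk (diff n (Fin.tail x) a + map (x 0) n b) (-diff n (Fin.tail x) b) := rfl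

lemma mem_chains_zero {U : AddSubgroup V} {p : ℤ} {z : Kos V 0} :
    z ∈ chains U 0 p ↔ (p = 0 ∧ (show V from z) ∈ U) ∨ z = 0 := by
  by_cases h : p = 0
  · subst h
    simp only [chains, true_and]
    constructor
    · intro h; exact Or.inl h
    · rintro (h | rfl)
      · exact h
      · exact zero_mem U
  · simp only [chains, h, false_and, false_or]
    exact Iff.rfl

lemma mem_chains_succ {U : AddSubgroup V} {n : ℕ} {p : ℤ} {a b : Kos V n} :
    mk a b ∈ chains U (n + 1) p ↔ a ∈ chains U n p ∧ b ∈ chains U n (p - 1) :=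
  Iff.rfl

lemma map_mem {U : AddSubgroup V} {U' : AddSubgroup V'} {φ : V →+ V'} (h : ∀ v ∈ U, φ v ∈ U') :
    ∀ {n : ℕ} {p : ℤ} {z : Kos V n}, z ∈ chains U n p → map φ n z ∈ chains U' n p
  | 0, p, z, hz => by
    rw [mem_chains_zero] at hz ⊢
    rcases hz with ⟨hp, hz⟩ | rfl
    · exact Or.inl ⟨hp, h _ hz⟩
    · exact Or.inr (map_zero _)
  | n + 1, p, (a, b), hz => ⟨map_mem h hz.1, map_mem h hz.2⟩

lemma chains_mono {U U' : AddSubgroup V} (h : U ≤ U') :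
    ∀ {n : ℕ} {p : ℤ} {z : Kos V n}, z ∈ chains U n p → z ∈ chains U' n p
  | 0, p, z, hz => by
    rw [mem_chains_zero] at hz ⊢
    exact hz.imp_left fun hz => ⟨hz.1, h hz.2⟩
  | n + 1, p, (a, b), hz => ⟨chains_mono h hz.1, chains_mono h hz.2⟩

/-- Chain groups are finite sums of copies of the coefficients, so lifting modulo `B` is done
coordinatewise; compatibility with differentials plays no role. -/
lemma exists_sub_map_mem {U B : AddSubgroup V} {A : AddSubgroup V'} {φ : V' →+ V}
    (h : ∀ v ∈ U, ∃ a ∈ A, v - φ a ∈ B) :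
    ∀ {n : ℕ} {p : ℤ} {z : Kos V n}, z ∈ chains U n p →
      ∃ w ∈ chains A n p, z - map φ n w ∈ chains B n p
  | 0, p, z, hz => by
    rw [mem_chains_zero] at hz
    rcases hz with ⟨rfl, hz⟩ | rfl
    · obtain ⟨a, ha, hb⟩ := h _ hz
      exact ⟨a, mem_chains_zero.2 (Or.inl ⟨rfl, ha⟩), mem_chains_zero.2 (Or.inl ⟨rfl, hb⟩)⟩
    · exact ⟨0, zero_mem _, by rw [map_zero, sub_zero]; exact zero_mem _⟩
  | n + 1, p, (a, b), hz => by
    obtain ⟨a', ha, ha'⟩ := exists_sub_map_mem h hz.1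
    obtain ⟨b', hb, hb'⟩ := exists_sub_map_mem h hz.2
    exact ⟨(a', b'), ⟨ha, hb⟩, ha', hb'⟩

lemma chains_bot : ∀ {n : ℕ} {p : ℤ} {z : Kos V n}, z ∈ chains (⊥ : AddSubgroup V) n p → z = 0
  | 0, p, z, hz => by
    rw [mem_chains_zero] at hz
    rcases hz with ⟨_, hz⟩ | rfl
    · exact hz
    · rfl
  | n + 1, p, (a, b), hz => Prod.ext (chains_bot hz.1) (chains_bot hz.2)

lemma exists_map_eq {U : AddSubgroup V} {A : AddSubgroup V'} {φ : V' →+ V}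
    (h : ∀ v ∈ U, ∃ a ∈ A, φ a = v) {n : ℕ} {p : ℤ} {z : Kos V n} (hz : z ∈ chains U n p) :
    ∃ w ∈ chains A n p, map φ n w = z := by
  obtain ⟨w, hw, hw'⟩ := exists_sub_map_mem (B := ⊥) (φ := φ) (A := A) (fun v hv => by
    obtain ⟨a, ha, rfl⟩ := h v hv
    exact ⟨a, ha, by simp⟩) hz
  exact ⟨w, hw, (sub_eq_zero.1 (chains_bot hw')).symm⟩

lemma mem_of_map_mem {U U'' : AddSubgroup V} {U' : AddSubgroup V'} {φ : V →+ V'}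
    (h : ∀ v ∈ U, φ v ∈ U' → v ∈ U'') :
    ∀ {n : ℕ} {p : ℤ} {z : Kos V n}, z ∈ chains U n p → map φ n z ∈ chains U' n p →
      z ∈ chains U'' n p
  | 0, p, z, hz, hz' => by
    rw [mem_chains_zero] at hz ⊢
    rcases hz with ⟨rfl, hz⟩ | rfl
    · refine Or.inl ⟨rfl, h _ hz ?_⟩
      rcases mem_chains_zero.1 hz' with ⟨_, h⟩ | h
      · exact h
      · exact (show φ z = 0 from h) ▸ zero_mem U'
    · exact Or.inr rfl
  | n + 1, p, (a, b), hz, hz' => ⟨mem_of_map_mem h hz.1 hz'.1, mem_of_map_mem h hz.2 hz'.2⟩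

lemma diff_mem : ∀ {n : ℕ} {x : Fin n → V →+ V} {U U' : AddSubgroup V}
    (_ : ∀ i, ∀ v ∈ U, x i v ∈ U') {p : ℤ} {z : Kos V n}, z ∈ chains U n p →
      diff n x z ∈ chains U' n (p - 1)
  | 0, _, _, _, _, _, _, _ => zero_mem _
  | n + 1, x, U, U', h, p, (a, b), hz => by
    refine ⟨add_mem (diff_mem (fun i => h i.succ) hz.1) (map_mem (h 0) hz.2), ?_⟩
    exact (chains U' n (p - 1 - 1)).neg_mem (diff_mem (fun i => h i.succ) hz.2)

lemma map_map {V'' : Type u} [AddCommGroup V''] (φ : V →+ V') (ψ : V' →+ V'') :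
    ∀ (n : ℕ) (z : Kos V n), map ψ n (map φ n z) = map (ψ.comp φ) n z
  | 0, _ => rfl
  | n + 1, (a, b) => by exact congr_arg₂ mk (map_map φ ψ n a) (map_map φ ψ n b)

lemma map_id : ∀ (n : ℕ) (z : Kos V n), map (AddMonoidHom.id V) n z = z
  | 0, _ => rfl
  | n + 1, (a, b) => by exact congr_arg₂ mk (map_id n a) (map_id n b)

lemma map_diff {φ : V →+ V'} : ∀ {n : ℕ} {x : Fin n → V →+ V} {x' : Fin n → V' →+ V'}
    (_ : ∀ i v, φ (x i v) = x' i (φ v)) (z : Kos V n),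
    map φ n (diff n x z) = diff n x' (map φ n z)
  | 0, _, _, _, _ => map_zero _
  | n + 1, x, x', h, (a, b) => by
    have h0 : map φ n (map (x 0) n b) = map (x' 0) n (map φ n b) := by
      rw [map_map, map_map]
      congr 2
      ext v
      exact h 0 v
    have h1 : ∀ z, map φ n (diff n (Fin.tail x) z) = diff n (Fin.tail x') (map φ n z) :=
      map_diff fun i => h i.succ
    change map φ (n + 1) (diff (n + 1) x (mk a b)) = diff (n + 1) x' (map φ (n + 1) (mk a b))
    rw [diff_succ, map_succ, map_succ, diff_succ, map_add, map_neg, h0, h1, h1]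

/-- The sign on the second component of the cone cancels the two cross terms, once `x 0` is moved
past the other operators. -/
lemma diff_diff : ∀ {n : ℕ} {x : Fin n → V →+ V} (_ : ∀ i j v, x i (x j v) = x j (x i v))
    (z : Kos V n), diff n x (diff n x z) = 0
  | 0, _, _, _ => rfl
  | n + 1, x, h, (a, b) => by
    have h1 : ∀ z, diff n (Fin.tail x) (diff n (Fin.tail x) z) = 0 :=
      diff_diff fun i j => h i.succ j.succ
    have h2 : map (x 0) n (diff n (Fin.tail x) b) = diff n (Fin.tail x) (map (x 0) n b) :=
      map_diff (x := Fin.tail x) (x' := Fin.tail x) (fun i v => h 0 i.succ v) b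
    change diff (n + 1) x (diff (n + 1) x (mk a b)) = 0
    rw [diff_succ, diff_succ, map_add, map_neg, map_neg, h1, h1, h2, zero_add, neg_neg,
      add_neg_cancel, mk_zero]

end Kos
end Koszul

/-! ### Exactness of Koszul complexes, extensions and pencils -/

section KoszulExact

variable {V V' : Type u} [AddCommGroup V] [AddCommGroup V'] {n : ℕ}

/-- Exactness of the Koszul complex of the graded object `W` in homological degree `p`, at the
chains with values in `W c`. -/
def KoszulExact (x : Fin n → V →+ V) (W : ℤ → AddSubgroup V) (p c : ℤ) : Prop :=
  ∀ z ∈ Kos.chains (W c) n p, Kos.diff n x z = 0 →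
    ∃ w ∈ Kos.chains (W (c - 1)) n (p + 1), Kos.diff n x w = z

open Kos

/-- Allows a submodule to be replaced by its image in an ambient group, so that all modules to be
compared can share the same operators. -/
lemma koszulExact_iff_of_injective {x : Fin n → V →+ V} {x' : Fin n → V' →+ V'} (φ : V →+ V')
    (hφ : Function.Injective φ) (hx : ∀ i v, φ (x i v) = x' i (φ v)) {W : ℤ → AddSubgroup V}
    {W' : ℤ → AddSubgroup V'} (hW : ∀ c, W' c = (W c).map φ) (p c : ℤ) :
    KoszulExact x W p c ↔ KoszulExact x' W' p c := by
  have hmem : ∀ c, ∀ v ∈ W c, φ v ∈ W' c := fun c v hv => hW c ▸ ⟨v, hv, rfl⟩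
  have hlift : ∀ c, ∀ v ∈ W' c, ∃ a ∈ W c, φ a = v := fun c v hv => by
    rw [hW] at hv
    exact hv
  have hinj' : ∀ q (z : Kos V n), z ∈ chains (⊤ : AddSubgroup V) n q → map φ n z = 0 → z = 0 := by
    intro q z hz h0
    refine chains_bot (mem_of_map_mem (φ := φ) (U' := ⊥) (fun v _ hv => ?_) hz
      (h0 ▸ zero_mem (chains (⊥ : AddSubgroup V') n q)))
    exact (AddSubgroup.mem_bot).2 (hφ ((AddSubgroup.mem_bot.1 hv).trans (map_zero φ).symm))
  constructor
  · intro h z' hz' hd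
    obtain ⟨z, hz, rfl⟩ := exists_map_eq (hlift c) hz'
    rw [← map_diff hx] at hd
    obtain ⟨w, hw, rfl⟩ := h z hz (hinj' _ _ (diff_mem (U' := ⊤) (fun _ _ _ => AddSubgroup.mem_top _) (chains_mono le_top hz)) hd)
    exact ⟨map φ n w, map_mem (hmem _) hw, (map_diff hx w).symm⟩
  · intro h z hz hd
    obtain ⟨w', hw', hw⟩ := h (map φ n z) (map_mem (hmem c) hz) (by rw [← map_diff hx, hd, map_zero])
    obtain ⟨w, hw1, rfl⟩ := exists_map_eq (hlift _) hw'
    refine ⟨w, hw1, ?_⟩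
    have h1 : diff n x w ∈ chains (⊤ : AddSubgroup V) n p := by
      have := diff_mem (x := x) (U' := ⊤) (fun _ _ _ => AddSubgroup.mem_top _) (chains_mono le_top hw1)
      rwa [add_sub_cancel_right] at this
    refine sub_eq_zero.1 (hinj' p _ (sub_mem h1 (chains_mono le_top hz)) ?_)
    rw [map_sub, map_diff hx, hw, sub_self]

/-- The middle term of a short exact sequence `0 → A → B → C(-e) → 0`. -/
lemma KoszulExact.of_extension {x : Fin n → V →+ V} {x' : Fin n → V' →+ V'} (φ : V →+ V')
    (hx : ∀ i v, φ (x i v) = x' i (φ v)) {A B : ℤ → AddSubgroup V} {C : ℤ → AddSubgroup V'} {e : ℤ}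
    (hxx : ∀ i j v, x i (x j v) = x j (x i v)) (hAB : ∀ c, A c ≤ B c)
    (hB : ∀ c i, ∀ v ∈ B c, x i v ∈ B (c + 1))
    (hBC : ∀ c, ∀ v ∈ B c, φ v ∈ C (c - e)) (hlift : ∀ c, ∀ u ∈ C (c - e), ∃ v ∈ B c, φ v = u)
    (hker : ∀ c, ∀ v ∈ B c, φ v = 0 → v ∈ A c) {p c : ℤ} (h1 : KoszulExact x A p c)
    (h2 : KoszulExact x' C p (c - e)) : KoszulExact x B p c := by
  intro z hz hd
  obtain ⟨u, hu, hu'⟩ := h2 (map φ n z) (map_mem (hBC c) hz) (by rw [← map_diff hx, hd, map_zero])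
  rw [show c - e - 1 = c - 1 - e by ring] at hu
  obtain ⟨w, hw, rfl⟩ := exists_map_eq (hlift _) hu
  have hdw : diff n x w ∈ chains (B c) n p := by
    have := diff_mem (hB _) hw
    rwa [add_sub_cancel_right, sub_add_cancel] at this
  -- Corrected by a boundary, the cycle dies in `C`, so its coefficients lie in `A`.
  have h3 : z - diff n x w ∈ chains (A c) n p := by
    refine mem_of_map_mem (φ := φ) (U := B c) (U' := ⊥) (fun v hv hv0 => hker c v hv hv0)
      (sub_mem hz hdw) ?_
    rw [map_sub, map_diff hx, hu', sub_self]
    exact zero_mem _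
  obtain ⟨v, hv, hv'⟩ := h1 _ h3 (by rw [map_sub, hd, diff_diff hxx, sub_zero])
  exact ⟨v + w, add_mem (chains_mono (hAB _) hv) hw, by rw [map_add, hv', sub_add_cancel]⟩

/-- A graded object `J` with operators `x`, presented by `0 → M(-1) ⊗ k[x₀] → M' ⊗ k[x₀] → J → 0`,
where `M` and `M'` are stable under the other operators. -/
structure IsPencil (x : Fin (n + 1) → V →+ V) (J M M' : ℤ → AddSubgroup V) : Prop where
  comm : ∀ i j v, x i (x j v) = x j (x i v)
  op_mem : ∀ c i, ∀ v ∈ J c, x i v ∈ J (c + 1)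
  op_succ_mem : ∀ c, ∀ i : Fin n, ∀ v ∈ M' c, x i.succ v ∈ M' (c + 1)
  left_le : ∀ c, M c ≤ J c
  right_le : ∀ c, M' c ≤ J c
  op_zero_mem : ∀ c, ∀ v ∈ M c, x 0 v ∈ M' (c + 1)
  mem_of_op_zero_mem : ∀ c, ∀ v ∈ J c, x 0 v ∈ M' (c + 1) → v ∈ M c
  exists_sub_mem : ∀ c, ∀ v ∈ J c, ∃ w ∈ J (c - 1), v - x 0 w ∈ M' c

namespace IsPencil

variable {x : Fin (n + 1) → V →+ V} {J M M' : ℤ → AddSubgroup V}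

lemma map_diff_tail (h : IsPencil x J M M') (z : Kos V n) :
    map (x 0) n (diff n (Fin.tail x) z) = diff n (Fin.tail x) (map (x 0) n z) :=
  map_diff (x := Fin.tail x) (x' := Fin.tail x) (fun i v => h.comm 0 i.succ v) z

lemma diff_tail_diff_tail (h : IsPencil x J M M') (z : Kos V n) : diff n (Fin.tail x) (diff n (Fin.tail x) z) = 0 :=
  diff_diff (fun i j => h.comm i.succ j.succ) z

/-- This is the exactness of `Tor_p(M') → Tor_p(J) → Tor_{p-1}(M)(-1)` at the middle, as a chase in
the cone over `x 0`. The shift by one is absorbed by the drop in `p`, so both hypotheses carry the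
same `c`. -/
lemma koszulExact (h : IsPencil x J M M') {p c : ℤ} (h1 : KoszulExact (Fin.tail x) M' p c)
    (h2 : KoszulExact (Fin.tail x) M (p - 1) c) : KoszulExact x J p c := by
  intro z hz hd
  obtain ⟨a, b, rfl⟩ := exists_eq_mk z
  obtain ⟨ha, hb⟩ := mem_chains_succ.1 hz
  rw [diff_succ, mk_eq_zero, neg_eq_zero] at hd
  obtain ⟨hd1, hd2⟩ := hd
  obtain ⟨w, hw, hw'⟩ := exists_sub_map_mem (h.exists_sub_mem c) ha
  -- Subtracting the boundary of `(0, w)` brings the first component into `M'`. The cycle equation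
  -- then shows that `x₀` times the second component is minus the differential of the first, hence
  -- lies in `M'`; so the second component lies in `M`.
  have hb' : b + diff n (Fin.tail x) w ∈ chains (M c) n (p - 1) := by
    refine mem_of_map_mem (φ := x 0) (U := J c) (U' := M' (c + 1)) (h.mem_of_op_zero_mem c) (add_mem hb ?_) ?_
    · have := diff_mem (x := Fin.tail x) (fun i => h.op_mem _ i.succ) hw
      rwa [sub_add_cancel] at this
    · have := neg_mem (diff_mem (x := Fin.tail x) (h.op_succ_mem _) hw')
      convert this using 1
      rw [map_add, map_diff_tail h, map_sub, neg_sub, eq_sub_iff_add_eq, add_right_comm,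
        add_comm (map _ _ b), hd1, zero_add]
  obtain ⟨v, hv, hv'⟩ := h2 _ hb' (by rw [map_add, hd2, diff_tail_diff_tail h, add_zero])
  rw [sub_add_cancel] at hv
  have ha' : a - map (x 0) n w + map (x 0) n v ∈ chains (M' c) n p := by
    refine add_mem hw' ?_
    have := map_mem (n := n) (p := p) (h.op_zero_mem (c - 1)) hv
    rwa [sub_add_cancel] at this
  obtain ⟨y, hy, hy'⟩ := h1 _ ha' (by
    rw [map_add, map_sub, ← map_diff_tail h, ← map_diff_tail h, hv', map_add, sub_add_add_cancel,
      hd1])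
  refine ⟨Kos.mk y (w - v), mem_chains_succ.2 ⟨chains_mono (h.right_le _) hy, ?_⟩, ?_⟩
  · rw [add_sub_cancel_right]
    exact sub_mem hw (chains_mono (h.left_le _) hv)
  · rw [diff_succ, mk_inj, hy', map_sub, map_sub, hv']
    constructor <;> abel

/-- The connecting map from `Tor_{p+1}(J)` to `Tor_p(M)(-1)` is followed by multiplication by `x₀`
into `Tor_p(M')`; if both neighbours vanish, so does the middle. Coefficients of `M'` are needed one
degree higher than those of `M`. -/
lemma koszulExact_left (h : IsPencil x J M M') {p c : ℤ} (h1 : KoszulExact x J (p + 1) c)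
    (h2 : KoszulExact (Fin.tail x) M' p (c + 1)) : KoszulExact (Fin.tail x) M p c := by
  intro z hz hd
  obtain ⟨y, hy, hy'⟩ := h2 _ (map_mem (h.op_zero_mem c) hz) (by rw [← map_diff_tail h, hd, map_zero])
  rw [add_sub_cancel_right] at hy
  -- A primitive `y` of `x₀ z` turns `(y, -z)` into a cycle over `J`; the second component of its
  -- primitive bounds `z`, but only over `J`.
  obtain ⟨w, hw, hd'⟩ := h1 (Kos.mk y (-z))
    (mem_chains_succ.2 ⟨chains_mono (h.right_le _) hy, by
      rw [add_sub_cancel_right]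
      exact neg_mem (chains_mono (h.left_le _) hz)⟩) (by
      rw [diff_succ, hy', map_neg, map_neg, hd, neg_zero, neg_zero, add_neg_cancel, mk_zero])
  obtain ⟨u, u', rfl⟩ := exists_eq_mk w
  obtain ⟨hu, hu'⟩ := mem_chains_succ.1 hw
  rw [diff_succ, mk_inj, neg_inj] at hd'
  obtain ⟨e1, e2⟩ := hd'
  rw [add_sub_cancel_right] at hu'
  obtain ⟨w, hw, hw'⟩ := exists_sub_map_mem (h.exists_sub_mem (c - 1)) hu
  refine ⟨u' + diff n (Fin.tail x) w, ?_, by rw [map_add, diff_tail_diff_tail h, add_zero, e2]⟩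
  have hdw : diff n (Fin.tail x) w ∈ chains (J (c - 1)) n (p + 1) := by
    have := diff_mem (x := Fin.tail x) (fun i => h.op_mem _ i.succ) hw
    rwa [sub_add_cancel, add_sub_cancel_right] at this
  refine mem_of_map_mem (φ := x 0) (U := J (c - 1)) (U' := M' c) ?_ (add_mem hu' hdw) ?_
  · intro v hv hv'
    exact h.mem_of_op_zero_mem _ v hv (by rwa [sub_add_cancel])
  · have h3 := diff_mem (x := Fin.tail x) (h.op_succ_mem _) hw'
    rw [sub_add_cancel, add_sub_cancel_right] at h3
    convert sub_mem hy h3 using 1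
    rw [map_add, map_sub, h.map_diff_tail, ← e1]
    abel

end IsPencil

end KoszulExact

section GradedCover

variable {V V' : Type u} [AddCommGroup V] [AddCommGroup V'] {n : ℕ}

open Kos

/-! ### Dimension shifting -/

/-- A short exact sequence `0 → A → B → C → 0` of graded objects. -/
structure IsGradedCover (x : Fin n → V →+ V) (x' : Fin n → V' →+ V') (φ : V →+ V')
    (A B : ℤ → AddSubgroup V) (C : ℤ → AddSubgroup V') : Prop where
  map_op : ∀ i v, φ (x i v) = x' i (φ v)
  comm : ∀ i j v, x i (x j v) = x j (x i v)
  op_mem : ∀ c i, ∀ v ∈ B c, x i v ∈ B (c + 1)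
  mem_target : ∀ c u, u ∈ C c ↔ ∃ v ∈ B c, φ v = u
  mem_kernel : ∀ c v, v ∈ A c ↔ v ∈ B c ∧ φ v = 0

namespace IsGradedCover

variable {x : Fin n → V →+ V} {x' : Fin n → V' →+ V'} {φ : V →+ V'}
  {A B : ℤ → AddSubgroup V} {C : ℤ → AddSubgroup V'}

lemma mem_chains (h : IsGradedCover x x' φ A B C) {p c : ℤ} {z : Kos V n}
    (hz : z ∈ chains (B c) n p) (h0 : Kos.map φ n z = 0) : z ∈ chains (A c) n p :=
  mem_of_map_mem (φ := φ) (U' := ⊥) (fun v hv h0 => (h.mem_kernel c v).2 ⟨hv, h0⟩) hz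
    (h0 ▸ zero_mem _)

lemma map_chains (h : IsGradedCover x x' φ A B C) {p c : ℤ} {z : Kos V n}
    (hz : z ∈ chains (A c) n p) : z ∈ chains (B c) n p ∧ Kos.map φ n z = 0 :=
  ⟨chains_mono (fun v hv => ((h.mem_kernel c v).1 hv).1) hz,
    chains_bot (map_mem (fun v hv => ((h.mem_kernel c v).1 hv).2) hz)⟩

/-- Vanishing of `H_{p+1}(C)` makes `H_p(A) → H_p(B)` injective: lift a primitive of the image of
`w` in `C` and subtract its boundary from `w`. -/
lemma exists_boundary (h : IsGradedCover x x' φ A B C) {p c : ℤ}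
    (h1 : KoszulExact x' C (p + 1) c) {w : Kos V n} (hw : w ∈ chains (B c) n (p + 1))
    (hdw : diff n x w ∈ chains (A (c + 1)) n p) :
    ∃ w' ∈ chains (A c) n (p + 1), diff n x w' = diff n x w := by
  obtain ⟨y, hy, hy'⟩ := h1 (Kos.map φ n w)
    (map_mem (fun v hv => (h.mem_target c _).2 ⟨v, hv, rfl⟩) hw)
    (by rw [← map_diff h.map_op, (h.map_chains hdw).2])
  obtain ⟨u, hu, rfl⟩ := exists_map_eq (fun v hv => (h.mem_target (c - 1) v).1 hv) hy
  refine ⟨w - diff n x u, h.mem_chains (sub_mem hw ?_) ?_, ?_⟩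
  · have := diff_mem (h.op_mem _) hu
    rwa [sub_add_cancel, add_sub_cancel_right] at this
  · rw [map_sub, map_diff h.map_op, hy', sub_self]
  · rw [map_sub, diff_diff h.comm, sub_zero]

/-- Converse of `exists_boundary`, for which `H_{p+1}(B)` must vanish. The injectivity is kept as a
hypothesis because for `p = 0` it cannot be replaced by the vanishing of `H_0(A)`. -/
lemma koszulExact_target (h : IsGradedCover x x' φ A B C) {p c : ℤ}
    (h1 : KoszulExact x B (p + 1) c)
    (h2 : ∀ w ∈ chains (B c) n (p + 1), diff n x w ∈ chains (A (c + 1)) n p →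
      ∃ w' ∈ chains (A c) n (p + 1), diff n x w' = diff n x w) :
    KoszulExact x' C (p + 1) c := by
  intro z hz hd
  obtain ⟨w, hw, rfl⟩ := exists_map_eq (fun v hv => (h.mem_target c v).1 hv) hz
  have h3 : diff n x w ∈ chains (A (c + 1)) n p := by
    refine h.mem_chains ?_ (by rw [map_diff h.map_op, hd])
    have := diff_mem (h.op_mem _) hw
    rwa [add_sub_cancel_right] at this
  obtain ⟨w', hw', e⟩ := h2 w hw h3
  obtain ⟨u, hu, hu'⟩ := h1 (w - w') (sub_mem hw (h.map_chains hw').1) (by rw [map_sub, e, sub_self])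
  exact ⟨Kos.map φ n u, map_mem (fun v hv => (h.mem_target _ _).2 ⟨v, hv, rfl⟩) hu, by
    rw [← map_diff h.map_op, hu', map_sub, (h.map_chains hw').2, sub_zero]⟩

lemma koszulExact_target_of_kernel (h : IsGradedCover x x' φ A B C) {p c : ℤ}
    (h1 : KoszulExact x B (p + 1) c) (h2 : KoszulExact x A p (c + 1)) :
    KoszulExact x' C (p + 1) c := by
  refine h.koszulExact_target h1 fun w _ hdw => ?_
  have := h2 _ hdw (diff_diff h.comm w)
  rwa [add_sub_cancel_right] at this

lemma koszulExact_kernel (h : IsGradedCover x x' φ A B C) {p c : ℤ}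
    (h1 : KoszulExact x B p (c + 1)) (h2 : KoszulExact x' C (p + 1) c) :
    KoszulExact x A p (c + 1) := by
  intro z hz hd
  obtain ⟨w, hw, rfl⟩ := h1 z (h.map_chains hz).1 hd
  rw [add_sub_cancel_right] at hw ⊢
  exact h.exists_boundary h2 hw hz

end IsGradedCover

/-! ### Homological degree zero -/

/-- An element of `V`, as a chain of degree `0`. -/
def Kos.ofDegreeZero : ∀ n, V → Kos V n
  | 0, v => v
  | n + 1, v => Kos.mk (ofDegreeZero n v) 0

lemma Kos.chains_of_neg {U : AddSubgroup V} : ∀ {n : ℕ} {p : ℤ} {z : Kos V n}, p < 0 →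
    z ∈ chains U n p → z = 0
  | 0, p, z, hp, hz => by
    rcases mem_chains_zero.1 hz with ⟨h, _⟩ | h
    · omega
    · exact h
  | n + 1, p, (a, b), hp, hz =>
    mk_eq_zero.2 ⟨chains_of_neg hp hz.1, chains_of_neg (by omega) hz.2⟩

lemma Kos.ofDegreeZero_mem {U : AddSubgroup V} {v : V} (hv : v ∈ U) :
    ∀ n, ofDegreeZero n v ∈ chains U n 0
  | 0 => mem_chains_zero.2 (Or.inl ⟨rfl, hv⟩)
  | n + 1 => mem_chains_succ.2 ⟨ofDegreeZero_mem hv n, zero_mem _⟩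

lemma Kos.ofDegreeZero_injective : ∀ n, Function.Injective (ofDegreeZero (V := V) n)
  | 0 => fun _ _ h => h
  | n + 1 => fun _ _ h => ofDegreeZero_injective n (mk_inj.1 h).1

lemma Kos.ofDegreeZero_add (v w : V) :
    ∀ n, ofDegreeZero n (v + w) = ofDegreeZero n v + ofDegreeZero n w
  | 0 => rfl
  | n + 1 => by
    rw [ofDegreeZero, ofDegreeZero, ofDegreeZero, mk_add, ofDegreeZero_add v w n, add_zero]

lemma Kos.map_ofDegreeZero (φ : V →+ V') (v : V) :
    ∀ n, map φ n (ofDegreeZero n v) = ofDegreeZero n (φ v)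
  | 0 => rfl
  | n + 1 => by rw [ofDegreeZero, ofDegreeZero, map_succ, map_ofDegreeZero φ v n, map_zero]

lemma Kos.mem_chains_zero_iff {U : AddSubgroup V} : ∀ {n : ℕ} {z : Kos V n},
    z ∈ chains U n 0 ↔ ∃ v ∈ U, z = ofDegreeZero n v
  | 0, z => by
    rw [mem_chains_zero]
    constructor
    · rintro (⟨_, h⟩ | rfl)
      · exact ⟨z, h, rfl⟩
      · exact ⟨0, zero_mem _, rfl⟩
    · rintro ⟨v, hv, rfl⟩
      exact Or.inl ⟨rfl, hv⟩
  | n + 1, z => by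
    constructor
    · intro hz
      obtain ⟨a, b, rfl⟩ := exists_eq_mk z
      obtain ⟨ha, hb⟩ := mem_chains_succ.1 hz
      obtain ⟨v, hv, rfl⟩ := mem_chains_zero_iff.1 ha
      exact ⟨v, hv, mk_inj.2 ⟨rfl, chains_of_neg (by omega) hb⟩⟩
    · rintro ⟨v, hv, rfl⟩
      exact ofDegreeZero_mem hv _

lemma Kos.diff_ofDegreeZero (v : V) :
    ∀ (n : ℕ) (x : Fin n → V →+ V), diff n x (ofDegreeZero n v) = 0
  | 0, _ => rfl
  | n + 1, x => by
    rw [ofDegreeZero, diff_succ, diff_ofDegreeZero v n, map_zero, map_zero, add_zero, neg_zero,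
      mk_zero]

lemma Kos.exists_diff_eq_sum {U : AddSubgroup V} : ∀ {n : ℕ} (x : Fin n → V →+ V)
    {w : Kos V n} (_ : w ∈ chains U n 1),
    ∃ u : Fin n → V, (∀ i, u i ∈ U) ∧ diff n x w = ofDegreeZero n (∑ i, x i (u i))
  | 0, x, w, hw => ⟨fun _ => 0, fun _ => zero_mem _, by
      rw [Finset.univ_eq_empty, Finset.sum_empty]; rfl⟩
  | n + 1, x, w, hw => by
    obtain ⟨a, b, rfl⟩ := exists_eq_mk w
    obtain ⟨ha, hb⟩ := mem_chains_succ.1 hw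
    rw [sub_self] at hb
    obtain ⟨v, hv, rfl⟩ := mem_chains_zero_iff.1 hb
    obtain ⟨u, hu, e⟩ := exists_diff_eq_sum (Fin.tail x) ha
    refine ⟨Fin.cons v u, fun i => ?_, ?_⟩
    · refine Fin.cases ?_ (fun i => ?_) i
      · exact hv
      · exact hu i
    · rw [diff_succ, diff_ofDegreeZero, neg_zero, e, map_ofDegreeZero, ← ofDegreeZero_add,
        Fin.sum_univ_succ, add_comm (∑ i, Fin.tail x i (u i))]
      rfl

lemma Kos.exists_mem_diff_eq {U : AddSubgroup V} : ∀ {n : ℕ} (x : Fin n → V →+ V)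
    {u : Fin n → V} (_ : ∀ i, u i ∈ U),
    ∃ w ∈ chains U n 1, diff n x w = ofDegreeZero n (∑ i, x i (u i))
  | 0, x, u, hu => ⟨0, zero_mem _, by
      rw [Finset.univ_eq_empty, Finset.sum_empty]; rfl⟩
  | n + 1, x, u, hu => by
    obtain ⟨a, ha, e⟩ := exists_mem_diff_eq (Fin.tail x) (u := Fin.tail u) (fun i => hu i.succ)
    refine ⟨Kos.mk a (ofDegreeZero n (u 0)), mem_chains_succ.2 ⟨ha, ?_⟩, ?_⟩
    · rw [sub_self]
      exact ofDegreeZero_mem (hu 0) n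
    · rw [diff_succ, diff_ofDegreeZero, neg_zero, e, map_ofDegreeZero, ← ofDegreeZero_add,
        Fin.sum_univ_succ, add_comm (∑ i, Fin.tail x i (Fin.tail u i))]
      rfl

/-- `H_0` is the quotient of the coefficients by the images of the operators, as degree-one
boundaries are exactly the sums `∑ x_i u_i`. -/
lemma koszulExact_zero_iff {x : Fin n → V →+ V} {W : ℤ → AddSubgroup V} {c : ℤ} :
    KoszulExact x W 0 c ↔
      ∀ v ∈ W c, ∃ u : Fin n → V, (∀ i, u i ∈ W (c - 1)) ∧ v = ∑ i, x i (u i) := by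
  constructor
  · intro h v hv
    obtain ⟨w, hw, e⟩ := h _ (ofDegreeZero_mem hv n) (diff_ofDegreeZero v n x)
    rw [zero_add] at hw
    obtain ⟨u, hu, e'⟩ := exists_diff_eq_sum x hw
    exact ⟨u, hu, ofDegreeZero_injective n (e.symm.trans e')⟩
  · intro h z hz _
    obtain ⟨v, hv, rfl⟩ := mem_chains_zero_iff.1 hz
    obtain ⟨u, hu, rfl⟩ := h v hv
    rw [zero_add]
    exact exists_mem_diff_eq x hu

/-- If the middle term is acyclic in degree `1`, then exactness of the target in degree `1` is a
statement about the kernel. -/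
lemma IsGradedCover.koszulExact_one_iff {x : Fin n → V →+ V} {x' : Fin n → V' →+ V'} {φ : V →+ V'}
    {A B : ℤ → AddSubgroup V} {C : ℤ → AddSubgroup V'} (h : IsGradedCover x x' φ A B C) {c : ℤ}
    (h1 : KoszulExact x B 1 c) :
    KoszulExact x' C 1 c ↔ ∀ u : Fin n → V, (∀ i, u i ∈ B c) → ∑ i, x i (u i) ∈ A (c + 1) →
      ∃ u' : Fin n → V, (∀ i, u' i ∈ A c) ∧ ∑ i, x i (u i) = ∑ i, x i (u' i) := by
  constructor
  · intro h2 u hu hs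
    obtain ⟨w, hw, e⟩ := exists_mem_diff_eq x hu
    obtain ⟨w', hw', e'⟩ := h.exists_boundary (p := 0) h2 hw (e ▸ ofDegreeZero_mem hs n)
    obtain ⟨u', hu', e''⟩ := exists_diff_eq_sum x hw'
    exact ⟨u', hu', ofDegreeZero_injective n (by rw [← e, ← e', e''])⟩
  · intro h2
    refine h.koszulExact_target (p := 0) h1 fun w hw hdw => ?_
    obtain ⟨u, hu, e⟩ := exists_diff_eq_sum x hw
    rw [e] at hdw ⊢
    obtain ⟨v, hv, e'⟩ := mem_chains_zero_iff.1 hdw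
    rw [← ofDegreeZero_injective n e'] at hv
    obtain ⟨u', hu', e''⟩ := h2 u hu hv
    rw [e'']
    exact exists_mem_diff_eq x hu'

/-! ### Acyclicity for operators which split -/

/-- `δ i` is a partial inverse of `x i` commuting with everything else, such as the division of
polynomials by a variable. -/
structure IsSplitting (x δ : Fin n → V →+ V) (W : ℤ → AddSubgroup V) : Prop where
  op_mem : ∀ c i, ∀ v ∈ W c, x i v ∈ W (c + 1)
  inv_mem : ∀ c i, ∀ v ∈ W c, δ i v ∈ W (c - 1)
  inv_op : ∀ i v, δ i (x i v) = v
  inv_op_of_ne : ∀ i j v, i ≠ j → δ i (x j v) = x j (δ i v)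
  op_comm : ∀ i j v, x i (x j v) = x j (x i v)
  inv_comm : ∀ i j v, δ i (δ j v) = δ j (δ i v)

/-- The kernel of `δ 0` is a complement to the image of `x 0`, and the remaining operators still
split on it. This gives an induction on the number of operators. -/
lemma IsSplitting.koszulExact : ∀ {n : ℕ} {x δ : Fin n → V →+ V} {W : ℤ → AddSubgroup V}
    (_ : IsSplitting x δ W) {p : ℤ} (_ : 0 < p) (c : ℤ), KoszulExact x W p c
  | 0, x, δ, W, h, p, hp, c => by
    intro z hz _
    rcases mem_chains_zero.1 hz with ⟨h, _⟩ | rfl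
    · omega
    · exact ⟨0, zero_mem _, rfl⟩
  | n + 1, x, δ, W, h, p, hp, c => by
    have h' : IsSplitting (Fin.tail x) (Fin.tail δ) (fun c => W c ⊓ (δ 0).ker) :=
      { op_mem := fun c i v hv => ⟨h.op_mem c i.succ v hv.1, by
          change δ 0 (x i.succ v) = 0
          rw [h.inv_op_of_ne _ _ _ (Fin.succ_ne_zero i).symm, (show δ 0 v = 0 from hv.2), map_zero]⟩
        inv_mem := fun c i v hv => ⟨h.inv_mem c i.succ v hv.1, by
          change δ 0 (δ i.succ v) = 0
          rw [h.inv_comm, (show δ 0 v = 0 from hv.2), map_zero]⟩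
        inv_op := fun i => h.inv_op i.succ
        inv_op_of_ne := fun i j v hij => h.inv_op_of_ne _ _ v (fun e => hij (Fin.succ_injective _ e))
        op_comm := fun i j => h.op_comm i.succ j.succ
        inv_comm := fun i j => h.inv_comm i.succ j.succ }
    intro z hz hd
    obtain ⟨a, b, rfl⟩ := exists_eq_mk z
    obtain ⟨ha, hb⟩ := mem_chains_succ.1 hz
    rw [diff_succ, mk_eq_zero, neg_eq_zero] at hd
    obtain ⟨hd1, hd2⟩ := hd
    have c1 : ∀ w, map (x 0) n (diff n (Fin.tail x) w) = diff n (Fin.tail x) (map (x 0) n w) :=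
      map_diff (x := Fin.tail x) (x' := Fin.tail x) fun i v => h.op_comm 0 i.succ v
    have c2 : ∀ w, map (δ 0) n (diff n (Fin.tail x) w) = diff n (Fin.tail x) (map (δ 0) n w) :=
      map_diff (x := Fin.tail x) (x' := Fin.tail x)
        fun i v => h.inv_op_of_ne 0 i.succ v (Fin.succ_ne_zero i).symm
    have c3 : ∀ w, map (δ 0) n (map (x 0) n w) = w := fun w => by
      rw [map_map, show (δ 0).comp (x 0) = AddMonoidHom.id V from AddMonoidHom.ext (h.inv_op 0),
        map_id]
    have hDa : map (δ 0) n a ∈ chains (W (c - 1)) n p := map_mem (h.inv_mem c 0) ha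
    -- Applying `δ 0` to the cycle equation determines `b`. Subtracting the boundary of `(0, δ₀ a)`
    -- therefore leaves `(a - x₀ δ₀ a, 0)`, a cycle over the kernel of `δ 0`.
    have hb' : b = -diff n (Fin.tail x) (map (δ 0) n a) := by
      have := congr_arg (map (δ 0) n) hd1
      rw [map_add, c2, c3, map_zero] at this
      exact (neg_eq_of_add_eq_zero_right this).symm
    obtain ⟨w, hw, e⟩ := IsSplitting.koszulExact h' hp c (a - map (x 0) n (map (δ 0) n a))
      (mem_of_map_mem (φ := δ 0) (U := W c) (U' := ⊥)
        (U'' := W c ⊓ (δ 0).ker) (fun v hv hv' => ⟨hv, hv'⟩)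
        (sub_mem ha (by
          have := map_mem (n := n) (p := p) (h.op_mem (c - 1) 0) hDa
          rwa [sub_add_cancel] at this))
        (by rw [map_sub, c3, sub_self]; exact zero_mem _))
      (by rw [map_sub, ← c1, ← sub_eq_zero.2 hd1, hb', map_neg]; abel)
    refine ⟨Kos.mk w (map (δ 0) n a), mem_chains_succ.2 ⟨chains_mono (U := W (c - 1) ⊓ (δ 0).ker) (fun v hv => hv.1) hw, ?_⟩, ?_⟩
    · rwa [add_sub_cancel_right]
    · rw [diff_succ, e, sub_add_cancel, ← hb']

end GradedCover

open MvPolynomial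

/-! ### Graded modules over a polynomial ring -/

section Graded

lemma degree_of_mem_support {σ : Type} {k : Type u} [Field k] {f : MvPolynomial σ k} {i : ℕ}
    (hf : f.IsHomogeneous i) {m : σ →₀ ℕ} (hm : m ∈ f.support) : m.degree = i :=
  (DFunLike.congr_fun (Finsupp.degree_eq_weight_one (R := ℕ)) m).trans (hf (mem_support_iff.1 hm))

/-- Extension by zero of a grading to negative degrees. -/
def extendGrading {V : Type u} [AddCommGroup V] (𝓥 : ℕ → AddSubgroup V) (c : ℤ) : AddSubgroup V :=
  if 0 ≤ c then 𝓥 c.toNat else ⊥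

lemma extendGrading_natCast {V : Type u} [AddCommGroup V] (𝓥 : ℕ → AddSubgroup V) (j : ℕ) :
    extendGrading 𝓥 (j : ℤ) = 𝓥 j := by
  simp [extendGrading]

lemma extendGrading_of_neg {V : Type u} [AddCommGroup V] (𝓥 : ℕ → AddSubgroup V) {c : ℤ} (hc : c < 0) :
    extendGrading 𝓥 c = ⊥ := by
  simp [extendGrading, not_le.2 hc]

variable {n : ℕ} {k : Type u} [Field k] {V V' : Type u} [AddCommGroup V] [AddCommGroup V']
  [Module (MvPolynomial (Fin n) k) V] [Module (MvPolynomial (Fin n) k) V']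

/-- Multiplication by a variable. -/
noncomputable def mulVar (n : ℕ) (k : Type u) [Field k] (V : Type u) [AddCommGroup V]
    [Module (MvPolynomial (Fin n) k) V] (i : Fin n) : V →+ V :=
  DistribSMul.toAddMonoidHom V (X i : MvPolynomial (Fin n) k)

lemma mulVar_apply (i : Fin n) (v : V) : mulVar n k V i v = (X i : MvPolynomial (Fin n) k) • v := rfl

lemma mulVar_comm (i j : Fin n) (v : V) :
    mulVar n k V i (mulVar n k V j v) = mulVar n k V j (mulVar n k V i v) := by
  simp only [mulVar_apply]
  exact smul_comm _ _ _

lemma map_mulVar (φ : V →ₗ[MvPolynomial (Fin n) k] V') (i : Fin n) (v : V) :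
    φ.toAddMonoidHom (mulVar n k V i v) = mulVar n k V' i (φ.toAddMonoidHom v) :=
  φ.map_smul _ _

/-- `𝓥` is a grading of the module `V`, with projections `π`. -/
structure IsGradedModule (n : ℕ) (k : Type u) [Field k] [Module (MvPolynomial (Fin n) k) V]
    (𝓥 : ℕ → AddSubgroup V) (π : ℕ → V →+ V) : Prop where
  proj_of_mem : ∀ {i j v}, v ∈ 𝓥 i → π j v = if i = j then v else 0
  proj_mem : ∀ j v, π j v ∈ 𝓥 j
  exists_sum_proj : ∀ v, ∃ n, ∑ j ∈ Finset.range n, π j v = v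
  monomial_smul_mem : ∀ {j v} (m : Fin n →₀ ℕ) (c : k), v ∈ 𝓥 j →
    (monomial m c : MvPolynomial (Fin n) k) • v ∈ 𝓥 (j + m.degree)

namespace IsGradedModule

variable {𝓥 : ℕ → AddSubgroup V} {π : ℕ → V →+ V}

lemma smul_mem (h : IsGradedModule n k 𝓥 π) {i j : ℕ} {f : MvPolynomial (Fin n) k} {v : V}
    (hf : f.IsHomogeneous i) (hv : v ∈ 𝓥 j) : f • v ∈ 𝓥 (i + j) := by
  rw [f.as_sum, Finset.sum_smul]
  refine sum_mem fun m hm => ?_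
  have := h.monomial_smul_mem m (coeff m f) hv
  rwa [degree_of_mem_support hf hm, add_comm] at this

lemma mulVar_mem (h : IsGradedModule n k 𝓥 π) (c : ℤ) (i : Fin n) (v : V)
    (hv : v ∈ extendGrading 𝓥 c) : mulVar n k V i v ∈ extendGrading 𝓥 (c + 1) := by
  rcases lt_or_ge c 0 with hc | hc
  · rw [extendGrading_of_neg _ hc, AddSubgroup.mem_bot] at hv
    rw [hv, map_zero]
    exact zero_mem _
  · lift c to ℕ using hc
    rw [extendGrading_natCast] at hv
    rw [show (c : ℤ) + 1 = ((1 + c : ℕ) : ℤ) by push_cast; ring, extendGrading_natCast]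
    exact h.smul_mem (isHomogeneous_X k i) hv

lemma isInternal (h : IsGradedModule n k 𝓥 π) : DirectSum.IsInternal 𝓥 := by
  classical
  have key : ∀ (x : DirectSum ℕ fun i => 𝓥 i) (j : ℕ),
      π j (DirectSum.coeAddMonoidHom 𝓥 x) = x j := by
    intro x j
    induction x using DirectSum.induction_on with
    | zero => simp
    | of i x =>
      rw [DirectSum.coeAddMonoidHom_of, h.proj_of_mem x.2, DirectSum.coe_of_apply]
      split_ifs <;> rfl
    | add x y hx hy => simp [hx, hy]
  constructor
  · rw [injective_iff_map_eq_zero]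
    intro x hx
    ext j
    rw [← key, hx, map_zero]
    rfl
  · intro v
    obtain ⟨n, hn⟩ := h.exists_sum_proj v
    refine ⟨∑ j ∈ Finset.range n, DirectSum.of (fun i => 𝓥 i) j ⟨π j v, h.proj_mem j v⟩, ?_⟩
    rw [map_sum]
    simp only [DirectSum.coeAddMonoidHom_of]
    exact hn

/-- Rules out the default value `0` in `torDim`, which would make Betti numbers vanish for no
reason. -/
lemma nonempty_resolution (h : IsGradedModule n k 𝓥 π) :
    Nonempty (GradedFreeResolution (Fin n) k 𝓥) := by
  classical
  let _ := h.isInternal.chooseDecomposition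
  have : SetLike.GradedSMul (homogeneousSubmodule (Fin n) k) 𝓥 :=
    ⟨fun {_ _ _ _} hf hv => h.smul_mem ((mem_homogeneousSubmodule _ _).1 hf) hv⟩
  exact GradedFreeResolution.exists_resolution 𝓥

end IsGradedModule

/-! ### Graded free modules -/

section Free

variable {ι : Type u} (deg : ι → ℕ)

/-- The homogeneous parts of a graded free module. -/
noncomputable def freeParts (n : ℕ) (k : Type u) [Field k] (j : ℕ) :
    AddSubgroup (ι →₀ MvPolynomial (Fin n) k) :=
  (freeGrading deg j).toAddSubgroup

lemma isGradedModule_free : IsGradedModule n k (freeParts deg n k) (comp deg) where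
  proj_of_mem hv := comp_of_mem deg hv
  proj_mem j v := comp_mem deg j v
  exists_sum_proj v := (sum_comp deg v).imp fun n hn => hn n le_rfl
  monomial_smul_mem _ c hv := smul_free deg c rfl hv

/-- Division by a variable. -/
noncomputable def divVar (i : Fin n) : MvPolynomial (Fin n) k →+ MvPolynomial (Fin n) k where
  toFun f := divMonomial f (Finsupp.single i 1)
  map_zero' := zero_divMonomial _
  map_add' f g := add_divMonomial f g _

lemma coeff_divVar (i : Fin n) (f : MvPolynomial (Fin n) k) (m : Fin n →₀ ℕ) :
    coeff m (divVar i f) = coeff (Finsupp.single i 1 + m) f :=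
  coeff_divMonomial _ _ _

lemma divVar_X_mul_of_ne {i j : Fin n} (hij : i ≠ j) (f : MvPolynomial (Fin n) k) :
    divVar i (X j * f) = X j * divVar i f := by
  classical
  ext m
  rw [coeff_divVar, coeff_X_mul', coeff_X_mul', coeff_divVar]
  have h1 : j ∈ (Finsupp.single i 1 + m).support ↔ j ∈ m.support := by
    simp [hij]
  simp only [h1]
  split_ifs with h
  · congr 1
    ext l
    simp only [Finsupp.tsub_apply, Finsupp.add_apply, Finsupp.single_apply]
    have : m j ≠ 0 := Finsupp.mem_support_iff.1 h
    split_ifs with h1 h2 <;> subst_vars <;> omega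
  · rfl

lemma divVar_comm (i j : Fin n) (f : MvPolynomial (Fin n) k) :
    divVar i (divVar j f) = divVar j (divVar i f) := by
  ext m
  simp only [coeff_divVar]
  rw [add_left_comm]

/-- Division by a variable, which discards the monomials not divisible by it, inverts multiplication
by that variable and commutes with all the others. Free modules are thus Koszul acyclic in positive
degrees. -/
lemma isSplitting_free : IsSplitting (mulVar n k (ι →₀ MvPolynomial (Fin n) k))
    (fun i => Finsupp.mapRange.addMonoidHom (divVar i)) (extendGrading (freeParts deg n k)) where
  op_mem := (isGradedModule_free deg).mulVar_mem
  inv_mem c i v hv := by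
    have key : ∀ a, ∀ m ∈ (divVar i (v a)).support, Finsupp.single i 1 + m ∈ (v a).support := by
      intro a m hm
      rwa [mem_support_iff, coeff_divVar, ← mem_support_iff] at hm
    have hdeg : ∀ m : Fin n →₀ ℕ, (Finsupp.single i 1 + m).degree = m.degree + 1 := by
      intro m
      rw [map_add, Finsupp.degree_single, add_comm]
    rcases lt_or_ge c 0 with hc | hc
    · rw [extendGrading_of_neg _ hc, AddSubgroup.mem_bot] at hv
      rw [hv, map_zero]
      exact zero_mem _
    · lift c to ℕ using hc
      rw [extendGrading_natCast] at hv
      have hv' : ∀ a, ∀ m ∈ (divVar i (v a)).support, deg a + (m.degree + 1) = c := by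
        intro a m hm
        have := hv a _ (key a m hm)
        rwa [hdeg] at this
      -- In degree `0` no monomial is divisible by a variable, so the quotient is zero, as the
      -- extended grading in degree `-1` demands.
      rcases c with _ | c
      · have : (Finsupp.mapRange.addMonoidHom (divVar i)) v = 0 := by
          ext a m
          by_contra hne
          have := hv' a m (mem_support_iff.2 hne)
          omega
        rw [this]
        exact zero_mem _
      · rw [show ((c + 1 : ℕ) : ℤ) - 1 = (c : ℤ) by push_cast; ring, extendGrading_natCast]
        intro a m hm
        have := hv' a m hm
        omega
  inv_op i v := by
    ext1 a
    exact X_mul_divMonomial i (v a)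
  inv_op_of_ne i j v hij := by
    ext1 a
    exact divVar_X_mul_of_ne hij (v a)
  op_comm := mulVar_comm
  inv_comm i j v := by
    ext1 a
    exact divVar_comm i j (v a)

/-- Reduction modulo the maximal ideal generated by the variables. -/
noncomputable def constCoeffs (ι : Type u) (n : ℕ) (k : Type u) [Field k] :
    (ι →₀ MvPolynomial (Fin n) k) →+ (ι →₀ k) :=
  Finsupp.mapRange.addMonoidHom constantCoeff.toAddMonoidHom

/-- The constant lift of an element of the reduction. -/
noncomputable def constLift (ι : Type u) (n : ℕ) (k : Type u) [Field k] :
    (ι →₀ k) →+ (ι →₀ MvPolynomial (Fin n) k) :=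
  Finsupp.mapRange.addMonoidHom C.toAddMonoidHom

lemma constCoeffs_constLift (v : ι →₀ k) : constCoeffs ι n k (constLift ι n k v) = v := by
  ext a
  exact constantCoeff_C _ _

lemma constCoeffs_smul (f : MvPolynomial (Fin n) k) (v : ι →₀ MvPolynomial (Fin n) k) :
    constCoeffs ι n k (f • v) = constantCoeff f • constCoeffs ι n k v := by
  ext a
  exact map_mul constantCoeff f (v a)

lemma constCoeffs_sum_mulVar (u : Fin n → ι →₀ MvPolynomial (Fin n) k) :
    constCoeffs ι n k (∑ i, mulVar n k _ i (u i)) = 0 := by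
  rw [map_sum]
  refine Finset.sum_eq_zero fun i _ => ?_
  rw [mulVar_apply, constCoeffs_smul, constantCoeff_X, zero_smul]

open Classical in
lemma constLift_mem {m : ℕ} {v : ι →₀ k} (hv : v ∈ Finsupp.supported k k {a | deg a = m}) :
    constLift ι n k v ∈ freeParts deg n k m := by
  intro a l hl
  have h1 : l ∈ (C (v a) : MvPolynomial (Fin n) k).support := hl
  by_cases h : v a = 0
  · simp [h] at h1
  · rw [support_C, if_neg h, Finset.mem_singleton] at h1
    have : deg a = m := hv (Finsupp.mem_support_iff.2 h)
    simp [h1, this]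

lemma constCoeffs_mem {m : ℕ} {v : ι →₀ MvPolynomial (Fin n) k} (hv : v ∈ freeParts deg n k m) :
    constCoeffs ι n k v ∈ Finsupp.supported k k {a | deg a = m} := by
  intro a ha
  have h1 : constCoeffs ι n k v a ≠ 0 := Finsupp.mem_support_iff.1 ha
  replace h1 : coeff 0 (v a) ≠ 0 := h1
  have := hv a 0 (mem_support_iff.2 h1)
  simpa using this

/-- Elements without constant terms lie in the product with the maximal ideal, with control of
degrees. Removing the constants and then projecting to degree `j` makes the claim additive in `y`,
so that monomials suffice. -/
lemma exists_sum_mulVar_eq_comp (y : ι →₀ MvPolynomial (Fin n) k) (j : ℕ) :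
    ∃ u : Fin n → ι →₀ MvPolynomial (Fin n) k,
      (∀ i, u i ∈ extendGrading (freeParts deg n k) ((j : ℤ) - 1)) ∧
        comp deg j (y - constLift ι n k (constCoeffs ι n k y)) = ∑ i, mulVar n k _ i (u i) := by
  induction y using free_induction with
  | h0 => exact ⟨0, fun _ => zero_mem _, by simp⟩
  | hadd v w hv hw =>
    obtain ⟨u, hu, e⟩ := hv
    obtain ⟨u', hu', e'⟩ := hw
    refine ⟨u + u', fun i => add_mem (hu i) (hu' i), ?_⟩
    rw [map_add, map_add, add_sub_add_comm, map_add, e, e', ← Finset.sum_add_distrib]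
    simp
  | hs a m c =>
    have h1 : constLift ι n k (constCoeffs ι n k (Finsupp.single a (monomial m c))) =
        if m = 0 then Finsupp.single a (monomial m c) else 0 := by
      simp only [constLift, constCoeffs, Finsupp.mapRange.addMonoidHom_apply,
        Finsupp.mapRange_single]
      split_ifs with h
      · subst h
        rw [show constantCoeff.toAddMonoidHom (monomial (0 : Fin n →₀ ℕ) c) = c from
          constantCoeff_C _ c]
        rfl
      · rw [show constantCoeff.toAddMonoidHom (monomial m c) = 0 from
          (constantCoeff_monomial m c).trans (if_neg h), map_zero, Finsupp.single_zero]
    rw [h1]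
    split_ifs with h
    · exact ⟨0, fun _ => zero_mem _, by simp⟩
    · rw [sub_zero, comp_single]
      split_ifs with hj
      · obtain ⟨i, hi⟩ := Finsupp.ne_iff.1 h
        have hm : Finsupp.single i 1 + (m - Finsupp.single i 1) = m :=
          add_tsub_cancel_of_le (Finsupp.single_le_iff.2 (Nat.one_le_iff_ne_zero.2 hi))
        have hdeg : m.degree = 1 + (m - Finsupp.single i 1).degree := by
          conv_lhs => rw [← hm, map_add, Finsupp.degree_single]
        refine ⟨Pi.single i (Finsupp.single a (monomial (m - Finsupp.single i 1) c)),
          fun l => ?_, ?_⟩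
        · by_cases hl : l = i
          · subst hl
            rw [Pi.single_eq_same, show (j : ℤ) - 1 =
              ((deg a + (m - Finsupp.single l 1).degree : ℕ) : ℤ) by push_cast; omega,
              extendGrading_natCast]
            exact single_mem deg a _ c
          · rw [Pi.single_eq_of_ne hl]
            exact zero_mem _
        · rw [Finset.sum_eq_single i]
          · rw [Pi.single_eq_same, mulVar_apply, Finsupp.smul_single, smul_eq_mul, X,
              monomial_mul, one_mul, hm]
          · intro l _ hl
            rw [Pi.single_eq_of_ne hl, map_zero]
          · simp
      · exact ⟨0, fun _ => zero_mem _, by simp⟩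

lemma exists_sum_mulVar_eq {y : ι →₀ MvPolynomial (Fin n) k} {j : ℕ}
    (hy : y ∈ freeParts deg n k j) (h0 : constCoeffs ι n k y = 0) :
    ∃ u : Fin n → ι →₀ MvPolynomial (Fin n) k,
      (∀ i, u i ∈ extendGrading (freeParts deg n k) ((j : ℤ) - 1)) ∧
        y = ∑ i, mulVar n k _ i (u i) := by
  obtain ⟨u, hu, e⟩ := exists_sum_mulVar_eq_comp deg y j
  rw [h0, map_zero, sub_zero, comp_of_mem deg hy, if_pos rfl] at e
  exact ⟨u, hu, e⟩

variable {𝓥 : ℕ → AddSubgroup V} {π : ℕ → V →+ V}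

lemma IsGradedModule.proj_map (h : IsGradedModule n k 𝓥 π)
    {φ : (ι →₀ MvPolynomial (Fin n) k) →ₗ[MvPolynomial (Fin n) k] V}
    (hφ : ∀ a, φ (Finsupp.single a 1) ∈ 𝓥 (deg a)) (j : ℕ) (v) :
    π j (φ v) = φ (comp deg j v) := by
  induction v using free_induction with
  | h0 => simp
  | hadd v w hv hw => simp [hv, hw]
  | hs a m c =>
    have h1 : φ (Finsupp.single a (monomial m c)) = monomial m c • φ (Finsupp.single a 1) := by
      rw [← map_smul, Finsupp.smul_single, smul_eq_mul, mul_one]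
    rw [comp_single, h1, h.proj_of_mem (h.monomial_smul_mem m c (hφ a))]
    split_ifs
    · exact h1.symm
    · exact (map_zero φ).symm

lemma IsGradedModule.map_mem (h : IsGradedModule n k 𝓥 π)
    {φ : (ι →₀ MvPolynomial (Fin n) k) →ₗ[MvPolynomial (Fin n) k] V}
    (hφ : ∀ a, φ (Finsupp.single a 1) ∈ 𝓥 (deg a)) {j : ℕ} {v} (hv : v ∈ freeParts deg n k j) :
    φ v ∈ 𝓥 j := by
  have := h.proj_map deg hφ j v
  rw [comp_of_mem deg hv, if_pos rfl] at this
  exact this ▸ h.proj_mem j _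

end Free

end Graded
/-! ### Graded Betti numbers vanish exactly where Koszul complexes are exact -/

section Comparison

variable {n : ℕ} {k : Type u} [Field k] {V : Type u} [AddCommGroup V]
  [Module (MvPolynomial (Fin n) k) V] {ι ι' : Type u}

/-- The homogeneous parts of the kernel of a map from a graded free module. -/
noncomputable def kernelParts (deg : ι → ℕ)
    (φ : (ι →₀ MvPolynomial (Fin n) k) →ₗ[MvPolynomial (Fin n) k] V) (c : ℤ) :
    AddSubgroup (ι →₀ MvPolynomial (Fin n) k) :=
  extendGrading (freeParts deg n k) c ⊓ φ.toAddMonoidHom.ker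

lemma isGradedCover_free (deg : ι → ℕ)
    (φ : (ι →₀ MvPolynomial (Fin n) k) →ₗ[MvPolynomial (Fin n) k] V) {W : ℤ → AddSubgroup V}
    (hW : ∀ c u, u ∈ W c ↔ ∃ v ∈ extendGrading (freeParts deg n k) c, φ v = u) :
    IsGradedCover (mulVar n k _) (mulVar n k V) φ.toAddMonoidHom (kernelParts deg φ)
      (extendGrading (freeParts deg n k)) W where
  map_op := map_mulVar φ
  comm := mulVar_comm
  op_mem := (isGradedModule_free deg).mulVar_mem
  mem_target := hW
  mem_kernel _ _ := Iff.rfl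

lemma koszulExact_free (deg : ι → ℕ) {p : ℤ} (hp : 0 < p) (c : ℤ) :
    KoszulExact (mulVar n k (ι →₀ MvPolynomial (Fin n) k)) (extendGrading (freeParts deg n k)) p c :=
  (isSplitting_free deg).koszulExact hp c

variable {𝓥 : ℕ → AddSubgroup V} {π : ℕ → V →+ V}

/-- If `ψ` maps onto the kernel of `φ`, then elements of the reduction of the source of `φ` lift to
the reduction of the source of `ψ` if and only if the values of `φ` lie in the expected product of
the maximal ideal. -/
lemma exists_constCoeffs_iff {deg : ι → ℕ} {deg' : ι' → ℕ}
    (φ : (ι →₀ MvPolynomial (Fin n) k) →ₗ[MvPolynomial (Fin n) k] V)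
    (ψ : (ι' →₀ MvPolynomial (Fin n) k) →ₗ[MvPolynomial (Fin n) k] (ι →₀ MvPolynomial (Fin n) k))
    (hψ : ∀ c u, u ∈ kernelParts deg φ c ↔ ∃ v ∈ extendGrading (freeParts deg' n k) c, ψ v = u)
    (m : ℕ) {v : ι →₀ MvPolynomial (Fin n) k} (hv : v ∈ freeParts deg n k m) :
    (∃ w ∈ freeParts deg' n k m, constCoeffs ι n k (ψ w) = constCoeffs ι n k v) ↔
      ∃ u : Fin n → ι →₀ MvPolynomial (Fin n) k,
        (∀ i, u i ∈ extendGrading (freeParts deg n k) ((m : ℤ) - 1)) ∧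
          φ v = φ (∑ i, mulVar n k _ i (u i)) := by
  have hψ' : ∀ u, u ∈ kernelParts deg φ m ↔ ∃ v ∈ freeParts deg' n k m, ψ v = u := by
    intro u
    rw [hψ, extendGrading_natCast]
  constructor
  · rintro ⟨w, hw, e⟩
    have hk := (hψ' (ψ w)).2 ⟨w, hw, rfl⟩
    have hk1 : ψ w ∈ freeParts deg n k m := extendGrading_natCast (freeParts deg n k) m ▸ hk.1
    obtain ⟨u, hu, e'⟩ := exists_sum_mulVar_eq deg (sub_mem hv hk1) (by rw [map_sub, e, sub_self])
    exact ⟨u, hu, by rw [← e', map_sub, show φ (ψ w) = 0 from hk.2, sub_zero]⟩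
  · rintro ⟨u, hu, e⟩
    have hs : ∑ i, mulVar n k _ i (u i) ∈ extendGrading (freeParts deg n k) m :=
      sum_mem fun i _ => by
        have := (isGradedModule_free deg).mulVar_mem _ i _ (hu i)
        rwa [sub_add_cancel] at this
    obtain ⟨w, hw, e'⟩ := (hψ' (v - ∑ i, mulVar n k _ i (u i))).1
      ⟨AddSubgroup.sub_mem _ (by rwa [extendGrading_natCast]) hs, by
        change φ _ = 0
        rw [map_sub, e, sub_self]⟩
    exact ⟨w, hw, by rw [e', map_sub, constCoeffs_sum_mulVar, sub_zero]⟩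

lemma IsGradedModule.mem_extendGrading_iff_of_surjective (h : IsGradedModule n k 𝓥 π)
    (deg : ι → ℕ) {φ : (ι →₀ MvPolynomial (Fin n) k) →ₗ[MvPolynomial (Fin n) k] V}
    (hφ : ∀ a, φ (Finsupp.single a 1) ∈ 𝓥 (deg a)) (hs : Function.Surjective φ) (c : ℤ) (u : V) :
    u ∈ extendGrading 𝓥 c ↔ ∃ v ∈ extendGrading (freeParts deg n k) c, φ v = u := by
  rcases lt_or_ge c 0 with hc | hc
  · rw [extendGrading_of_neg _ hc, extendGrading_of_neg _ hc]
    simp [eq_comm]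
  · lift c to ℕ using hc
    rw [extendGrading_natCast, extendGrading_natCast]
    constructor
    · intro hu
      obtain ⟨v, rfl⟩ := hs u
      refine ⟨comp deg c v, comp_mem _ _ _, ?_⟩
      rw [← h.proj_map _ hφ, h.proj_of_mem hu, if_pos rfl]
    · rintro ⟨v, hv, rfl⟩
      exact h.map_mem _ hφ hv

namespace GradedFreeResolution

variable (F : GradedFreeResolution (Fin n) k 𝓥)

/-- The homogeneous parts of the syzygies. -/
noncomputable def syzygyParts : ∀ p, ℤ → AddSubgroup (F.ι p →₀ MvPolynomial (Fin n) k)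
  | 0 => kernelParts (F.deg 0) F.ε
  | p + 1 => kernelParts (F.deg (p + 1)) (F.d p)

lemma mem_extendGrading_iff (h : IsGradedModule n k 𝓥 π) (c : ℤ) (u : V) :
    u ∈ extendGrading 𝓥 c ↔ ∃ v ∈ extendGrading (freeParts (F.deg 0) n k) c, F.ε v = u :=
  h.mem_extendGrading_iff_of_surjective _ F.ε_deg F.ε_surjective c u

lemma mem_kernelParts_iff {deg : ι → ℕ} {deg' : ι' → ℕ}
    {φ : (ι →₀ MvPolynomial (Fin n) k) →ₗ[MvPolynomial (Fin n) k] V}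
    {ψ : (ι' →₀ MvPolynomial (Fin n) k) →ₗ[MvPolynomial (Fin n) k] (ι →₀ MvPolynomial (Fin n) k)}
    (hψ : ∀ a, ψ (Finsupp.single a 1) ∈ freeGrading deg (deg' a)) (he : Function.Exact ψ φ)
    (c : ℤ) (u : ι →₀ MvPolynomial (Fin n) k) :
    u ∈ kernelParts deg φ c ↔ ∃ v ∈ extendGrading (freeParts deg' n k) c, ψ v = u := by
  have hF := isGradedModule_free (n := n) (k := k) deg
  rcases lt_or_ge c 0 with hc | hc
  · rw [kernelParts, extendGrading_of_neg _ hc, extendGrading_of_neg _ hc]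
    simp [eq_comm]
  · lift c to ℕ using hc
    rw [kernelParts, extendGrading_natCast, extendGrading_natCast]
    constructor
    · rintro ⟨hu, hu0⟩
      obtain ⟨v, rfl⟩ := (he u).1 hu0
      refine ⟨comp deg' c v, comp_mem _ _ _, ?_⟩
      rw [← hF.proj_map _ hψ, hF.proj_of_mem hu, if_pos rfl]
    · rintro ⟨v, hv, rfl⟩
      exact ⟨hF.map_mem _ hψ hv, (he _).2 ⟨v, rfl⟩⟩

lemma mem_syzygyParts_iff : ∀ (p : ℕ) (c : ℤ) (u),
    u ∈ F.syzygyParts p c ↔ ∃ v ∈ extendGrading (freeParts (F.deg (p + 1)) n k) c, F.d p v = u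
  | 0 => mem_kernelParts_iff (F.d_deg 0) F.exact_zero
  | p + 1 => mem_kernelParts_iff (F.d_deg (p + 1)) (F.exact_succ p)

lemma dBar_constCoeffs (p : ℕ) (v : F.ι (p + 1) →₀ MvPolynomial (Fin n) k) :
    F.dBar p (constCoeffs _ n k v) = constCoeffs _ n k (F.d p v) := by
  induction v using Finsupp.induction_linear with
  | zero => simp
  | add v w hv hw => simp [hv, hw]
  | single a f =>
    have h1 : Finsupp.single a f = f • Finsupp.single a (1 : MvPolynomial (Fin n) k) := by
      rw [Finsupp.smul_single, smul_eq_mul, mul_one]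
    have h2 : constCoeffs (F.ι (p + 1)) n k (Finsupp.single a f) =
        Finsupp.single a (constantCoeff f) := by
      simp only [constCoeffs, Finsupp.mapRange.addMonoidHom_apply, Finsupp.mapRange_single]
      rfl
    rw [h2, dBar, Finsupp.linearCombination_single, h1, map_smul, constCoeffs_smul]
    rfl

lemma torDim_eq_zero_iff_le (p j : ℕ) :
    F.torDim p j = 0 ↔ F.gradedCycles p j ≤ F.gradedBoundaries p j := by
  rw [GradedFreeResolution.torDim, subquotientDim, rank_zero_iff]
  exact Submodule.Quotient.subsingleton_iff.trans Submodule.submoduleOf_eq_top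

/-- Constant vectors lift chains over `k` without changing degrees, so homology of the reduced
resolution can be tested on polynomial vectors. -/
lemma torDim_eq_zero_iff_lift (p m : ℕ) :
    F.torDim p m = 0 ↔ ∀ v ∈ freeParts (F.deg p) n k m, constCoeffs _ n k v ∈ F.cycles p →
      ∃ w ∈ freeParts (F.deg (p + 1)) n k m,
        constCoeffs _ n k (F.d p w) = constCoeffs _ n k v := by
  rw [torDim_eq_zero_iff_le]
  constructor
  · intro h v hv hc
    obtain ⟨w, hw, e⟩ := h ⟨hc, constCoeffs_mem _ hv⟩
    refine ⟨constLift _ n k w, constLift_mem _ hw, ?_⟩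
    rw [← dBar_constCoeffs, constCoeffs_constLift, e]
  · rintro h v ⟨hc, hv⟩
    obtain ⟨w, hw, e⟩ := h _ (constLift_mem _ hv) (by rwa [constCoeffs_constLift])
    rw [constCoeffs_constLift, ← dBar_constCoeffs] at e
    exact ⟨_, constCoeffs_mem _ hw, e⟩

/-- Dimension shift along a free cover. The free module must be acyclic in degrees `p` and `p + 1`,
whence `0 < p`; the internal degree `p + 1 + c` is preserved. -/
lemma koszulExact_iff_step {V : Type u} [AddCommGroup V] [Module (MvPolynomial (Fin n) k) V]
    {deg : ι → ℕ} {φ : (ι →₀ MvPolynomial (Fin n) k) →ₗ[MvPolynomial (Fin n) k] V}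
    {W : ℤ → AddSubgroup V}
    (hW : ∀ c u, u ∈ W c ↔ ∃ v ∈ extendGrading (freeParts deg n k) c, φ v = u)
    {p : ℤ} (hp : 0 < p) (c : ℤ) :
    KoszulExact (mulVar n k V) W (p + 1) c ↔
      KoszulExact (mulVar n k _) (kernelParts deg φ) p (c + 1) :=
  ⟨fun h => (isGradedCover_free deg φ hW).koszulExact_kernel (koszulExact_free deg hp _) h,
    fun h => (isGradedCover_free deg φ hW).koszulExact_target_of_kernel
      (koszulExact_free deg (by omega) _) h⟩

/-- With `F → V` the free cover, `Z` its kernel and `𝔪` the ideal of the variables, `Tor_1` measures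
`(Z ∩ 𝔪F) / 𝔪Z`. An element of `Z` is some `ψ v`; it lies in `𝔪F` when its constant coefficients
vanish, and in `𝔪Z` when `v` can be corrected by a syzygy in the image of `χ` to have no constant
coefficients. -/
lemma koszulExact_one_iff {V : Type u} [AddCommGroup V] [Module (MvPolynomial (Fin n) k) V]
    {ι'' : Type u} {deg : ι → ℕ} {deg' : ι' → ℕ} {deg'' : ι'' → ℕ}
    {φ : (ι →₀ MvPolynomial (Fin n) k) →ₗ[MvPolynomial (Fin n) k] V}
    {W : ℤ → AddSubgroup V}
    (hW : ∀ c u, u ∈ W c ↔ ∃ v ∈ extendGrading (freeParts deg n k) c, φ v = u)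
    (ψ : (ι' →₀ MvPolynomial (Fin n) k) →ₗ[MvPolynomial (Fin n) k] (ι →₀ MvPolynomial (Fin n) k))
    (hψ : ∀ c u, u ∈ kernelParts deg φ c ↔ ∃ v ∈ extendGrading (freeParts deg' n k) c, ψ v = u)
    (χ : (ι'' →₀ MvPolynomial (Fin n) k) →ₗ[MvPolynomial (Fin n) k]
      (ι' →₀ MvPolynomial (Fin n) k))
    (hχ : ∀ c u, u ∈ kernelParts deg' ψ c ↔
      ∃ v ∈ extendGrading (freeParts deg'' n k) c, χ v = u) (c : ℕ) {m : ℤ} (hm : m + 1 = c) :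
    KoszulExact (mulVar n k V) W 1 m ↔
      ∀ v ∈ freeParts deg' n k c, constCoeffs _ n k (ψ v) = 0 →
        ∃ w ∈ freeParts deg'' n k c, constCoeffs _ n k (χ w) = constCoeffs _ n k v := by
  obtain rfl : m = (c : ℤ) - 1 := by omega
  rw [(isGradedCover_free deg φ hW).koszulExact_one_iff (koszulExact_free deg one_pos _)]
  constructor
  · intro h v hv h0
    rw [exists_constCoeffs_iff ψ χ hχ c hv]
    have hk : ψ v ∈ kernelParts deg φ c := (hψ _ _).2 ⟨v, by rwa [extendGrading_natCast], rfl⟩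
    have hk1 : ψ v ∈ freeParts deg n k c := extendGrading_natCast (freeParts deg n k) c ▸ hk.1
    obtain ⟨u, hu, e⟩ := exists_sum_mulVar_eq deg hk1 h0
    obtain ⟨u', hu', e'⟩ := h u hu (by rwa [← e, sub_add_cancel])
    choose y hy hy' using fun i => (hψ _ _).1 (hu' i)
    refine ⟨y, hy, ?_⟩
    rw [e, e', map_sum]
    refine Finset.sum_congr rfl fun i _ => ?_
    rw [← hy' i]
    exact (map_mulVar ψ i (y i)).symm
  · intro h u hu hs
    rw [sub_add_cancel] at hs
    obtain ⟨v, hv, e⟩ := (hψ _ _).1 hs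
    rw [extendGrading_natCast] at hv
    obtain ⟨y, hy, e'⟩ := (exists_constCoeffs_iff ψ χ hχ c hv).1
      (h v hv (by rw [e, constCoeffs_sum_mulVar]))
    refine ⟨fun i => ψ (y i), fun i => (hψ _ _).2 ⟨_, hy i, rfl⟩, ?_⟩
    rw [← e, e', map_sum]
    exact Finset.sum_congr rfl fun i _ => map_mulVar ψ i (y i)

/-- Iterated dimension shift down to homological degree `1`; it stops there because `H_0` of a free
module does not vanish. -/
lemma koszulExact_syzygyParts_iff (q : ℕ) : ∀ (p : ℕ) (c : ℤ),
    KoszulExact (mulVar n k _) (F.syzygyParts q) (p + 1) c ↔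
      KoszulExact (mulVar n k _) (F.syzygyParts (q + p)) 1 (c + p)
  | 0, c => by simp
  | p + 1, c => by
    have h1 := koszulExact_iff_step (F.mem_syzygyParts_iff q) (p := p + 1) (by omega) c
    have h2 := koszulExact_syzygyParts_iff (q + 1) p (c + 1)
    push_cast
    rw [h1]
    refine h2.trans ?_
    rw [show q + 1 + p = q + (p + 1) by ring, show c + 1 + (p : ℤ) = c + (p + 1) by ring]

/-- The graded Betti numbers computed from a resolution vanish where the Koszul complex is exact. -/
theorem torDim_eq_zero_iff (h : IsGradedModule n k 𝓥 π) : ∀ (p j : ℕ),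
    F.torDim p (p + j) = 0 ↔ KoszulExact (mulVar n k V) (extendGrading 𝓥) p j
  | 0, j => by
    rw [torDim_eq_zero_iff_lift, Nat.cast_zero, koszulExact_zero_iff, zero_add,
      extendGrading_natCast]
    constructor
    · intro H v hv
      rw [← extendGrading_natCast 𝓥, F.mem_extendGrading_iff h] at hv
      obtain ⟨y, hy, rfl⟩ := hv
      rw [extendGrading_natCast] at hy
      obtain ⟨u, hu, e⟩ := (exists_constCoeffs_iff F.ε (F.d 0) (F.mem_syzygyParts_iff 0) j hy).1
        (H y hy trivial)
      refine ⟨fun i => F.ε (u i), fun i => (F.mem_extendGrading_iff h _ _).2 ⟨_, hu i, rfl⟩, ?_⟩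
      rw [e, map_sum]
      exact Finset.sum_congr rfl fun i _ => map_mulVar F.ε i (u i)
    · intro H v hv _
      rw [exists_constCoeffs_iff F.ε (F.d 0) (F.mem_syzygyParts_iff 0) j hv]
      obtain ⟨u, hu, e⟩ := H _ (h.map_mem _ F.ε_deg hv)
      choose y hy hy' using fun i => (F.mem_extendGrading_iff h _ _).1 (hu i)
      refine ⟨y, hy, ?_⟩
      rw [e, map_sum]
      refine Finset.sum_congr rfl fun i _ => ?_
      rw [← hy' i]
      exact (map_mulVar F.ε i (y i)).symm
  | 1, j => by
    rw [torDim_eq_zero_iff_lift, Nat.cast_one, koszulExact_one_iff (F.mem_extendGrading_iff h) (F.d 0)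
      (F.mem_syzygyParts_iff 0) (F.d 1) (F.mem_syzygyParts_iff 1) (1 + j) (by push_cast; ring)]
    simp only [cycles, LinearMap.mem_ker, dBar_constCoeffs]
  -- One shift passes from the module to its first syzygies and `p` further ones reach homological
  -- degree `1` of the `p`-th syzygy module, which `d p`, `d (p + 1)` and `d (p + 2)` describe.
  | p + 2, j => by
    have h1 := koszulExact_iff_step (F.mem_extendGrading_iff h) (p := p + 1) (by omega) j
    have h2 := F.koszulExact_syzygyParts_iff 0 p (j + 1)
    have h3 := koszulExact_one_iff (F.mem_syzygyParts_iff p) (F.d (p + 1))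
      (F.mem_syzygyParts_iff (p + 1)) (F.d (p + 2)) (F.mem_syzygyParts_iff (p + 2)) (p + 2 + j)
      (m := j + 1 + p) (by push_cast; ring)
    rw [zero_add] at h2
    rw [torDim_eq_zero_iff_lift, show ((p + 2 : ℕ) : ℤ) = p + 1 + 1 by push_cast; ring, h1]
    refine Iff.trans ?_ (h3.symm.trans h2.symm)
    simp only [cycles, LinearMap.mem_ker, dBar_constCoeffs]

end GradedFreeResolution

theorem gradedBetti_eq_zero_iff (h : IsGradedModule n k 𝓥 π) (p j : ℕ) :
    gradedBetti (Fin n) k 𝓥 p j = 0 ↔ KoszulExact (mulVar n k V) (extendGrading 𝓥) p j := by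
  rw [gradedBetti, torDim, dif_pos h.nonempty_resolution]
  exact GradedFreeResolution.torDim_eq_zero_iff _ h p j

end Comparison
/-! ### Finitely generated modules -/

section Finite

variable {n : ℕ} {k : Type u} [Field k]

lemma exists_finite_homogeneous_generators {V : Type u} [AddCommGroup V]
    [Module (MvPolynomial (Fin n) k) V] {𝓥 : ℕ → AddSubgroup V}
    {Z : Submodule (MvPolynomial (Fin n) k) V} (hZ : Z.FG)
    (h : Z ≤ Submodule.span _ {v | v ∈ Z ∧ ∃ j, v ∈ 𝓥 j}) :
    ∃ (ι : Type u) (_ : Finite ι) (deg : ι → ℕ)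
      (φ : (ι →₀ MvPolynomial (Fin n) k) →ₗ[MvPolynomial (Fin n) k] V),
        (∀ a, φ (Finsupp.single a 1) ∈ 𝓥 (deg a)) ∧ LinearMap.range φ = Z := by
  have hs : Submodule.span _ {v | v ∈ Z ∧ ∃ j, v ∈ 𝓥 j} = Z :=
    le_antisymm (Submodule.span_le.2 fun v hv => hv.1) h
  obtain ⟨t, ht, e⟩ := (Submodule.fg_span_iff_fg_span_finset_subset _).1 (hs.symm ▸ hZ)
  choose deg hdeg using fun a : t => (ht a.2).2
  refine ⟨t, inferInstance, deg, Finsupp.linearCombination _ (fun a : t => (a : V)), fun a => ?_, ?_⟩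
  · rw [Finsupp.linearCombination_single, one_smul]
    exact hdeg a
  · rw [Finsupp.range_linearCombination, Subtype.range_coe_subtype, ← hs, e]
    rfl

/-- Induction on `p` over all modules with a finite graded cover: the kernel is finitely generated
by noetherianity and is homogeneous by hypothesis, so it has such a cover again. -/
lemma exists_koszulExact_of_cover (p : ℕ) : ∀ {V : Type u} [AddCommGroup V]
    [Module (MvPolynomial (Fin n) k) V] {ι : Type u} [Finite ι] (deg : ι → ℕ)
    (φ : (ι →₀ MvPolynomial (Fin n) k) →ₗ[MvPolynomial (Fin n) k] V)
    (_ : ∀ j v, φ v = 0 → φ (comp deg j v) = 0) {W : ℤ → AddSubgroup V}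
    (_ : ∀ c u, u ∈ W c ↔ ∃ v ∈ extendGrading (freeParts deg n k) c, φ v = u),
    ∃ c₀ : ℤ, ∀ c, c₀ ≤ c → KoszulExact (mulVar n k V) W p c := by
  induction p with
  | zero =>
    intro V _ _ ι _ deg φ _ W hW
    obtain ⟨b, hb⟩ := (Set.finite_range deg).bddAbove
    refine ⟨b + 1, fun c hc => ?_⟩
    lift c to ℕ using by omega
    rw [Nat.cast_zero, koszulExact_zero_iff]
    intro v hv
    obtain ⟨y, hy, rfl⟩ := (hW _ _).1 hv
    rw [extendGrading_natCast] at hy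
    -- Above the largest generator degree `b` no basis vector has degree `c`, so no constant
    -- coefficient can occur.
    have h0 : constCoeffs ι n k y = 0 := by
      have := constCoeffs_mem deg hy
      rw [show {a | deg a = c} = ∅ from Set.eq_empty_of_forall_notMem fun a ha => by
        have h1 : deg a ≤ b := hb ⟨a, rfl⟩
        rw [Set.mem_ofPred_eq] at ha
        omega, Finsupp.supported_empty] at this
      exact this
    obtain ⟨u, hu, rfl⟩ := exists_sum_mulVar_eq deg hy h0
    refine ⟨fun i => φ (u i), fun i => (hW _ _).2 ⟨_, hu i, rfl⟩, ?_⟩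
    rw [map_sum]
    exact Finset.sum_congr rfl fun i _ => map_mulVar φ i (u i)
  | succ p ih =>
    intro V _ _ ι _ deg φ hφ W hW
    obtain ⟨ι', _, deg', ψ, hψ, hr⟩ := exists_finite_homogeneous_generators
      (𝓥 := freeParts deg n k) (IsNoetherian.noetherian (LinearMap.ker φ)) (fun v hv => by
        obtain ⟨m, hm⟩ := (isGradedModule_free deg).exists_sum_proj v
        rw [← hm]
        exact sum_mem fun j _ => Submodule.subset_span ⟨hφ j v hv, j, comp_mem deg j v⟩)
    obtain ⟨c₀, hc⟩ := ih deg' ψ (fun j v hv => by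
        rw [← (isGradedModule_free deg).proj_map deg' hψ, hv, map_zero])
      (W := kernelParts deg φ)
      (GradedFreeResolution.mem_kernelParts_iff hψ (LinearMap.exact_iff.2 hr.symm))
    refine ⟨c₀, fun c h => ?_⟩
    exact (isGradedCover_free deg φ hW).koszulExact_target_of_kernel
      (koszulExact_free deg (by omega) _) (hc _ (by omega))

/-- The Koszul homology of a finitely generated graded module is bounded. -/
lemma IsGradedModule.exists_koszulExact {V : Type u} [AddCommGroup V]
    [Module (MvPolynomial (Fin n) k) V] [Module.Finite (MvPolynomial (Fin n) k) V]
    {𝓥 : ℕ → AddSubgroup V} {π : ℕ → V →+ V} (h : IsGradedModule n k 𝓥 π) (p : ℕ) :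
    ∃ c₀ : ℤ, ∀ c, c₀ ≤ c → KoszulExact (mulVar n k V) (extendGrading 𝓥) p c := by
  obtain ⟨ι, _, deg, φ, hφ, hr⟩ := exists_finite_homogeneous_generators (𝓥 := 𝓥)
    (Module.Finite.fg_top (R := MvPolynomial (Fin n) k) (M := V)) (fun v _ => by
      obtain ⟨m, hm⟩ := h.exists_sum_proj v
      rw [← hm]
      exact sum_mem fun j _ => Submodule.subset_span ⟨trivial, j, h.proj_mem j v⟩)
  exact exists_koszulExact_of_cover p deg φ
    (fun j v hv => by rw [← h.proj_map deg hφ, hv, map_zero])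
    (h.mem_extendGrading_iff_of_surjective deg hφ (LinearMap.range_eq_top.1 hr))

end Finite
/-! ### Ideals generated by linear forms -/

section Linear

variable {n : ℕ} {k : Type u} [Field k]

/-- The homogeneous parts of an ideal, as subgroups of the polynomial ring. -/
noncomputable def idealParts (𝔟 : Ideal (MvPolynomial (Fin n) k)) (j : ℕ) : AddSubgroup (MvPolynomial (Fin n) k) :=
  𝔟.toAddSubgroup ⊓ (homogeneousSubmodule (Fin n) k j).toAddSubgroup

lemma isGradedModule_top : IsGradedModule n k (idealParts (⊤ : Ideal (MvPolynomial (Fin n) k)))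
    (fun j => (homogeneousComponent j).toAddMonoidHom) where
  proj_of_mem {i j v} hv := by
    have := homogeneousComponent_of_mem (m := j) hv.2
    simp only [eq_comm (a := j)] at this
    exact this
  proj_mem j v := ⟨trivial, homogeneousComponent_isHomogeneous j v⟩
  exists_sum_proj v := ⟨_, sum_homogeneousComponent v⟩
  monomial_smul_mem {j v} m c hv := by
    refine ⟨trivial, ?_⟩
    have := (isHomogeneous_monomial c (rfl : m.degree = m.degree)).mul hv.2
    rwa [add_comm] at this

lemma extendGrading_mono {V : Type u} [AddCommGroup V] {𝓥 𝓦 : ℕ → AddSubgroup V}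
    (h : ∀ j, 𝓥 j ≤ 𝓦 j) (c : ℤ) : extendGrading 𝓥 c ≤ extendGrading 𝓦 c := by
  rcases lt_or_ge c 0 with hc | hc
  · rw [extendGrading_of_neg _ hc]
    exact bot_le
  · lift c to ℕ using hc
    rw [extendGrading_natCast, extendGrading_natCast]
    exact h c

lemma mem_extendGrading_idealParts {𝔟 : Ideal (MvPolynomial (Fin n) k)} {c : ℤ}
    {f : MvPolynomial (Fin n) k} : f ∈ extendGrading (idealParts 𝔟) c ↔
      f ∈ 𝔟 ∧ f ∈ extendGrading (idealParts ⊤) c := by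
  rcases lt_or_ge c 0 with hc | hc
  · rw [extendGrading_of_neg _ hc, extendGrading_of_neg _ hc, AddSubgroup.mem_bot]
    exact ⟨fun h => ⟨h ▸ zero_mem _, h⟩, fun h => h.2⟩
  · lift c to ℕ using hc
    rw [extendGrading_natCast, extendGrading_natCast]
    exact ⟨fun h => ⟨h.1, trivial, h.2⟩, fun h => ⟨h.1, h.2.2⟩⟩

lemma mulVar_mem_idealParts {𝔟 : Ideal (MvPolynomial (Fin n) k)} (c : ℤ) (i : Fin n)
    (f : MvPolynomial (Fin n) k) (hf : f ∈ extendGrading (idealParts 𝔟) c) :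
    mulVar n k _ i f ∈ extendGrading (idealParts 𝔟) (c + 1) := by
  rw [mem_extendGrading_idealParts] at hf ⊢
  exact ⟨𝔟.mul_mem_left _ hf.1, isGradedModule_top.mulVar_mem c i f hf.2⟩

/-- The polynomial ring is free on one generator of degree `0`; its only Koszul homology sits at `p
= c = 0`. -/
lemma koszulExact_top {p c : ℤ} (h : 0 < p ∨ c ≠ 0) :
    KoszulExact (mulVar n k (MvPolynomial (Fin n) k)) (extendGrading (idealParts ⊤)) p c := by
  let φ : (PUnit.{u + 1} →₀ MvPolynomial (Fin n) k) →ₗ[MvPolynomial (Fin n) k]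
      MvPolynomial (Fin n) k := Finsupp.lapply PUnit.unit
  have hφ : ∀ a, φ (Finsupp.single a 1) ∈ idealParts (⊤ : Ideal (MvPolynomial (Fin n) k)) 0 :=
    fun a => ⟨trivial, by
      change (Finsupp.single a (1 : MvPolynomial (Fin n) k) PUnit.unit).IsHomogeneous 0
      rw [Finsupp.single_eq_same]
      exact isHomogeneous_one (Fin n) k⟩
  have hW := isGradedModule_top.mem_extendGrading_iff_of_surjective (k := k) (fun _ => 0) hφ
    (fun f => ⟨Finsupp.single PUnit.unit f, by simp [φ]⟩)
  rcases lt_or_ge 0 p with hp | hp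
  · refine (koszulExact_iff_of_injective φ.toAddMonoidHom (fun v w e => ?_) (map_mulVar φ)
      (fun c => ?_) p c).1 (koszulExact_free (fun _ => 0) hp c)
    · exact Finsupp.ext fun _ => e
    · ext u
      exact hW c u
  have hc := h.resolve_left (not_lt.2 hp)
  rcases hp.lt_or_eq with hp | rfl
  · exact fun z hz _ => ⟨0, zero_mem _, by rw [map_zero, Kos.chains_of_neg hp hz]⟩
  rw [koszulExact_zero_iff]
  intro v hv
  obtain ⟨y, hy, rfl⟩ := (hW _ _).1 hv
  rcases lt_or_ge c 0 with h0 | h0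
  · rw [extendGrading_of_neg _ h0, AddSubgroup.mem_bot] at hy
    exact ⟨0, fun _ => zero_mem _, by simp [hy]⟩
  lift c to ℕ using h0
  rw [extendGrading_natCast] at hy
  have h0 : constCoeffs PUnit.{u + 1} n k y = 0 := by
    have := constCoeffs_mem _ hy
    rw [show {a : PUnit.{u + 1} | 0 = c} = ∅ from
      Set.eq_empty_of_forall_notMem fun a ha => hc (by exact_mod_cast ha.symm),
      Finsupp.supported_empty] at this
    exact this
  obtain ⟨u, hu, rfl⟩ := exists_sum_mulVar_eq _ hy h0
  refine ⟨fun i => φ (u i), fun i => (hW _ _).2 ⟨_, hu i, rfl⟩, ?_⟩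
  rw [map_sum]
  exact Finset.sum_congr rfl fun i _ => map_mulVar φ i (u i)

/-- The ideal is the kernel of an endomorphism of the polynomial ring, which is a domain: subtract
from each variable its image under a `k`-linear retraction onto the span of `t`. This kills `t` and
is the identity modulo `t`. -/
lemma isPrime_span_linear {t : Set (MvPolynomial (Fin n) k)} (ht : ∀ l ∈ t, l.IsHomogeneous 1) :
    (Ideal.span t).IsPrime := by
  let U := Submodule.span k t
  obtain ⟨ρ, hρ⟩ := U.subtype.exists_leftInverse_of_injective (Submodule.ker_subtype U)
  let π : MvPolynomial (Fin n) k →ₐ[k] MvPolynomial (Fin n) k := aeval fun i => X i - (ρ (X i) : MvPolynomial (Fin n) k)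
  have hU : ∀ u ∈ U, u ∈ Ideal.span t := fun u hu => by
    have : U ≤ (Ideal.span t).restrictScalars k := Submodule.span_le.2 Ideal.subset_span
    exact this hu
  have hlin : ∀ l : MvPolynomial (Fin n) k, l.IsHomogeneous 1 → π l = l - (ρ l : MvPolynomial (Fin n) k) := by
    intro l hl
    have h1 : l ∈ Submodule.span k (Set.range X) := by
      rw [← homogeneousSubmodule_one_eq_span_X]
      exact hl
    clear hl
    induction h1 using Submodule.span_induction with
    | mem x hx =>
      obtain ⟨i, rfl⟩ := hx
      exact aeval_X _ _
    | zero => simp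
    | add x y _ _ hx hy => rw [map_add, map_add, hx, hy, Submodule.coe_add]; ring
    | smul a x _ hx => rw [map_smul, map_smul, hx, Submodule.coe_smul, smul_sub]
  have hker : RingHom.ker π = Ideal.span t := by
    apply le_antisymm
    · intro f hf
      have h2 : (Ideal.Quotient.mkₐ k (Ideal.span t)).comp π = Ideal.Quotient.mkₐ k _ := by
        apply algHom_ext
        intro i
        simp only [π, AlgHom.comp_apply, aeval_X]
        refine Ideal.Quotient.eq.2 ?_
        rw [sub_sub_cancel_left]
        exact neg_mem (hU _ (ρ _).2)
      have h3 := DFunLike.congr_fun h2 f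
      rw [AlgHom.comp_apply, show π f = 0 from hf, map_zero] at h3
      exact Ideal.Quotient.eq_zero_iff_mem.1 h3.symm
    · rw [Ideal.span_le]
      intro l hl
      have h4 := DFunLike.congr_fun hρ ⟨l, Submodule.subset_span hl⟩
      change π l = 0
      rw [hlin l (ht l hl)]
      exact sub_eq_zero.2 (congr_arg Subtype.val h4).symm
  rw [← hker]
  exact RingHom.ker_isPrime _

lemma homogeneousComponent_linear_mul {l : MvPolynomial (Fin n) k} (hl : l.IsHomogeneous 1)
    (f : MvPolynomial (Fin n) k) (j : ℕ) :
    homogeneousComponent (j + 1) (l * f) = l * homogeneousComponent j f := by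
  conv_lhs => rw [← sum_homogeneousComponent f, Finset.mul_sum, map_sum]
  have : ∀ i, homogeneousComponent (j + 1) (l * homogeneousComponent i f) =
      if i = j then l * homogeneousComponent i f else 0 := by
    intro i
    rw [homogeneousComponent_of_mem (hl.mul (homogeneousComponent_isHomogeneous i f))]
    simp only [show j + 1 = 1 + i ↔ i = j by omega]
  simp only [this, Finset.sum_ite_eq', Finset.mem_range]
  split_ifs with h
  · rfl
  · rw [homogeneousComponent_eq_zero _ _ (by omega), mul_zero]

lemma homogeneousComponent_mem_span {t : Set (MvPolynomial (Fin n) k)}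
    (ht : ∀ l ∈ t, l.IsHomogeneous 1) {f : MvPolynomial (Fin n) k} (hf : f ∈ Ideal.span t) (j : ℕ) :
    homogeneousComponent j f ∈ Ideal.span t := by
  let _ := MvPolynomial.gradedAlgebra (σ := Fin n) (R := k)
  exact homogeneousComponent_mem_of_mem
    (Ideal.homogeneous_span _ _ fun l hl => ⟨1, ht l hl⟩) hf j

lemma constantCoeff_of_isHomogeneous_one {l : MvPolynomial (Fin n) k} (hl : l.IsHomogeneous 1) :
    constantCoeff l = 0 := by
  by_contra hne
  have := degree_of_mem_support hl (mem_support_iff.2 hne)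
  simp at this

lemma constantCoeff_of_mem_span {t : Set (MvPolynomial (Fin n) k)}
    (ht : ∀ l ∈ t, l.IsHomogeneous 1) {f : MvPolynomial (Fin n) k} (hf : f ∈ Ideal.span t) :
    constantCoeff f = 0 := by
  have : Ideal.span t ≤ RingHom.ker (constantCoeff (σ := Fin n) (R := k)) :=
    Ideal.span_le.2 fun l hl => constantCoeff_of_isHomogeneous_one (ht l hl)
  exact this hf

/-- The Koszul complex of the quotient by an ideal generated by linear forms is exact in positive
degrees. -/
def QuotientExact (𝔟 : Ideal (MvPolynomial (Fin n) k)) : Prop :=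
  ∀ p c : ℤ, c ≠ 0 → ∀ z ∈ Kos.chains (extendGrading (idealParts ⊤) c) n p,
    Kos.diff n (mulVar n k _) z ∈ Kos.chains (extendGrading (idealParts 𝔟) (c + 1)) n (p - 1) →
      ∃ w ∈ Kos.chains (extendGrading (idealParts ⊤) (c - 1)) n (p + 1),
        z - Kos.diff n (mulVar n k _) w ∈ Kos.chains (extendGrading (idealParts 𝔟) c) n p

/-- Unless it already lies in the prime ideal `𝔟 = (t)`, the form `l` is a nonzerodivisor modulo
`𝔟`. With `A` the polynomial ring, the chase follows `0 → A/𝔟(-1) → A/𝔟 → A/(𝔟 + l) → 0`, with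
representatives in `A`. -/
lemma quotientExact_insert {l : MvPolynomial (Fin n) k} (hl : l.IsHomogeneous 1)
    {t : Set (MvPolynomial (Fin n) k)} (ht : ∀ l ∈ t, l.IsHomogeneous 1)
    (h : QuotientExact (Ideal.span t)) : QuotientExact (Ideal.span (insert l t)) := by
  by_cases hlt : l ∈ Ideal.span t
  · rwa [Ideal.span_insert, sup_eq_right.2 ((Ideal.span_singleton_le_iff_mem _).2 hlt)]
  have hprime := isPrime_span_linear ht
  have hcomm : ∀ z, Kos.map (AddMonoidHom.mulLeft l) n (Kos.diff n (mulVar n k _) z) =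
      Kos.diff n (mulVar n k _) (Kos.map (AddMonoidHom.mulLeft l) n z) :=
    Kos.map_diff fun i v => mul_left_comm l (X i) v
  have hmul : ∀ c, ∀ v ∈ extendGrading (idealParts (⊤ : Ideal (MvPolynomial (Fin n) k))) c,
      l * v ∈ extendGrading (idealParts ⊤) (c + 1) := by
    intro c v hv
    rcases lt_or_ge c 0 with hc | hc
    · rw [extendGrading_of_neg _ hc, AddSubgroup.mem_bot] at hv
      rw [hv, mul_zero]
      exact zero_mem _
    · lift c to ℕ using hc
      rw [show (c : ℤ) + 1 = ((1 + c : ℕ) : ℤ) by push_cast; ring, extendGrading_natCast]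
      rw [extendGrading_natCast] at hv
      exact ⟨trivial, hl.mul hv.2⟩
  have hle : ∀ c, extendGrading (idealParts (Ideal.span t)) c ≤
      extendGrading (idealParts (Ideal.span (insert l t))) c :=
    extendGrading_mono fun j v hv => ⟨Ideal.span_mono (Set.subset_insert l t) hv.1, hv.2⟩
  have hle' : ∀ c, extendGrading (idealParts (Ideal.span t)) c ≤ extendGrading (idealParts ⊤) c :=
    extendGrading_mono fun j v hv => ⟨trivial, hv.2⟩
  have hdec : ∀ c, ∀ v ∈ extendGrading (idealParts (Ideal.span (insert l t))) (c + 1),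
      ∃ a ∈ extendGrading (idealParts (⊤ : Ideal (MvPolynomial (Fin n) k))) c,
        v - l * a ∈ extendGrading (idealParts (Ideal.span t)) (c + 1) := by
    intro c v hv
    rcases lt_or_ge (c + 1) 0 with hc | hc
    · rw [extendGrading_of_neg _ hc, AddSubgroup.mem_bot] at hv
      exact ⟨0, zero_mem _, by rw [hv, mul_zero, sub_zero]; exact zero_mem _⟩
    obtain ⟨j, hj⟩ := Int.eq_ofNat_of_zero_le hc
    rw [hj, extendGrading_natCast] at hv
    obtain ⟨a, b, hb, e⟩ := Ideal.mem_span_insert.1 hv.1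
    have hbj := homogeneousComponent_mem_span ht hb j
    have hvj := homogeneousComponent_of_mem (m := j) hv.2
    rw [if_pos rfl, e, map_add, mul_comm] at hvj
    -- In degree `0` the multiple of `l` contributes nothing, and `c = -1` leaves no other choice
    -- than `a = 0`.
    rcases j with _ | j
    · refine ⟨0, zero_mem _, ?_⟩
      rw [hj, extendGrading_natCast, mul_zero, sub_zero]
      refine ⟨?_, hv.2⟩
      have h0 : homogeneousComponent 0 (l * a) = 0 := by
        rw [homogeneousComponent_zero]
        change C (constantCoeff (l * a)) = 0
        rw [map_mul, constantCoeff_of_isHomogeneous_one hl, zero_mul, map_zero]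
      rw [h0, zero_add] at hvj
      change v ∈ Ideal.span t
      rw [e, mul_comm, ← hvj]
      exact hbj
    · have hcj : c = j := by push_cast at hj; omega
      subst hcj
      refine ⟨homogeneousComponent j a, ?_, ?_⟩
      · rw [extendGrading_natCast]
        exact ⟨trivial, homogeneousComponent_isHomogeneous j a⟩
      · rw [hj, extendGrading_natCast]
        rw [homogeneousComponent_linear_mul hl] at hvj
        have h5 : v - l * homogeneousComponent j a = homogeneousComponent (j + 1) b := by
          rw [e, mul_comm a l, ← hvj, add_sub_cancel_left]
        rw [h5]
        exact ⟨hbj, homogeneousComponent_isHomogeneous _ b⟩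
  intro p c hc z hz hdz
  obtain ⟨y, hy, hy'⟩ := Kos.exists_sub_map_mem (φ := AddMonoidHom.mulLeft l) (hdec c) hdz
  have hdd : ∀ z, Kos.diff n (mulVar n k (MvPolynomial (Fin n) k))
      (Kos.diff n (mulVar n k _) z) = 0 := Kos.diff_diff mulVar_comm
  -- Since `d z - l y` has coefficients in `𝔟`, so has `l d y`; primality lets `l` be cancelled, and
  -- `y` is a cycle modulo `𝔟`.
  have hdy : Kos.diff n (mulVar n k _) y ∈
      Kos.chains (extendGrading (idealParts (Ideal.span t)) (c + 1)) n (p - 1 - 1) := by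
    refine Kos.mem_of_map_mem (φ := AddMonoidHom.mulLeft l)
      (U := extendGrading (idealParts ⊤) (c + 1))
      (U' := extendGrading (idealParts (Ideal.span t)) (c + 1 + 1)) (fun v hv hv' => ?_)
      (Kos.diff_mem (isGradedModule_top.mulVar_mem c) hy) ?_
    · rw [mem_extendGrading_idealParts] at hv' ⊢
      exact ⟨(hprime.mem_or_mem hv'.1).resolve_left hlt, hv⟩
    · have := neg_mem (Kos.diff_mem (mulVar_mem_idealParts (c + 1)) hy')
      rwa [map_sub, hdd, zero_sub, neg_neg, ← hcomm] at this
  obtain ⟨u, hu, hu'⟩ := h (p - 1) c hc y hy hdy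
  rw [sub_add_cancel] at hu
  have hlu : Kos.map (AddMonoidHom.mulLeft l) n u ∈
      Kos.chains (extendGrading (idealParts ⊤) c) n p := by
    have := Kos.map_mem (n := n) (p := p) (φ := AddMonoidHom.mulLeft l) (hmul (c - 1)) hu
    rwa [sub_add_cancel] at this
  obtain ⟨w, hw, hw'⟩ := h p c hc (z - Kos.map (AddMonoidHom.mulLeft l) n u) (sub_mem hz hlu) (by
    have h6 := Kos.map_mem (n := n) (φ := AddMonoidHom.mulLeft l)
      (U' := extendGrading (idealParts (Ideal.span t)) (c + 1)) (fun v hv => by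
        rw [mem_extendGrading_idealParts] at hv ⊢
        exact ⟨Ideal.mul_mem_left _ _ hv.1, hmul c v hv.2⟩) hu'
    convert add_mem hy' h6 using 1
    rw [map_sub, map_sub, ← hcomm]
    abel)
  refine ⟨w, hw, ?_⟩
  have h7 : Kos.map (AddMonoidHom.mulLeft l) n u ∈
      Kos.chains (extendGrading (idealParts (Ideal.span (insert l t))) c) n p := by
    refine Kos.map_mem (φ := AddMonoidHom.mulLeft l)
      (U := extendGrading (idealParts ⊤) (c - 1)) (fun v hv => ?_) hu
    rw [mem_extendGrading_idealParts]
    have := hmul (c - 1) v hv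
    rw [sub_add_cancel] at this
    exact ⟨Ideal.mul_mem_right _ _ (Ideal.subset_span (Set.mem_insert l t)), this⟩
  convert add_mem (Kos.chains_mono (hle c) hw') h7 using 1
  abel

lemma quotientExact_span {t : Finset (MvPolynomial (Fin n) k)}
    (ht : ∀ l ∈ t, l.IsHomogeneous 1) : QuotientExact (Ideal.span (t : Set (MvPolynomial (Fin n) k))) := by
  classical
  induction t using Finset.induction_on with
  | empty =>
    intro p c hc z hz hdz
    rw [Finset.coe_empty, Ideal.span_empty] at hdz ⊢
    have h0 : Kos.diff n (mulVar n k _) z = 0 := by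
      refine Kos.chains_bot (Kos.chains_mono (fun v hv => ?_) hdz)
      rw [mem_extendGrading_idealParts] at hv
      exact hv.1
    obtain ⟨w, hw, rfl⟩ := koszulExact_top (Or.inr hc) z hz h0
    exact ⟨w, hw, by rw [sub_self]; exact zero_mem _⟩
  | insert l t _ ih =>
    rw [Finset.coe_insert]
    exact quotientExact_insert (ht l (Finset.mem_insert_self l t))
      (fun l hl => ht l (Finset.mem_insert_of_mem hl)) (ih fun l hl => ht l (Finset.mem_insert_of_mem hl))

/-- An ideal generated by linear forms has a linear resolution. -/
lemma koszulExact_of_span_linear {t : Set (MvPolynomial (Fin n) k)}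
    (ht : ∀ l ∈ t, l.IsHomogeneous 1) {p c : ℤ} (hc : c ≠ 1) :
    KoszulExact (mulVar n k (MvPolynomial (Fin n) k)) (extendGrading (idealParts (Ideal.span t)))
      p c := by
  obtain ⟨t', ht', e⟩ := (Submodule.fg_span_iff_fg_span_finset_subset t).1
    (IsNoetherian.noetherian (Ideal.span t))
  have hq : QuotientExact (Ideal.span t) := by
    rw [Ideal.span, e]
    exact quotientExact_span fun l hl => ht l (ht' hl)
  intro z hz hd
  by_cases h0 : c = 0
  · subst h0
    refine ⟨0, zero_mem _, ?_⟩
    rw [map_zero]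
    refine (Kos.chains_bot (Kos.chains_mono (fun v hv => ?_) hz)).symm
    rw [← Nat.cast_zero, extendGrading_natCast] at hv
    change v = 0
    rw [← homogeneousComponent_eq_self hv.2, homogeneousComponent_zero]
    change C (constantCoeff v) = 0
    rw [constantCoeff_of_mem_span ht hv.1, map_zero]
  obtain ⟨w, hw, rfl⟩ := koszulExact_top (Or.inr h0) z
    (Kos.chains_mono (fun v hv => (mem_extendGrading_idealParts.1 hv).2) hz) hd
  -- The primitive `w` is a cycle modulo the ideal with coefficients in degree `c - 1 ≠ 0`;
  -- correcting it by a boundary brings it into the ideal.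
  obtain ⟨v, hv, hv'⟩ := hq (p + 1) (c - 1) (sub_ne_zero.2 hc) w hw (by
    rwa [sub_add_cancel, add_sub_cancel_right])
  exact ⟨_, hv', by rw [map_sub, Kos.diff_diff mulVar_comm, sub_zero]⟩

end Linear
/-! ### The tangent cone at a smooth rational point -/

section Smooth

variable {n : ℕ} {k : Type u} [Field k]

/-- The linear parts of the elements of an ideal. -/
def linearParts (𝔞 : Ideal (MvPolynomial (Fin n) k)) : Set (MvPolynomial (Fin n) k) :=
  {l | l.IsHomogeneous 1 ∧ ∃ f ∈ 𝔞, f - l ∈ idealOfVars (Fin n) k ^ 2}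

lemma mem_idealOfVars_iff {f : MvPolynomial (Fin n) k} :
    f ∈ idealOfVars (Fin n) k ↔ constantCoeff f = 0 := by
  rw [← pow_one (idealOfVars (Fin n) k), mem_pow_idealOfVars_iff']
  constructor
  · intro h
    exact h 0 (by simp)
  · intro h x hx
    have hx0 : x = 0 := (Finsupp.degree_eq_zero_iff x).1 (by omega)
    rw [hx0]
    exact h

lemma mem_pow_idealOfVars_of_isHomogeneous {f : MvPolynomial (Fin n) k} {d : ℕ}
    (hf : f.IsHomogeneous d) : f ∈ idealOfVars (Fin n) k ^ d :=
  (mem_pow_idealOfVars_iff _ _).2 fun _ hx => (degree_of_mem_support hf hx).ge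

lemma homogeneousComponent_of_mem_pow_idealOfVars {f : MvPolynomial (Fin n) k} {d e : ℕ}
    (hf : f ∈ idealOfVars (Fin n) k ^ e) (hd : d < e) : homogeneousComponent d f = 0 := by
  ext x
  rw [coeff_homogeneousComponent, coeff_zero]
  split_ifs with h
  · exact (mem_pow_idealOfVars_iff' _ _).1 hf x (h ▸ hd)
  · rfl

lemma sub_homogeneousComponent_mem {f : MvPolynomial (Fin n) k} {d : ℕ}
    (hf : f ∈ idealOfVars (Fin n) k ^ d) :
    f - homogeneousComponent d f ∈ idealOfVars (Fin n) k ^ (d + 1) := by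
  rw [mem_pow_idealOfVars_iff'] at hf ⊢
  intro x hx
  rw [coeff_sub, coeff_homogeneousComponent]
  split_ifs with h
  · exact sub_self _
  · rw [sub_zero]
    exact hf x (by omega)

/-- A substitution tangent to the identity preserves initial forms. The cases `d = 0, 1` are checked
on generators, and `y(cb) - cb = (y(c) - c) y(b) + c (y(b) - b)` gives the induction. -/
lemma aeval_sub_mem {y : Fin n → MvPolynomial (Fin n) k}
    (hy : ∀ i, y i - X i ∈ idealOfVars (Fin n) k ^ 2) : ∀ (d : ℕ) (f : MvPolynomial (Fin n) k),
    f ∈ idealOfVars (Fin n) k ^ d → aeval y f - f ∈ idealOfVars (Fin n) k ^ (d + 1) := by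
  have hy' : ∀ i, y i ∈ idealOfVars (Fin n) k := fun i => by
    have h1 := add_mem (Ideal.pow_le_self two_ne_zero (hy i))
      (Ideal.subset_span (Set.mem_range_self i) : X i ∈ idealOfVars (Fin n) k)
    rwa [sub_add_cancel] at h1
  have h0 : ∀ f : MvPolynomial (Fin n) k, aeval y f - f ∈ idealOfVars (Fin n) k := by
    intro f
    induction f using MvPolynomial.induction_on with
    | C a =>
      rw [algHom_C, algebraMap_eq, sub_self]
      exact zero_mem _
    | add p q hp hq =>
      rw [map_add, add_sub_add_comm]
      exact add_mem hp hq
    | mul_X p i _ =>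
      rw [map_mul, aeval_X]
      exact sub_mem (Ideal.mul_mem_left _ _ (hy' i))
        (Ideal.mul_mem_left _ _ (Ideal.subset_span (Set.mem_range_self i)))
  have h1 : ∀ f ∈ idealOfVars (Fin n) k, aeval y f - f ∈ idealOfVars (Fin n) k ^ 2 := by
    intro f hf
    induction hf using Submodule.span_induction with
    | mem x hx =>
      obtain ⟨i, rfl⟩ := hx
      rw [aeval_X]
      exact hy i
    | zero =>
      rw [map_zero, sub_zero]
      exact zero_mem _
    | add p q _ _ hp hq =>
      rw [map_add, add_sub_add_comm]
      exact add_mem hp hq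
    | smul r p hp' hp =>
      have e : aeval y (r • p) - r • p = aeval y r * (aeval y p - p) + (aeval y r - r) * p := by
        rw [smul_eq_mul, map_mul]
        ring
      rw [e]
      refine add_mem (Ideal.mul_mem_left _ _ hp) ?_
      rw [pow_two]
      exact Ideal.mul_mem_mul (h0 r) hp'
  intro d
  induction d with
  | zero =>
    intro f _
    rw [zero_add, pow_one]
    exact h0 f
  | succ d ih =>
    intro f hf
    rw [pow_succ] at hf
    induction hf using Submodule.mul_induction_on' with
    | mem_mul_mem c hc b hb =>
      have e : aeval y (c * b) - c * b = (aeval y c - c) * aeval y b + c * (aeval y b - b) := by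
        rw [map_mul]
        ring
      have hb' : aeval y b ∈ idealOfVars (Fin n) k := by
        have := add_mem (h0 b) hb
        rwa [sub_add_cancel] at this
      rw [e]
      refine add_mem ?_ ?_
      · rw [pow_succ]
        exact Ideal.mul_mem_mul (ih c hc) hb'
      · rw [show d + 1 + 1 = d + 2 by ring, pow_add]
        exact Ideal.mul_mem_mul hc (h1 b hb)
    | add p _ q _ hp hq =>
      rw [map_add, add_sub_add_comm]
      exact add_mem hp hq

lemma mem_linearParts_sup {𝔞 : Ideal (MvPolynomial (Fin n) k)} {f : MvPolynomial (Fin n) k}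
    (hf : f ∈ 𝔞) (h0 : constantCoeff f = 0) :
    f ∈ Ideal.span (linearParts 𝔞) ⊔ idealOfVars (Fin n) k ^ 2 := by
  have h1 : f ∈ idealOfVars (Fin n) k ^ 1 := by
    rw [pow_one]
    exact mem_idealOfVars_iff.2 h0
  have h2 := sub_homogeneousComponent_mem h1
  have h3 : homogeneousComponent 1 f ∈ Ideal.span (linearParts 𝔞) :=
    Ideal.subset_span ⟨homogeneousComponent_isHomogeneous 1 f, f, hf, h2⟩
  rw [← add_sub_cancel (homogeneousComponent 1 f) f]
  exact add_mem (Ideal.mem_sup_left h3) (Ideal.mem_sup_right h2)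

/-- The truncation of the coordinate ring of the tangent space. -/
abbrev TangentTruncation (𝔞 : Ideal (MvPolynomial (Fin n) k)) (e : ℕ) : Type u :=
  MvPolynomial (Fin n) k ⧸ (Ideal.span (linearParts 𝔞) ⊔ idealOfVars (Fin n) k ^ e)

/-- A nonzero constant plus a nilpotent is a unit. This lets maps extend from `A / 𝔞` to its local
ring at the origin. -/
lemma isUnit_tangentTruncation {𝔞 : Ideal (MvPolynomial (Fin n) k)} {e : ℕ}
    {f : MvPolynomial (Fin n) k} (hf : constantCoeff f ≠ 0) :
    IsUnit (Ideal.Quotient.mk (Ideal.span (linearParts 𝔞) ⊔ idealOfVars (Fin n) k ^ e) f) := by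
  rw [← add_sub_cancel (C (constantCoeff f)) f, map_add]
  refine IsNilpotent.isUnit_add_left_of_commute ⟨e, ?_⟩ ?_ (Commute.all _ _)
  · rw [← map_pow, Ideal.Quotient.eq_zero_iff_mem]
    refine Ideal.mem_sup_right (Ideal.pow_mem_pow (mem_idealOfVars_iff.2 ?_) e)
    rw [map_sub, constantCoeff_C, sub_self]
  · exact ((isUnit_iff_ne_zero.2 hf).map C).map _

lemma exists_algHom_lift {k A B B' : Type*} [CommRing k] [CommRing A] [CommRing B] [CommRing B']
    [Algebra k A] [Algebra k B] [Algebra k B'] [Algebra.FormallySmooth k A] (f : A →ₐ[k] B')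
    (r : B →ₐ[k] B') (hr : Function.Surjective r) (hnil : IsNilpotent (RingHom.ker (r : B →+* B'))) :
    ∃ θ : A →ₐ[k] B, ∀ x, r (θ x) = f x :=
  ⟨_, Algebra.FormallySmooth.liftOfSurjective_apply f r hr hnil⟩

/-- At a smooth rational point, the tangent cone is the tangent space: the initial forms of elements
of the ideal are generated by their linear parts. -/
lemma mem_span_linearParts {𝔞 : Ideal (MvPolynomial (Fin n) k)}
    {P : PrimeSpectrum (MvPolynomial (Fin n) k ⧸ 𝔞)}
    (hP : P ∈ Algebra.smoothLocus k (MvPolynomial (Fin n) k ⧸ 𝔞))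
    (hP0 : P.asIdeal.comap (Ideal.Quotient.mk 𝔞) = RingHom.ker (constantCoeff (σ := Fin n)))
    {f a : MvPolynomial (Fin n) k} {d : ℕ} (hf : f ∈ 𝔞) (ha : a.IsHomogeneous d)
    (hfa : f - a ∈ idealOfVars (Fin n) k ^ (d + 1)) : a ∈ Ideal.span (linearParts 𝔞) := by
  have h𝔞 : ∀ g ∈ 𝔞, constantCoeff g = 0 := by
    intro g hg
    have : g ∈ P.asIdeal.comap (Ideal.Quotient.mk 𝔞) := by
      rw [Ideal.mem_comap, Ideal.Quotient.eq_zero_iff_mem.2 hg]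
      exact zero_mem _
    rw [hP0] at this
    exact this
  rcases d with _ | d
  · rw [← homogeneousComponent_eq_self ha, homogeneousComponent_zero]
    have h1 := Ideal.pow_le_self one_ne_zero hfa
    rw [mem_idealOfVars_iff, map_sub, h𝔞 f hf, zero_sub, neg_eq_zero] at h1
    change C (constantCoeff a) ∈ _
    rw [h1, map_zero]
    exact zero_mem _
  have : Algebra.FormallySmooth k (Localization.AtPrime P.asIdeal) := hP
  -- Modulo `𝔪²` an element of `𝔞` equals its linear part, so the truncated tangent space of order
  -- `2` receives a map from `A / 𝔞`.
  let f₀ : (MvPolynomial (Fin n) k ⧸ 𝔞) →ₐ[k] TangentTruncation 𝔞 2 :=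
    Ideal.Quotient.liftₐ 𝔞 (Ideal.Quotient.mkₐ k _) fun g hg =>
      Ideal.Quotient.eq_zero_iff_mem.2 (mem_linearParts_sup hg (h𝔞 g hg))
  let f₁ : Localization.AtPrime P.asIdeal →ₐ[k] TangentTruncation 𝔞 2 :=
    IsLocalization.liftAlgHom (M := P.asIdeal.primeCompl) (f := f₀) (by
      rintro ⟨y, hy⟩
      obtain ⟨g, rfl⟩ := Ideal.Quotient.mk_surjective y
      refine isUnit_tangentTruncation (f := g) fun h0 => hy ?_
      have : g ∈ RingHom.ker (constantCoeff (σ := Fin n) (R := k)) := h0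
      rw [← hP0] at this
      exact this)
  have hle : Ideal.span (linearParts 𝔞) ⊔ idealOfVars (Fin n) k ^ (d + 2) ≤
      Ideal.span (linearParts 𝔞) ⊔ idealOfVars (Fin n) k ^ 2 :=
    sup_le_sup_left (Ideal.pow_le_pow_right (by omega)) _
  let r : TangentTruncation 𝔞 (d + 2) →ₐ[k] TangentTruncation 𝔞 2 := Ideal.Quotient.factorₐ k hle
  have hr : Function.Surjective r := Ideal.Quotient.factor_surjective hle
  have hker : ∀ x, r x = 0 → ∃ g ∈ idealOfVars (Fin n) k ^ 2, Ideal.Quotient.mk _ g = x := by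
    intro x hx
    obtain ⟨g, rfl⟩ := Ideal.Quotient.mk_surjective x
    have hg : g ∈ Ideal.span (linearParts 𝔞) ⊔ idealOfVars (Fin n) k ^ 2 :=
      Ideal.Quotient.eq_zero_iff_mem.1 hx
    obtain ⟨b, hb, c, hc, rfl⟩ := Submodule.mem_sup.1 hg
    refine ⟨c, hc, Ideal.Quotient.eq.2 ?_⟩
    rw [sub_add_cancel_right]
    exact Ideal.mem_sup_left (neg_mem hb)
  have hnil : IsNilpotent (RingHom.ker (r : TangentTruncation 𝔞 (d + 2) →+*
      TangentTruncation 𝔞 2)) := by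
    refine ⟨d + 2, le_bot_iff.1 ?_⟩
    have h2 : RingHom.ker (r : TangentTruncation 𝔞 (d + 2) →+* TangentTruncation 𝔞 2) ≤
        (idealOfVars (Fin n) k).map (Ideal.Quotient.mk _) := by
      intro x hx
      obtain ⟨g, hg, rfl⟩ := hker x hx
      exact Ideal.mem_map_of_mem _ (Ideal.pow_le_self two_ne_zero hg)
    refine (Ideal.pow_right_mono h2 (d + 2)).trans ?_
    rw [← Ideal.map_pow, Ideal.map_le_iff_le_comap]
    intro g hg
    exact Ideal.Quotient.eq_zero_iff_mem.2 (Ideal.mem_sup_right hg)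
  -- Formal smoothness of the local ring lifts this map to the truncation of order `d + 2`; the
  -- target form now has degree `d + 1`.
  obtain ⟨θ, hθ⟩ := exists_algHom_lift (A := Localization.AtPrime P.asIdeal) f₁ r hr hnil
  let ψ : MvPolynomial (Fin n) k →ₐ[k] TangentTruncation 𝔞 (d + 2) :=
    (θ.comp (IsScalarTower.toAlgHom k (MvPolynomial (Fin n) k ⧸ 𝔞)
      (Localization.AtPrime P.asIdeal))).comp (Ideal.Quotient.mkₐ k 𝔞)
  have hψ : ∀ g, r (ψ g) = Ideal.Quotient.mk _ g := by
    intro g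
    refine (hθ _).trans ?_
    exact IsLocalization.lift_eq _ _
  -- In coordinates the lift is a substitution `y` with `y i ≡ X i` modulo `𝔪²`, and it kills `𝔞` up
  -- to linear parts and `𝔪 ^ (d + 2)`.
  have hy : ∀ i, ∃ y : MvPolynomial (Fin n) k, y - X i ∈ idealOfVars (Fin n) k ^ 2 ∧
      Ideal.Quotient.mk _ y = ψ (X i) := by
    intro i
    obtain ⟨g, hg, e⟩ := hker (ψ (X i) - Ideal.Quotient.mk _ (X i)) (by
      rw [map_sub, hψ]
      exact sub_self _)
    exact ⟨X i + g, by rwa [add_sub_cancel_left], by rw [map_add, e, add_sub_cancel]⟩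
  choose y hy hy' using hy
  have hψy : ∀ g, ψ g = Ideal.Quotient.mk _ (aeval y g) := by
    intro g
    have : ψ = (Ideal.Quotient.mkₐ k _).comp (aeval y) := by
      apply algHom_ext
      intro i
      refine (hy' i).symm.trans ?_
      rw [AlgHom.comp_apply, aeval_X]
      rfl
    rw [this]
    rfl
  have h3 : aeval y f ∈ Ideal.span (linearParts 𝔞) ⊔ idealOfVars (Fin n) k ^ (d + 2) := by
    rw [← Ideal.Quotient.eq_zero_iff_mem, ← hψy]
    change θ (algebraMap _ _ (Ideal.Quotient.mk 𝔞 f)) = 0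
    rw [Ideal.Quotient.eq_zero_iff_mem.2 hf, map_zero, map_zero]
  have h4 : a - aeval y f ∈ idealOfVars (Fin n) k ^ (d + 2) := by
    have e1 := aeval_sub_mem hy (d + 1) a (mem_pow_idealOfVars_of_isHomogeneous ha)
    have e2 := aeval_sub_mem hy (d + 2) _ hfa
    have e3 := add_mem (add_mem e1 (Ideal.pow_le_pow_right (Nat.le_succ _) e2)) hfa
    have : a - aeval y f =
        -(aeval y a - a + (aeval y (f - a) - (f - a)) + (f - a)) := by
      rw [map_sub]
      ring
    rw [this]
    exact neg_mem e3
  -- Thus `a` agrees modulo `𝔪 ^ (d + 2)` with an element of the homogeneous ideal of linear parts;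
  -- compare components of degree `d + 1`.
  obtain ⟨b, hb, c, hc, e⟩ := Submodule.mem_sup.1 h3
  have h5 : a = b + (c + (a - aeval y f)) := by
    rw [← add_assoc, e]
    ring
  have h6 := homogeneousComponent_of_mem_pow_idealOfVars (add_mem hc h4) (Nat.lt_succ_self (d + 1))
  rw [← homogeneousComponent_eq_self ha, h5, map_add, h6, add_zero]
  exact homogeneousComponent_mem_span (fun l hl => hl.1) hb _

end Smooth
/-! ### Coefficients with respect to the first variable -/

section Coefficients

variable {k : Type u} [Field k] {N : ℕ}

/-- The coefficient of `x₀ ^ a`. -/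
noncomputable def headCoeff (a : ℕ) : R k N →+ S k N :=
  (Polynomial.lcoeff (S k N) a).toAddMonoidHom.comp
    (finSuccEquiv k N).toRingEquiv.toRingHom.toAddMonoidHom

lemma headCoeff_apply (a : ℕ) (f : R k N) : headCoeff a f = (finSuccEquiv k N f).coeff a := rfl

lemma coeff_headCoeff (a : ℕ) (f : R k N) (m : Fin N →₀ ℕ) :
    coeff m (headCoeff a f) = coeff (m.cons a) f :=
  finSuccEquiv_coeff_coeff m f a

lemma eq_zero_of_headCoeff {f : R k N} (h : ∀ a, headCoeff a f = 0) : f = 0 := by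
  rw [← map_eq_zero_iff (finSuccEquiv k N) (finSuccEquiv k N).injective]
  exact Polynomial.ext h

lemma finSuccEquiv_C (a : k) : finSuccEquiv k N (C a) = Polynomial.C (C a) :=
  (finSuccEquiv k N).commutes a

lemma finSuccEquiv_rename_succ (p : S k N) :
    finSuccEquiv k N (rename Fin.succ p) = Polynomial.C p := by
  induction p using MvPolynomial.induction_on with
  | C a =>
    rw [rename_C]
    exact finSuccEquiv_C a
  | add p q hp hq => rw [map_add, map_add, hp, hq, Polynomial.C_add]
  | mul_X p i hp => rw [map_mul, map_mul, rename_X, hp, finSuccEquiv_X_succ, Polynomial.C_mul]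

lemma headCoeff_rename_mul (a : ℕ) (p : S k N) (f : R k N) :
    headCoeff a (rename Fin.succ p * f) = p * headCoeff a f := by
  rw [headCoeff_apply, map_mul, finSuccEquiv_rename_succ, Polynomial.coeff_C_mul]
  rfl

lemma headCoeff_X_succ_mul (a : ℕ) (i : Fin N) (f : R k N) :
    headCoeff a (X i.succ * f) = X i * headCoeff a f := by
  rw [← headCoeff_rename_mul, rename_X]

lemma headCoeff_succ_X_zero_mul (a : ℕ) (f : R k N) :
    headCoeff (a + 1) (X 0 * f) = headCoeff a f := by
  rw [headCoeff_apply, map_mul, finSuccEquiv_X_zero, Polynomial.coeff_X_mul]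
  rfl

lemma degree_cons (a : ℕ) (m : Fin N →₀ ℕ) : (m.cons a).degree = a + m.degree := by
  rw [Finsupp.degree_eq_sum, Finsupp.degree_eq_sum, Fin.sum_univ_succ, Finsupp.cons_zero]
  simp only [Finsupp.cons_succ]

lemma headCoeff_homogeneousComponent (a d : ℕ) (f : R k N) :
    headCoeff a (homogeneousComponent d f) =
      if a ≤ d then homogeneousComponent (d - a) (headCoeff a f) else 0 := by
  ext m
  rw [coeff_headCoeff, coeff_homogeneousComponent, degree_cons]
  split_ifs with h1 h2 h2
  · rw [coeff_homogeneousComponent, if_pos (by omega), coeff_headCoeff]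
  · omega
  · rw [coeff_homogeneousComponent, if_neg (by omega)]
  · rfl

lemma isHomogeneous_headCoeff {c : ℕ} {f : R k N} (hf : f.IsHomogeneous c) {a e : ℕ}
    (h : a + e = c) : (headCoeff a f).IsHomogeneous e := by
  have := headCoeff_homogeneousComponent a c f
  rw [homogeneousComponent_eq_self hf, if_pos (by omega), show c - a = e by omega] at this
  rw [this]
  exact homogeneousComponent_isHomogeneous _ _

lemma headCoeff_eq_zero_of_lt {c : ℕ} {f : R k N} (hf : f.IsHomogeneous c) {a : ℕ} (h : c < a) :
    headCoeff a f = 0 := by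
  have := headCoeff_homogeneousComponent a c f
  rwa [homogeneousComponent_eq_self hf, if_neg (by omega)] at this

lemma exists_headCoeff_eq_zero (f : R k N) : ∃ n, ∀ a, n ≤ a → headCoeff a f = 0 :=
  ⟨(finSuccEquiv k N f).natDegree + 1, fun _ ha => Polynomial.coeff_eq_zero_of_natDegree_lt ha⟩

/-- Dehomogenization. -/
noncomputable abbrev dehomogenize : R k N →ₐ[k] S k N := aeval (Fin.cons 1 X)

lemma dehomogenize_eq_sum (f : R k N) {n : ℕ} (hn : ∀ a, n ≤ a → headCoeff a f = 0) :
    dehomogenize f = ∑ a ∈ Finset.range n, headCoeff a f := by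
  have h1 : dehomogenize f = (finSuccEquiv k N f).eval 1 := by
    clear hn
    induction f using MvPolynomial.induction_on with
    | C a =>
      rw [algHom_C, finSuccEquiv_C, Polynomial.eval_C]
      rfl
    | add p q hp hq => rw [map_add, map_add, Polynomial.eval_add, hp, hq]
    | mul_X p i hp =>
      rw [map_mul, map_mul, Polynomial.eval_mul, hp, aeval_X]
      cases i using Fin.cases with
      | zero => rw [finSuccEquiv_X_zero, Polynomial.eval_X, Fin.cons_zero]
      | succ i => rw [finSuccEquiv_X_succ, Polynomial.eval_C, Fin.cons_succ]
  rw [h1, Polynomial.eval_eq_sum]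
  refine (Polynomial.sum_over_range' _ (fun _ => zero_mul _) (n + (finSuccEquiv k N f).natDegree + 1)
    (by omega)).trans ?_
  symm
  refine (Finset.sum_subset (Finset.range_mono (by omega)) fun a _ ha => ?_).trans
    (Finset.sum_congr rfl fun a _ => ?_)
  · exact hn a (not_lt.1 fun h => ha (Finset.mem_range.2 h))
  · rw [one_pow, mul_one]
    rfl

/-- Distinct `x₀`-coefficients of a form have distinct degrees, so setting `x₀ = 1` loses nothing.
-/
lemma headCoeff_of_isHomogeneous {D : ℕ} {f : R k N} (hf : f.IsHomogeneous D) {a e : ℕ}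
    (h : a + e = D) : headCoeff a f = homogeneousComponent e (dehomogenize f) := by
  rw [dehomogenize_eq_sum f (n := D + 1) fun b hb => headCoeff_eq_zero_of_lt hf hb, map_sum,
    Finset.sum_eq_single a]
  · rw [homogeneousComponent_eq_self (isHomogeneous_headCoeff hf h)]
  · intro b hb hba
    have hb' : b ≤ D := Nat.lt_succ_iff.1 (Finset.mem_range.1 hb)
    rw [homogeneousComponent_of_mem (isHomogeneous_headCoeff hf (Nat.add_sub_of_le hb')),
      if_neg (by omega)]
  · intro ha
    exact absurd (Finset.mem_range.2 (by omega)) ha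

/-! ### Partial elimination ideals of homogeneous ideals -/

/-- Closure under taking homogeneous components. -/
def HasComponents (J : Ideal (R k N)) : Prop :=
  ∀ f ∈ J, ∀ n : ℕ, homogeneousComponent n f ∈ J

variable {J : Ideal (R k N)}

lemma mem_degreeLT_iff {i : ℕ} {f : R k N} :
    finSuccEquiv k N f ∈ Polynomial.degreeLT (S k N) i ↔ ∀ a, i ≤ a → headCoeff a f = 0 := by
  rw [Polynomial.mem_degreeLT, Polynomial.degree_lt_iff_coeff_zero]
  rfl

lemma mem_KTilde_iff {i : ℤ} {f : R k N} : finSuccEquiv k N f ∈ KTilde J i ↔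
    f ∈ J ∧ ∀ a, (i + 1).toNat ≤ a → headCoeff a f = 0 := by
  rw [KTilde, Submodule.mem_inf, mem_degreeLT_iff, and_comm]
  refine and_congr ?_ Iff.rfl
  change (finSuccEquiv k N).symm (finSuccEquiv k N f) ∈ J ↔ _
  rw [AlgEquiv.symm_apply_apply]

lemma mem_K_iff {i : ℕ} {a : S k N} : a ∈ K J i ↔
    ∃ g ∈ J, (∀ b, i + 1 ≤ b → headCoeff b g = 0) ∧ headCoeff i g = a := by
  have h1 : K J i = (KTilde J i).map (Polynomial.lcoeff (S k N) i) :=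
    Submodule.span_eq ((KTilde J i).map (Polynomial.lcoeff (S k N) i))
  rw [h1, Submodule.mem_map]
  constructor
  · rintro ⟨g, hg, rfl⟩
    obtain ⟨g, rfl⟩ := (finSuccEquiv k N).surjective g
    exact ⟨g, (mem_KTilde_iff.1 hg).1, (mem_KTilde_iff.1 hg).2, rfl⟩
  · rintro ⟨g, hg, h0, rfl⟩
    exact ⟨_, mem_KTilde_iff.2 ⟨hg, h0⟩, rfl⟩

lemma exists_isHomogeneous_of_mem_K (hJ : HasComponents J) {i e : ℕ} {a : S k N} (ha : a ∈ K J i)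
    (he : a.IsHomogeneous e) : ∃ g ∈ J, g.IsHomogeneous (e + i) ∧
      (∀ b, i + 1 ≤ b → headCoeff b g = 0) ∧ headCoeff i g = a := by
  obtain ⟨g, hg, h0, rfl⟩ := mem_K_iff.1 ha
  refine ⟨_, hJ g hg (e + i), homogeneousComponent_isHomogeneous _ _, fun b hb => ?_, ?_⟩
  · rw [headCoeff_homogeneousComponent, h0 b hb, map_zero, ite_self]
  · rw [headCoeff_homogeneousComponent, if_pos (by omega), Nat.add_sub_cancel,
      homogeneousComponent_eq_self he]

lemma homogeneousComponent_mem_K (hJ : HasComponents J) {i : ℕ} {a : S k N} (ha : a ∈ K J i)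
    (e : ℕ) : homogeneousComponent e a ∈ K J i := by
  obtain ⟨g, hg, h0, rfl⟩ := mem_K_iff.1 ha
  refine mem_K_iff.2 ⟨_, hJ g hg (e + i), fun b hb => ?_, ?_⟩
  · rw [headCoeff_homogeneousComponent, h0 b hb, map_zero, ite_self]
  · rw [headCoeff_homogeneousComponent, if_pos (by omega), Nat.add_sub_cancel]

lemma K_mono : Monotone (K J) := by
  refine monotone_nat_of_le_succ fun i a ha => ?_
  obtain ⟨g, hg, h0, rfl⟩ := mem_K_iff.1 ha
  refine mem_K_iff.2 ⟨X 0 * g, J.mul_mem_left _ hg, fun b hb => ?_, headCoeff_succ_X_zero_mul i g⟩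
  obtain ⟨b, rfl⟩ := Nat.exists_eq_add_of_le' (show 1 ≤ b by omega)
  rw [headCoeff_succ_X_zero_mul]
  exact h0 b (by omega)

/-- The ascending chain stabilizes because `S` is noetherian, so the infimum is attained and is not
the default value of `sInf ∅`. -/
lemma K_eq_of_stabilizationNumber_le {i : ℕ} (hi : stabilizationNumber J ≤ i) :
    K J i = K J (stabilizationNumber J) := by
  obtain ⟨n, hn⟩ := monotone_stabilizes_iff_noetherian.2 inferInstance
    (⟨K J, K_mono⟩ : ℕ →o Ideal (S k N))
  have h : stabilizationNumber J ∈ {i | ∀ j, i ≤ j → K J j = K J i} :=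
    Nat.sInf_mem ⟨n, fun j hj => (hn j hj).symm⟩
  exact h i hi

lemma K_le_stabilizationNumber (i : ℕ) : K J i ≤ K J (stabilizationNumber J) :=
  (K_mono (le_max_left i _)).trans (K_eq_of_stabilizationNumber_le (le_max_right _ _)).le

/-- At a smooth rational point, the stable partial elimination ideal is generated by linear
forms. -/
theorem K_stabilizationNumber_eq_span (hJ : HasComponents J) (hq : IsSmoothPointAtOrigin J) :
    K J (stabilizationNumber J) = Ideal.span (linearParts (affineIdeal J)) := by
  obtain ⟨P, hP, hP0⟩ := hq
  apply le_antisymm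
  · intro a ha
    rw [← sum_homogeneousComponent a]
    refine sum_mem fun e _ => ?_
    obtain ⟨g, hg, hgh, h0, e1⟩ := exists_isHomogeneous_of_mem_K hJ
      (homogeneousComponent_mem_K hJ ha e) (homogeneousComponent_isHomogeneous e a)
    refine mem_span_linearParts hP hP0 (f := dehomogenize g) (d := e) (Ideal.mem_map_of_mem _ hg)
      (homogeneousComponent_isHomogeneous e a) ?_
    -- The form `g` has degree `e + s`, so its coefficients of `x₀ ^ b` with `b < s` have degree
    -- above `e`: the leading coefficient is the initial form of the dehomogenization.
    rw [dehomogenize_eq_sum g h0, Finset.sum_range_succ, e1, add_sub_cancel_right]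
    refine sum_mem fun b hb => ?_
    have hb' := Finset.mem_range.1 hb
    refine Ideal.pow_le_pow_right ?_ (mem_pow_idealOfVars_of_isHomogeneous
      (isHomogeneous_headCoeff hgh
        (show b + (e + stabilizationNumber J - b) = e + stabilizationNumber J by omega)))
    omega
  · rw [Ideal.span_le]
    rintro l ⟨hl, f, hf, hfl⟩
    have hs : Function.Surjective (dehomogenize : R k N →ₐ[k] S k N) := by
      intro p
      refine ⟨rename Fin.succ p, ?_⟩
      rw [aeval_rename]
      exact aeval_X_left_apply p
    obtain ⟨h, hh, rfl⟩ := (Ideal.mem_map_iff_of_surjective _ hs).1 hf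
    let D := h.totalDegree + 1
    -- Homogenize in degree `D`: the coefficient of `x₀ ^ D` is the constant term, which vanishes,
    -- and that of `x₀ ^ (D - 1)` is the linear part `l`. The extra `1` in `D` ensures that `D - 1`
    -- makes sense.
    let h' : R k N := ∑ c ∈ Finset.range D, X 0 ^ (D - c) * homogeneousComponent c h
    have h1 : h' ∈ J := sum_mem fun c _ => J.mul_mem_left _ (hJ h hh c)
    have h2 : h'.IsHomogeneous D := by
      refine IsHomogeneous.sum _ _ _ fun c hc => ?_
      have := ((isHomogeneous_X k (0 : Fin (N + 1))).pow (D - c)).mul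
        (homogeneousComponent_isHomogeneous c h)
      rwa [one_mul, Nat.sub_add_cancel (Finset.mem_range.1 hc).le] at this
    have h3 : dehomogenize h' = dehomogenize h := by
      conv_rhs => rw [← sum_homogeneousComponent h]
      rw [map_sum, map_sum]
      refine Finset.sum_congr rfl fun c _ => ?_
      rw [map_mul, map_pow, aeval_X, Fin.cons_zero, one_pow, one_mul]
    have h4 : ∀ e, e < 2 → homogeneousComponent e (dehomogenize h) = homogeneousComponent e l := by
      intro e he
      rw [← sub_eq_zero, ← map_sub]
      exact homogeneousComponent_of_mem_pow_idealOfVars hfl he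
    refine K_le_stabilizationNumber (D - 1) (mem_K_iff.2 ⟨h', h1, fun b hb => ?_, ?_⟩)
    · rcases lt_or_ge D b with hb' | hb'
      · exact headCoeff_eq_zero_of_lt h2 hb'
      · rw [headCoeff_of_isHomogeneous h2 (show b + 0 = D by omega), h3, h4 0 (by omega),
          homogeneousComponent_of_mem hl, if_neg zero_ne_one]
    · rw [headCoeff_of_isHomogeneous h2 (show D - 1 + 1 = D by omega), h3, h4 1 (by omega),
        homogeneousComponent_eq_self hl]

end Coefficients
/-! ### The pencil attached to partial elimination -/

section Elimination

variable {k : Type u} [Field k] {N : ℕ} {J : Ideal (R k N)}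

/-- The homogeneous elements of `J` of degree less than `i` in the first variable. -/
noncomputable def elimParts (J : Ideal (R k N)) (i j : ℕ) : AddSubgroup (R k N) :=
  idealParts J j ⊓
    { carrier := {f | ∀ a, i ≤ a → headCoeff a f = 0}
      zero_mem' := fun _ _ => map_zero _
      add_mem' := fun {f g} hf hg a ha => by rw [map_add, hf a ha, hg a ha, add_zero]
      neg_mem' := fun {f} hf a ha => by rw [map_neg, hf a ha, neg_zero] }

lemma mem_elimParts {i j : ℕ} {f : R k N} :
    f ∈ elimParts J i j ↔ f ∈ idealParts J j ∧ ∀ a, i ≤ a → headCoeff a f = 0 := Iff.rfl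

lemma mem_extendGrading_elimParts {i : ℕ} {c : ℤ} {f : R k N} :
    f ∈ extendGrading (elimParts J i) c ↔
      f ∈ extendGrading (idealParts J) c ∧ ∀ a, i ≤ a → headCoeff a f = 0 := by
  rcases lt_or_ge c 0 with hc | hc
  · rw [extendGrading_of_neg _ hc, extendGrading_of_neg _ hc, AddSubgroup.mem_bot]
    exact ⟨fun h => ⟨h, fun a _ => h ▸ map_zero _⟩, fun h => h.1⟩
  · lift c to ℕ using hc
    rw [extendGrading_natCast, extendGrading_natCast, mem_elimParts]

lemma headCoeff_mem_extendGrading {c : ℤ} {f : R k N} (hf : f ∈ extendGrading (idealParts J) c)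
    (a : ℕ) : headCoeff a f ∈ extendGrading (idealParts (⊤ : Ideal (S k N))) (c - a) := by
  rcases lt_or_ge c 0 with hc | hc
  · rw [extendGrading_of_neg _ hc, AddSubgroup.mem_bot] at hf
    rw [hf, map_zero]
    exact zero_mem _
  · lift c to ℕ using hc
    rw [extendGrading_natCast] at hf
    rcases lt_or_ge c a with h | h
    · rw [headCoeff_eq_zero_of_lt hf.2 h]
      exact zero_mem _
    · rw [← Nat.cast_sub h, extendGrading_natCast]
      exact ⟨trivial, isHomogeneous_headCoeff hf.2 (by omega)⟩

lemma headCoeff_mem_extendGrading_K {i : ℕ} {c : ℤ} {f : R k N}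
    (hf : f ∈ extendGrading (elimParts J (i + 1)) c) :
    headCoeff i f ∈ extendGrading (idealParts (K J i)) (c - i) := by
  rw [mem_extendGrading_elimParts] at hf
  rw [mem_extendGrading_idealParts]
  exact ⟨mem_K_iff.2 ⟨f, (mem_extendGrading_idealParts.1 hf.1).1, hf.2, rfl⟩,
    headCoeff_mem_extendGrading hf.1 i⟩

lemma exists_headCoeff_eq (hJ : HasComponents J) {i : ℕ} {c : ℤ} {u : S k N}
    (hu : u ∈ extendGrading (idealParts (K J i)) (c - i)) :
    ∃ f ∈ extendGrading (elimParts J (i + 1)) c, headCoeff i f = u := by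
  rcases lt_or_ge (c - i) 0 with hc | hc
  · rw [extendGrading_of_neg _ hc, AddSubgroup.mem_bot] at hu
    exact ⟨0, zero_mem _, by rw [hu, map_zero]⟩
  · obtain ⟨e, he⟩ := Int.eq_ofNat_of_zero_le hc
    rw [he, extendGrading_natCast] at hu
    obtain ⟨g, hg, hgh, h0, h1⟩ := exists_isHomogeneous_of_mem_K hJ hu.1 hu.2
    refine ⟨g, ?_, h1⟩
    rw [show c = ((e + i : ℕ) : ℤ) by push_cast; omega, extendGrading_natCast]
    exact ⟨⟨hg, hgh⟩, h0⟩

lemma headCoeff_succ_mulVar_zero (a : ℕ) (f : R k N) :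
    headCoeff (a + 1) (mulVar (N + 1) k (R k N) 0 f) = headCoeff a f :=
  headCoeff_succ_X_zero_mul a f

lemma headCoeff_zero_mulVar_zero (f : R k N) :
    headCoeff 0 (mulVar (N + 1) k (R k N) 0 f) = 0 := by
  rw [mulVar_apply, smul_eq_mul, headCoeff_apply, map_mul, finSuccEquiv_X_zero,
    Polynomial.mul_coeff_zero, Polynomial.coeff_X_zero, zero_mul]

lemma headCoeff_mulVar_succ (a : ℕ) (i : Fin N) (f : R k N) :
    headCoeff a (mulVar (N + 1) k (R k N) i.succ f) = mulVar N k (S k N) i (headCoeff a f) :=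
  headCoeff_X_succ_mul a i f

lemma mulVar_succ_mem_elimParts {i : ℕ} (c : ℤ) (j : Fin N) (f : R k N)
    (hf : f ∈ extendGrading (elimParts J i) c) :
    mulVar (N + 1) k (R k N) j.succ f ∈ extendGrading (elimParts J i) (c + 1) := by
  rw [mem_extendGrading_elimParts] at hf ⊢
  exact ⟨mulVar_mem_idealParts c _ f hf.1, fun a ha => by
    rw [headCoeff_mulVar_succ, hf.2 a ha, map_zero]⟩

/-- Only the reduction of `J` to `x₀`-degree at most `s` uses stabilization; the remaining
conditions express that `x₀` raises the `x₀`-degree by exactly one. -/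
theorem isPencil_elimParts (hJ : HasComponents J) :
    IsPencil (mulVar (N + 1) k (R k N)) (extendGrading (idealParts J))
      (extendGrading (elimParts J (stabilizationNumber J)))
      (extendGrading (elimParts J (stabilizationNumber J + 1))) where
  comm := mulVar_comm
  op_mem := mulVar_mem_idealParts
  op_succ_mem := mulVar_succ_mem_elimParts
  left_le _ _ h := (mem_extendGrading_elimParts.1 h).1
  right_le _ _ h := (mem_extendGrading_elimParts.1 h).1
  op_zero_mem c f hf := by
    rw [mem_extendGrading_elimParts] at hf ⊢
    refine ⟨mulVar_mem_idealParts c _ f hf.1, fun a ha => ?_⟩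
    obtain ⟨a, rfl⟩ := Nat.exists_eq_add_of_le' (show 1 ≤ a by omega)
    rw [headCoeff_succ_mulVar_zero]
    exact hf.2 a (by omega)
  mem_of_op_zero_mem c f hf h := by
    rw [mem_extendGrading_elimParts] at h ⊢
    exact ⟨hf, fun a ha => headCoeff_succ_mulVar_zero a f ▸ h.2 (a + 1) (by omega)⟩
  exists_sub_mem c f hf := by
    obtain ⟨n, hn⟩ := exists_headCoeff_eq_zero f
    replace hn : ∀ a, stabilizationNumber J + 1 + n ≤ a → headCoeff a f = 0 :=
      fun a ha => hn a (by omega)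
    induction n generalizing f with
    | zero =>
      exact ⟨0, zero_mem _, by
        rw [map_zero, sub_zero]
        exact mem_extendGrading_elimParts.2 ⟨hf, hn⟩⟩
    | succ n ih =>
      -- The coefficient of `x₀ ^ (s + n + 1)` also lies in `K_{s+n}`. Lift it to `g ∈ J` of
      -- `x₀`-degree at most `s + n`; then `f - x₀ g` has smaller `x₀`-degree.
      have h1 := headCoeff_mem_extendGrading_K (i := stabilizationNumber J + n + 1)
        (mem_extendGrading_elimParts.2 ⟨hf, fun a ha => hn a (by omega)⟩)
      rw [K_eq_of_stabilizationNumber_le (by omega),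
        ← K_eq_of_stabilizationNumber_le (i := stabilizationNumber J + n) (by omega),
        show c - ((stabilizationNumber J + n + 1 : ℕ) : ℤ) =
          c - 1 - ((stabilizationNumber J + n : ℕ) : ℤ) by push_cast; ring] at h1
      obtain ⟨g, hg, e⟩ := exists_headCoeff_eq hJ h1
      rw [mem_extendGrading_elimParts] at hg
      have hg' := mulVar_mem_idealParts _ 0 g hg.1
      rw [sub_add_cancel] at hg'
      obtain ⟨w, hw, hw'⟩ := ih (f - mulVar (N + 1) k (R k N) 0 g) (sub_mem hf hg') (by
        intro a ha
        obtain ⟨a, rfl⟩ := Nat.exists_eq_add_of_le' (show 1 ≤ a by omega)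
        rw [map_sub, headCoeff_succ_mulVar_zero]
        rcases (show stabilizationNumber J + n ≤ a by omega).eq_or_lt with rfl | h
        · rw [e, sub_self]
        · rw [hn _ (by omega), hg.2 _ (by omega), sub_zero])
      refine ⟨w + g, add_mem hw hg.1, ?_⟩
      convert hw' using 1
      rw [map_add]
      abel

/-- Uses `0 → K̃_{s-1} → K̃_s → K_s(-s) → 0`: the linear resolution of `K_s` is visible only where
`c - s = 1`. -/
lemma koszulExact_elimParts_succ (hJ : HasComponents J) (hq : IsSmoothPointAtOrigin J) {p c : ℤ}
    (hc : c ≠ stabilizationNumber J + 1)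
    (h : KoszulExact (Fin.tail (mulVar (N + 1) k (R k N)))
      (extendGrading (elimParts J (stabilizationNumber J))) p c) :
    KoszulExact (Fin.tail (mulVar (N + 1) k (R k N)))
      (extendGrading (elimParts J (stabilizationNumber J + 1))) p c := by
  refine KoszulExact.of_extension (x' := mulVar N k (S k N)) (headCoeff (stabilizationNumber J))
    (C := extendGrading (idealParts (K J (stabilizationNumber J)))) (e := stabilizationNumber J)
    (fun i v => headCoeff_mulVar_succ _ i v) (fun i j v => mulVar_comm _ _ v) ?_ ?_ ?_ ?_ ?_ h ?_
  · exact extendGrading_mono fun j v hv => ⟨hv.1, fun a ha => hv.2 a (by omega)⟩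
  · exact mulVar_succ_mem_elimParts
  · exact fun c v hv => headCoeff_mem_extendGrading_K hv
  · exact fun c u hu => exists_headCoeff_eq hJ hu
  · intro c v hv h0
    rw [mem_extendGrading_elimParts] at hv ⊢
    refine ⟨hv.1, fun a ha => ?_⟩
    rcases ha.eq_or_lt with rfl | ha
    · exact h0
    · exact hv.2 a ha
  · rw [K_stabilizationNumber_eq_span hJ hq]
    exact koszulExact_of_span_linear (fun l hl => hl.1) (by omega)

/-- Every leading coefficient in `x₀` lies in `K_s`. -/
lemma eq_bot_of_K_stabilizationNumber_eq_bot (h : K J (stabilizationNumber J) = ⊥) : J = ⊥ := by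
  rw [eq_bot_iff]
  intro f hf
  obtain ⟨n, hn⟩ := exists_headCoeff_eq_zero f
  induction n with
  | zero => exact eq_zero_of_headCoeff fun a => hn a (by omega)
  | succ n ih =>
    refine ih fun a ha => ?_
    rcases ha.eq_or_lt with rfl | ha
    · have h1 := K_le_stabilizationNumber _ (mem_K_iff.2 ⟨f, hf, hn, rfl⟩)
      rwa [h] at h1
    · exact hn a ha

/-- A nonzero ideal has a minimal generator in the degree following the stabilization number. -/
theorem not_koszulExact_stabilizationNumber (hJ : HasComponents J) (hq : IsSmoothPointAtOrigin J)
    (h0 : J ≠ ⊥) : ¬ KoszulExact (mulVar (N + 1) k (R k N)) (extendGrading (idealParts J)) 0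
      ((stabilizationNumber J + 1 : ℕ) : ℤ) := by
  intro h
  rw [koszulExact_zero_iff, show ((stabilizationNumber J + 1 : ℕ) : ℤ) - 1 = stabilizationNumber J by
    push_cast; ring, extendGrading_natCast, extendGrading_natCast] at h
  have hK := K_stabilizationNumber_eq_span hJ hq
  -- In degree `s` the coefficient of `x₀ ^ s` is a constant, and `K_s` contains no nonzero
  -- constant.
  have hz : ∀ f ∈ idealParts J (stabilizationNumber J), headCoeff (stabilizationNumber J) f = 0 := by
    intro f hf
    have h1 : headCoeff (stabilizationNumber J) f ∈ K J (stabilizationNumber J) :=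
      mem_K_iff.2 ⟨f, hf.1, fun b hb => headCoeff_eq_zero_of_lt hf.2 hb, rfl⟩
    rw [hK] at h1
    have h2 := isHomogeneous_headCoeff hf.2 (add_zero (stabilizationNumber J))
    rw [← homogeneousComponent_eq_self h2, homogeneousComponent_zero]
    change C (constantCoeff _) = 0
    rw [constantCoeff_of_mem_span (fun l hl => hl.1) h1, map_zero]
  have hl : ∀ l ∈ linearParts (affineIdeal J), ∃ u ∈ idealParts J (stabilizationNumber J),
      l = headCoeff (stabilizationNumber J) (mulVar (N + 1) k (R k N) 0 u) := by
    intro l hl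
    obtain ⟨g, hg, hgh, _, rfl⟩ := exists_isHomogeneous_of_mem_K hJ
      (hK ▸ Ideal.subset_span hl : l ∈ K J (stabilizationNumber J)) hl.1
    obtain ⟨u, hu, rfl⟩ := h g ⟨hg, (Nat.add_comm 1 (stabilizationNumber J) ▸ hgh : g.IsHomogeneous _)⟩
    refine ⟨u 0, hu 0, ?_⟩
    -- In `g = ∑ x_i u_i` only `x₀ u_0` contributes to the coefficient of `x₀ ^ s`. Hence `l` comes
    -- from `u_0` in `x₀`-degree `s - 1`, or is zero if `s = 0`.
    rw [Fin.sum_univ_succ, map_add, map_sum, add_eq_left]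
    refine Finset.sum_eq_zero fun i _ => ?_
    rw [headCoeff_mulVar_succ, hz _ (hu _), map_zero]
  rcases hs : stabilizationNumber J with _ | t
  · refine h0 (eq_bot_of_K_stabilizationNumber_eq_bot ?_)
    rw [hK, Ideal.span_eq_bot]
    intro l hl'
    obtain ⟨u, _, rfl⟩ := hl l hl'
    rw [hs]
    exact headCoeff_zero_mulVar_zero u
  · have hle : K J (stabilizationNumber J) ≤ K J t := by
      rw [hK, Ideal.span_le]
      intro l hl'
      obtain ⟨u, hu, rfl⟩ := hl l hl'
      refine mem_K_iff.2 ⟨u, hu.1, fun b hb => ?_, ?_⟩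
      · rcases hb.eq_or_lt with rfl | hb
        · exact hs ▸ hz u hu
        · exact headCoeff_eq_zero_of_lt hu.2 (hs ▸ hb)
      · rw [hs, headCoeff_succ_mulVar_zero]
    -- Now `K_t = K_s` with `t = s - 1`, against the minimality of `s`.
    have hmem : t ∈ {i | ∀ j, i ≤ j → K J j = K J i} := fun j hj =>
      le_antisymm ((K_le_stabilizationNumber j).trans hle) (K_mono hj)
    have := Nat.sInf_le hmem
    change stabilizationNumber J ≤ t at this
    omega

end Elimination
/-! ### Graded modules of polynomials -/

section Embedded

variable {k : Type u} [Field k] {n : ℕ} {σ : Type}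

/-- Pulls the grading by total degree back to a module whose image is closed under components. The
scalars act through forms of a possibly larger polynomial ring, as `S` does on `K̃_i ⊆ R`. -/
lemma exists_isGradedModule_of_injective {V : Type u} [AddCommGroup V]
    [Module (MvPolynomial (Fin n) k) V] (φ : V →+ MvPolynomial σ k) (hφ : Function.Injective φ)
    (hr : ∀ j v, ∃ w, φ w = homogeneousComponent j (φ v))
    (hs : ∀ (m : Fin n →₀ ℕ) (c : k) (v : V), ∃ f : MvPolynomial σ k, f.IsHomogeneous m.degree ∧
      φ ((monomial m c : MvPolynomial (Fin n) k) • v) = f * φ v) :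
    ∃ π, IsGradedModule n k (fun j => (homogeneousSubmodule σ k j).toAddSubgroup.comap φ) π := by
  choose π hπ using hr
  refine ⟨fun j => AddMonoidHom.mk' (π j) fun v w => hφ ?_, ⟨fun {i j v} hv => hφ ?_, fun j v => ?_,
    fun v => ⟨(φ v).totalDegree + 1, hφ ?_⟩, fun {j v} m c hv => ?_⟩⟩
  · rw [map_add, hπ, hπ, hπ, map_add, map_add]
  · refine (hπ j v).trans ((homogeneousComponent_of_mem hv).trans ?_)
    simp only [eq_comm (a := i) (b := j)]
    split_ifs
    · rfl
    · rw [map_zero]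
  · change (φ (π j v)).IsHomogeneous j
    rw [hπ]
    exact homogeneousComponent_isHomogeneous j _
  · rw [map_sum]
    exact (Finset.sum_congr rfl fun j _ => hπ j v).trans (sum_homogeneousComponent (φ v))
  · obtain ⟨f, hf, e⟩ := hs m c v
    change (φ (_ • v)).IsHomogeneous (j + m.degree)
    rw [e, add_comm]
    exact hf.mul hv

lemma extendGrading_eq_map {V V' : Type u} [AddCommGroup V] [AddCommGroup V'] (φ : V →+ V')
    {𝓥 : ℕ → AddSubgroup V} {𝓦 : ℕ → AddSubgroup V'} (h : ∀ j, 𝓦 j = (𝓥 j).map φ) (c : ℤ) :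
    extendGrading 𝓦 c = (extendGrading 𝓥 c).map φ := by
  rcases lt_or_ge c 0 with hc | hc
  · rw [extendGrading_of_neg _ hc, extendGrading_of_neg _ hc, AddSubgroup.map_bot]
  · lift c to ℕ using hc
    rw [extendGrading_natCast, extendGrading_natCast, h]

lemma exists_isGradedModule_ideal {I : Ideal (MvPolynomial (Fin n) k)}
    (hI : ∀ f ∈ I, ∀ j : ℕ, homogeneousComponent j f ∈ I) :
    ∃ π, IsGradedModule n k (idealGrading I) π :=
  exists_isGradedModule_of_injective I.subtype.toAddMonoidHom Subtype.val_injective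
    (fun j v => ⟨⟨_, hI _ v.2 j⟩, rfl⟩)
    (fun m c _ => ⟨monomial m c, isHomogeneous_monomial c rfl, rfl⟩)

lemma koszulExact_idealGrading_iff {I : Ideal (MvPolynomial (Fin n) k)} (p c : ℤ) :
    KoszulExact (mulVar n k I) (extendGrading (idealGrading I)) p c ↔
      KoszulExact (mulVar n k (MvPolynomial (Fin n) k)) (extendGrading (idealParts I)) p c := by
  refine koszulExact_iff_of_injective I.subtype.toAddMonoidHom Subtype.val_injective
    (fun i v => rfl) (extendGrading_eq_map _ fun j => ?_) p c
  ext f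
  exact ⟨fun h => ⟨⟨f, h.1⟩, h.2, rfl⟩, fun ⟨v, hv, e⟩ => e ▸ ⟨v.2, hv⟩⟩

end Embedded

/-! ### The modules `K̃_i` inside `R` -/

section KTilde

variable {k : Type u} [Field k] {N : ℕ} {J : Ideal (R k N)}

/-- The inclusion of `K̃_i(J)` into `R`. -/
noncomputable def KTildeInclusion (J : Ideal (R k N)) (i : ℤ) : KTilde J i →+ R k N :=
  (finSuccEquiv k N).symm.toRingEquiv.toRingHom.toAddMonoidHom.comp
    (KTilde J i).subtype.toAddMonoidHom

lemma finSuccEquiv_KTildeInclusion {i : ℤ} (v : KTilde J i) :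
    finSuccEquiv k N (KTildeInclusion J i v) = v :=
  (finSuccEquiv k N).apply_symm_apply _

lemma KTildeInclusion_injective (i : ℤ) : Function.Injective (KTildeInclusion J i) :=
  fun v w h => Subtype.ext <| by
    rw [← finSuccEquiv_KTildeInclusion, h, finSuccEquiv_KTildeInclusion]

lemma KTildeInclusion_smul {i : ℤ} (f : S k N) (v : KTilde J i) :
    KTildeInclusion J i (f • v) = rename Fin.succ f * KTildeInclusion J i v := by
  apply (finSuccEquiv k N).injective
  rw [finSuccEquiv_KTildeInclusion, map_mul, finSuccEquiv_rename_succ,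
    finSuccEquiv_KTildeInclusion, Submodule.coe_smul, Polynomial.smul_eq_C_mul]

lemma exists_KTildeInclusion_eq_iff {i : ℤ} {f : R k N} : (∃ v, KTildeInclusion J i v = f) ↔
    f ∈ J ∧ ∀ a, (i + 1).toNat ≤ a → headCoeff a f = 0 := by
  rw [← mem_KTilde_iff]
  constructor
  · rintro ⟨v, rfl⟩
    rw [finSuccEquiv_KTildeInclusion]
    exact v.2
  · intro h
    exact ⟨⟨_, h⟩, (finSuccEquiv k N).symm_apply_apply f⟩

lemma exists_isGradedModule_KTilde (hJ : HasComponents J) (i : ℤ) :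
    ∃ π, IsGradedModule N k (KTildeGrading J i) π := by
  refine exists_isGradedModule_of_injective (KTildeInclusion J i) (KTildeInclusion_injective i)
    (fun j v => ?_) (fun m c v => ⟨_, ?_, KTildeInclusion_smul (monomial m c) v⟩)
  · obtain ⟨h1, h2⟩ := exists_KTildeInclusion_eq_iff.1 ⟨v, rfl⟩
    refine exists_KTildeInclusion_eq_iff.2 ⟨hJ _ h1 j, fun a ha => ?_⟩
    rw [headCoeff_homogeneousComponent, h2 a ha, map_zero, ite_self]
  · exact (isHomogeneous_monomial c rfl).rename_isHomogeneous

/-- Index shift: `K̃_{s-1}` bounds the `x₀`-degree by `s - 1`, while `elimParts J s` asks for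
`x₀`-degree less than `s`. The integer index makes `s = 0` the zero module. -/
lemma koszulExact_KTildeGrading_iff (s : ℕ) (p c : ℤ) :
    KoszulExact (mulVar N k (KTilde J ((s : ℤ) - 1)))
        (extendGrading (KTildeGrading J ((s : ℤ) - 1))) p c ↔
      KoszulExact (Fin.tail (mulVar (N + 1) k (R k N))) (extendGrading (elimParts J s)) p c := by
  refine koszulExact_iff_of_injective (KTildeInclusion J _) (KTildeInclusion_injective _)
    (fun i v => ?_) (extendGrading_eq_map _ fun j => ?_) p c
  · rw [mulVar_apply, KTildeInclusion_smul, rename_X]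
    rfl
  · have hs : ((s : ℤ) - 1 + 1).toNat = s := by omega
    ext f
    constructor
    · intro h
      obtain ⟨v, hv⟩ := exists_KTildeInclusion_eq_iff.2 (⟨h.1.1, hs.symm ▸ h.2⟩ :
        f ∈ J ∧ ∀ a, ((s : ℤ) - 1 + 1).toNat ≤ a → headCoeff a f = 0)
      rw [← hv] at h ⊢
      exact ⟨v, h.1.2, rfl⟩
    · rintro ⟨v, hv, rfl⟩
      obtain ⟨h1, h2⟩ := exists_KTildeInclusion_eq_iff.1 ⟨v, rfl⟩
      rw [hs] at h2
      exact ⟨⟨h1, hv⟩, h2⟩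

lemma gradedBetti_KTildeGrading_eq_zero_iff (hJ : HasComponents J) (s p j : ℕ) :
    gradedBetti (Fin N) k (KTildeGrading J ((s : ℤ) - 1)) p j = 0 ↔
      KoszulExact (Fin.tail (mulVar (N + 1) k (R k N))) (extendGrading (elimParts J s)) p j := by
  obtain ⟨π, h⟩ := exists_isGradedModule_KTilde hJ ((s : ℤ) - 1)
  rw [gradedBetti_eq_zero_iff h, koszulExact_KTildeGrading_iff]

instance (i : ℤ) : Module.Finite (S k N) (KTilde J i) := by
  have : IsNoetherian (S k N) (Polynomial.degreeLT (S k N) (i + 1).toNat) :=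
    isNoetherian_of_linearEquiv (Polynomial.degreeLTEquiv (S k N) (i + 1).toNat).symm
  have : IsNoetherian (S k N) (KTilde J i) :=
    isNoetherian_of_le (t := Polynomial.degreeLT (S k N) (i + 1).toNat) inf_le_left
  infer_instance

/-- Starting point of the descending induction in `koszulExact_elimParts`. -/
lemma exists_koszulExact_elimParts (hJ : HasComponents J) (s p : ℕ) :
    ∃ c₀ : ℤ, ∀ c, c₀ ≤ c → KoszulExact (Fin.tail (mulVar (N + 1) k (R k N)))
      (extendGrading (elimParts J s)) p c := by
  obtain ⟨π, h⟩ := exists_isGradedModule_KTilde hJ ((s : ℤ) - 1)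
  obtain ⟨c₀, hc₀⟩ := h.exists_koszulExact p
  exact ⟨c₀, fun c hc => (koszulExact_KTildeGrading_iff s p c).1 (hc₀ c hc)⟩

end KTilde
/-! ### Linear changes of coordinates -/

section LinearSubst

variable {k : Type u} [Field k] {N : ℕ} (g : Matrix.GeneralLinearGroup (Fin (N + 1)) k)

lemma linearSubst_mul (h : Matrix.GeneralLinearGroup (Fin (N + 1)) k) (f : R k N) :
    linearSubst h (linearSubst g f) = linearSubst (g * h) f := by
  refine DFunLike.congr_fun (?_ : (linearSubst h).comp (linearSubst g) = linearSubst (g * h)) f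
  apply algHom_ext
  intro i
  simp only [linearSubst, AlgHom.comp_apply, aeval_X, map_sum, map_mul, Units.val_mul,
    Matrix.mul_apply, algHom_C, Finset.mul_sum, Finset.sum_mul]
  rw [Finset.sum_comm]
  refine Finset.sum_congr rfl fun j _ => Finset.sum_congr rfl fun l _ => ?_
  rw [← algebraMap_eq, mul_assoc]

lemma linearSubst_one (f : R k N) : linearSubst 1 f = f := by
  have : linearSubst (1 : Matrix.GeneralLinearGroup (Fin (N + 1)) k) = AlgHom.id k (R k N) := by
    apply algHom_ext
    intro i
    simp [linearSubst, Matrix.one_apply]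
  rw [this, AlgHom.id_apply]

lemma linearSubst_inv_apply (f : R k N) : linearSubst g⁻¹ (linearSubst g f) = f := by
  rw [linearSubst_mul, mul_inv_cancel, linearSubst_one]

lemma linearSubst_bijective : Function.Bijective (linearSubst g) :=
  ⟨Function.LeftInverse.injective (linearSubst_inv_apply g), fun f =>
    ⟨linearSubst g⁻¹ f, by rw [linearSubst_mul, inv_mul_cancel, linearSubst_one]⟩⟩

lemma isHomogeneous_linearSubst {f : R k N} {j : ℕ} (hf : f.IsHomogeneous j) :
    (linearSubst g f).IsHomogeneous j := by
  have := hf.aeval (fun i => ∑ j, C (g.1 i j) * (X j : R k N)) (n := 1) fun i =>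
    IsHomogeneous.sum _ _ _ fun j _ => (isHomogeneous_X k j).C_mul _
  rwa [one_mul] at this

lemma homogeneousComponent_linearSubst (f : R k N) (j : ℕ) :
    homogeneousComponent j (linearSubst g f) = linearSubst g (homogeneousComponent j f) := by
  conv_lhs => rw [← sum_homogeneousComponent f, map_sum, map_sum]
  have h : ∀ i, homogeneousComponent j (linearSubst g (homogeneousComponent i f)) =
      if j = i then linearSubst g (homogeneousComponent i f) else 0 := fun i =>
    homogeneousComponent_of_mem
      (isHomogeneous_linearSubst g (homogeneousComponent_isHomogeneous i f))
  simp only [h, Finset.sum_ite_eq, Finset.mem_range]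
  split_ifs with hj
  · rfl
  · rw [homogeneousComponent_eq_zero _ _ (by omega), map_zero]

lemma constantCoeff_linearSubst (f : R k N) : constantCoeff (linearSubst g f) = constantCoeff f := by
  have h := homogeneousComponent_linearSubst g f 0
  rw [homogeneousComponent_zero, homogeneousComponent_zero, algHom_C] at h
  exact C_injective _ _ h

variable {g} {I : Ideal (R k N)}

lemma mem_changeCoords_iff {f : R k N} : f ∈ changeCoords g I ↔ ∃ h ∈ I, linearSubst g h = f :=
  Ideal.mem_map_iff_of_surjective _ (linearSubst_bijective g).2

lemma hasComponents_changeCoords (hI : HasComponents I) : HasComponents (changeCoords g I) := by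
  intro f hf j
  obtain ⟨h, hh, rfl⟩ := mem_changeCoords_iff.1 hf
  exact mem_changeCoords_iff.2 ⟨_, hI h hh j, (homogeneousComponent_linearSubst g h j).symm⟩

lemma changeCoords_eq_bot_iff : changeCoords g I = ⊥ ↔ I = ⊥ :=
  Ideal.map_eq_bot_iff_of_injective (linearSubst_bijective g).1

/-- Substitution in the coordinates of a vector. -/
noncomputable def substCoords (g : Matrix.GeneralLinearGroup (Fin (N + 1)) k) (ι : Type u) :
    (ι →₀ R k N) →+ (ι →₀ R k N) :=
  Finsupp.mapRange.addMonoidHom (linearSubst g).toAddMonoidHom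

lemma substCoords_apply {ι : Type u} (v : ι →₀ R k N) (a : ι) :
    substCoords g ι v a = linearSubst g (v a) := rfl

lemma substCoords_smul {ι : Type u} (f : R k N) (v : ι →₀ R k N) :
    substCoords g ι (f • v) = linearSubst g f • substCoords g ι v :=
  Finsupp.ext fun a => map_mul (linearSubst g) f (v a)

lemma substCoords_single {ι : Type u} (a : ι) (f : R k N) :
    substCoords g ι (Finsupp.single a f) = Finsupp.single a (linearSubst g f) :=
  Finsupp.mapRange_single (hf := map_zero _)

lemma substCoords_injective {ι : Type u} : Function.Injective (substCoords g ι) :=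
  Finsupp.mapRange_injective _ (map_zero _) (linearSubst_bijective g).1

lemma substCoords_surjective {ι : Type u} : Function.Surjective (substCoords g ι) :=
  Finsupp.mapRange_surjective _ (map_zero _) (linearSubst_bijective g).2

lemma substCoords_mem {ι : Type u} {deg : ι → ℕ} {j : ℕ} {v : ι →₀ R k N}
    (hv : v ∈ freeGrading deg j) : substCoords g ι v ∈ freeGrading (k := k) deg j := by
  intro a m hm
  -- Truncated subtraction in `j - deg a` is harmless only when `deg a ≤ j`; otherwise the
  -- coordinate is zero.
  rcases lt_or_ge j (deg a) with h | h
  · have h0 : v a = 0 := by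
      rw [← support_eq_empty, Finset.eq_empty_iff_forall_notMem]
      intro m hm
      have := hv a m hm
      omega
    rw [substCoords_apply, h0, map_zero, support_zero] at hm
    exact absurd hm (Finset.notMem_empty m)
  · have hh : (v a).IsHomogeneous (j - deg a) := by
      rw [← mem_homogeneousSubmodule, homogeneousSubmodule_eq_finsupp_supported]
      intro m hm
      have := hv a m hm
      exact (by omega : m.degree = j - deg a)
    have := degree_of_mem_support (isHomogeneous_linearSubst g hh) hm
    omega

/-- Conjugation of a linear map by a linear change of coordinates, described on basis vectors. -/
lemma linearCombination_substCoords {ι : Type u} {V W : Type u} [AddCommGroup V] [AddCommGroup W]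
    [Module (R k N) V] [Module (R k N) W] (φ : (ι →₀ R k N) →ₗ[R k N] V) (τ : V →+ W)
    (hτ : ∀ (f : R k N) v, τ (f • v) = linearSubst g f • τ v) (v : ι →₀ R k N) :
    Finsupp.linearCombination (R k N) (fun a => τ (φ (Finsupp.single a 1))) (substCoords g ι v) =
      τ (φ v) := by
  induction v using Finsupp.induction_linear with
  | zero => simp
  | add v w hv hw => simp only [map_add, hv, hw]
  | single a f =>
    rw [substCoords_single, Finsupp.linearCombination_single, ← hτ, ← map_smul,
      Finsupp.smul_single, smul_eq_mul, mul_one]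

/-- Change of coordinates as a map of ideals. -/
noncomputable def changeCoordsMap (g : Matrix.GeneralLinearGroup (Fin (N + 1)) k)
    (I : Ideal (R k N)) : I →+ changeCoords g I :=
  AddMonoidHom.mk' (fun f => ⟨linearSubst g f, Ideal.mem_map_of_mem _ f.2⟩) fun f h =>
    Subtype.ext (map_add (linearSubst g) (f : R k N) h)

lemma exact_conj {A A' B B' C C' : Type u} [Zero C] [Zero C'] {d : A → B} {e : B → C} {d' : A' → B'}
    {e' : B' → C'} (α : A → A') (β : B → B') (γ : C → C') (hα : Function.Surjective α)
    (hβ : Function.Bijective β) (hγ : Function.Injective γ) (h0 : γ 0 = 0)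
    (hd : ∀ a, d' (α a) = β (d a)) (he : ∀ b, e' (β b) = γ (e b)) (h : Function.Exact d e) :
    Function.Exact d' e' := by
  intro b'
  obtain ⟨b, rfl⟩ := hβ.2 b'
  rw [he, ← h0, hγ.eq_iff, h b]
  constructor
  · rintro ⟨a, rfl⟩
    exact ⟨α a, hd a⟩
  · rintro ⟨a', e1⟩
    obtain ⟨a, rfl⟩ := hα a'
    exact ⟨a, hβ.1 ((hd a).symm.trans e1)⟩

/-- Transport of a graded free resolution along a linear change of coordinates. -/
noncomputable def GradedFreeResolution.changeCoords
    (F : GradedFreeResolution (Fin (N + 1)) k (idealGrading I))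
    (g : Matrix.GeneralLinearGroup (Fin (N + 1)) k) :
    GradedFreeResolution (Fin (N + 1)) k (idealGrading (changeCoords g I)) where
  ι := F.ι
  deg := F.deg
  ε := Finsupp.linearCombination _ fun a => changeCoordsMap g I (F.ε (Finsupp.single a 1))
  d p := Finsupp.linearCombination _ fun a => substCoords g _ (F.d p (Finsupp.single a 1))
  ε_deg a := by
    rw [Finsupp.linearCombination_single, one_smul]
    exact isHomogeneous_linearSubst g (F.ε_deg a)
  d_deg p a := by
    rw [Finsupp.linearCombination_single, one_smul]
    exact substCoords_mem (F.d_deg p a)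
  ε_surjective := by
    rintro ⟨f, hf⟩
    obtain ⟨h, hh, rfl⟩ := mem_changeCoords_iff.1 hf
    obtain ⟨v, hv⟩ := F.ε_surjective ⟨h, hh⟩
    refine ⟨substCoords g _ v, ?_⟩
    rw [linearCombination_substCoords F.ε (changeCoordsMap g I)
      (fun f v => Subtype.ext (map_mul (linearSubst g) f v)), hv]
    rfl
  exact_zero := exact_conj (substCoords g _) (substCoords g _) (changeCoordsMap g I)
    substCoords_surjective ⟨substCoords_injective, substCoords_surjective⟩
    (fun f h e => Subtype.ext ((linearSubst_bijective g).1 (congr_arg Subtype.val e)))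
    (map_zero _) (linearCombination_substCoords (F.d 0) _ substCoords_smul)
    (linearCombination_substCoords F.ε (changeCoordsMap g I)
      (fun f v => Subtype.ext (map_mul (linearSubst g) f v))) F.exact_zero
  exact_succ p := exact_conj (substCoords g _) (substCoords g _) (substCoords g _)
    substCoords_surjective ⟨substCoords_injective, substCoords_surjective⟩
    substCoords_injective (map_zero _)
    (linearCombination_substCoords (F.d (p + 1)) _ substCoords_smul)
    (linearCombination_substCoords (F.d p) _ substCoords_smul) (F.exact_succ p)

lemma constantCoeff_linearCombination_substCoords {ι ι' : Type u} (v : ι → ι' →₀ R k N) (a : ι)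
    (b : ι') : constantCoeff (Finsupp.linearCombination (R k N) (fun a => substCoords g ι' (v a))
      (Finsupp.single a 1) b) = constantCoeff (v a b) := by
  rw [Finsupp.linearCombination_single, one_smul, substCoords_apply, constantCoeff_linearSubst]

/-- Linear substitutions fix constant terms, so the two reduced complexes coincide. -/
lemma GradedFreeResolution.dBar_changeCoords
    (F : GradedFreeResolution (Fin (N + 1)) k (idealGrading I)) (p : ℕ) :
    (F.changeCoords g).dBar p = F.dBar p :=
  congr_arg (fun v : F.ι (p + 1) → F.ι p →₀ k => Finsupp.linearCombination k v)
    (funext fun a => Finsupp.ext fun b => constantCoeff_linearCombination_substCoords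
      (fun a => F.d p (Finsupp.single a 1)) a b)

lemma GradedFreeResolution.torDim_changeCoords
    (F : GradedFreeResolution (Fin (N + 1)) k (idealGrading I)) (p j : ℕ) :
    (F.changeCoords g).torDim p j = F.torDim p j := by
  have hc : (F.changeCoords g).cycles p = F.cycles p := by
    cases p with
    | zero => rfl
    | succ p => exact congr_arg LinearMap.ker (F.dBar_changeCoords p)
  have h1 : (F.changeCoords g).gradedCycles p j = F.gradedCycles p j :=
    congr_arg (· ⊓ F.degreePart p j) hc
  have h2 : (F.changeCoords g).gradedBoundaries p j = F.gradedBoundaries p j :=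
    congr_arg (Submodule.map · (F.degreePart (p + 1) j)) (F.dBar_changeCoords p)
  exact congr_arg₂ subquotientDim h1 h2

/-- Betti numbers of `I` are thus tested on `J`. Both are compared through one resolution and its
transport, since vanishing does not depend on the resolution. -/
lemma gradedBetti_eq_zero_iff_changeCoords (hI : HasComponents I) (p j : ℕ) :
    gradedBetti (Fin (N + 1)) k (idealGrading I) p j = 0 ↔
      KoszulExact (mulVar (N + 1) k (R k N)) (extendGrading (idealParts (changeCoords g I))) p j := by
  obtain ⟨π, h⟩ := exists_isGradedModule_ideal hI
  obtain ⟨π', h'⟩ := exists_isGradedModule_ideal (hasComponents_changeCoords (g := g) hI)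
  obtain ⟨F⟩ := h.nonempty_resolution
  rw [gradedBetti_eq_zero_iff h, ← F.torDim_eq_zero_iff h, ← F.torDim_changeCoords (g := g),
    (F.changeCoords g).torDim_eq_zero_iff h', koszulExact_idealGrading_iff]

end LinearSubst
/-! ### Comparison of Betti numbers -/

section Regularity

variable {k : Type u} [Field k] {N : ℕ} {J : Ideal (R k N)}

lemma koszulExact_of_elimParts (hJ : HasComponents J) (hq : IsSmoothPointAtOrigin J) {p c : ℤ}
    (hc : c ≠ stabilizationNumber J + 1)
    (h : KoszulExact (Fin.tail (mulVar (N + 1) k (R k N)))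
      (extendGrading (elimParts J (stabilizationNumber J))) p c)
    (h' : KoszulExact (Fin.tail (mulVar (N + 1) k (R k N)))
      (extendGrading (elimParts J (stabilizationNumber J))) (p - 1) c) :
    KoszulExact (mulVar (N + 1) k (R k N)) (extendGrading (idealParts J)) p c :=
  (isPencil_elimParts hJ).koszulExact (koszulExact_elimParts_succ hJ hq hc h) h'

/-- Descending induction on `j`: row `j` of `M` is controlled by row `j` of `J` and row `j + 1` of
`M'`, the latter by row `j + 1` of `M`. -/
lemma koszulExact_elimParts (hJ : HasComponents J) (hq : IsSmoothPointAtOrigin J) {p d : ℕ}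
    (hd : stabilizationNumber J ≤ d)
    (h : ∀ j : ℕ, d < j →
      KoszulExact (mulVar (N + 1) k (R k N)) (extendGrading (idealParts J)) ((p + 1 : ℕ) : ℤ) j)
    {j : ℕ} (hj : d < j) : KoszulExact (Fin.tail (mulVar (N + 1) k (R k N)))
      (extendGrading (elimParts J (stabilizationNumber J))) p j := by
  obtain ⟨c₀, hc₀⟩ := exists_koszulExact_elimParts hJ (stabilizationNumber J) p
  have key : ∀ n j : ℕ, d < j → c₀ ≤ j + n → KoszulExact (Fin.tail (mulVar (N + 1) k (R k N)))
      (extendGrading (elimParts J (stabilizationNumber J))) p j := by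
    intro n
    induction n with
    | zero => exact fun j _ hn => hc₀ j (by simpa using hn)
    | succ n ih =>
      intro j hj hn
      -- The exceptional row would require `j + 1 = s + 1`, which `s ≤ d < j` excludes.
      refine (isPencil_elimParts hJ).koszulExact_left (by exact_mod_cast h j hj)
        (koszulExact_elimParts_succ hJ hq (by omega) ?_)
      exact_mod_cast ih (j + 1) (by omega) (by push_cast at hn ⊢; omega)
  exact key c₀.toNat j hj (by omega)

lemma le_regularity {σ : Type} {M : Type u} [AddCommGroup M] [Module (MvPolynomial σ k) M]
    {ℳ : ℕ → AddSubgroup M} {p q : ℕ} (h : gradedBetti σ k ℳ p q ≠ 0) :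
    ((q : ℕ∞) : WithBot ℕ∞) ≤ regularity σ k ℳ :=
  le_iSup_of_le p (le_iSup_of_le q (le_iSup_of_le h le_rfl))

lemma regularity_le {σ : Type} {M : Type u} [AddCommGroup M] [Module (MvPolynomial σ k) M]
    {ℳ : ℕ → AddSubgroup M} {r : WithBot ℕ∞}
    (h : ∀ p q : ℕ, gradedBetti σ k ℳ p q ≠ 0 → ((q : ℕ∞) : WithBot ℕ∞) ≤ r) :
    regularity σ k ℳ ≤ r :=
  iSup_le fun p => iSup_le fun q => iSup_le fun hpq => h p q hpq

end Regularity
end PartialElimination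

/-! ### The comparison theorem -/

open PartialElimination in
theorem theorem2p8 {k : Type u} [Field k] {N : ℕ}
    -- a homogeneous ideal `I` of `R = k[x_0, …, x_N]`, defining `X ⊆ ℙ^N`
    (I : Ideal (MvPolynomial (Fin (N + 1)) k))
    (hI : ∀ f ∈ I, ∀ n : ℕ, MvPolynomial.homogeneousComponent n f ∈ I)
    -- a point `q`, linear coordinates in which it is `(1 : 0 : ⋯ : 0)`, and `I` in these coordinates
    (q : ℙ k (Fin (N + 1) → k)) (g : Matrix.GeneralLinearGroup (Fin (N + 1)) k)
    (hg : PartialElimination.Adapted g q)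
    (J : Ideal (MvPolynomial (Fin (N + 1)) k)) (hJ : J = PartialElimination.changeCoords g I)
    -- `q` is a smooth point of `X`
    (hq : PartialElimination.IsSmoothPointAtOrigin J)
    (s : ℕ) (hs : s = PartialElimination.stabilizationNumber J) :
    -- (a)
    (∀ d p₀ : ℕ, s ≤ d → 1 ≤ p₀ → PartialElimination.PropertyN I d p₀ →
      ∀ p j : ℕ, p + 1 < p₀ → d < j →
        PartialElimination.gradedBetti (Fin N) k
          (PartialElimination.KTildeGrading J ((s : ℤ) - 1)) p j = 0) ∧
    -- (b)
    (∀ d p₀ : ℕ, s + 1 ≤ d → 1 ≤ p₀ →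
      (∀ p j : ℕ, p < p₀ → d < j →
        PartialElimination.gradedBetti (Fin N) k
          (PartialElimination.KTildeGrading J ((s : ℤ) - 1)) p j = 0) →
      PartialElimination.PropertyN I d p₀) ∧
    -- (c)
    (I ≠ ⊥ →
      PartialElimination.regularity (Fin (N + 1)) k (PartialElimination.idealGrading I) =
        max (PartialElimination.regularity (Fin N) k
              (PartialElimination.KTildeGrading J ((s : ℤ) - 1)))
          (((s + 1 : ℕ) : ℕ∞) : WithBot ℕ∞)) := by
  have hJc : HasComponents J := hJ ▸ hasComponents_changeCoords hI
  have hR : ∀ p j : ℕ, gradedBetti (Fin (N + 1)) k (idealGrading I) p j = 0 ↔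
      KoszulExact (mulVar (N + 1) k (R k N)) (extendGrading (idealParts J)) p j := fun p j => by
    rw [hJ]
    exact gradedBetti_eq_zero_iff_changeCoords hI p j
  have hS : ∀ p j : ℕ, gradedBetti (Fin N) k (KTildeGrading J ((s : ℤ) - 1)) p j = 0 ↔
      KoszulExact (Fin.tail (mulVar (N + 1) k (R k N)))
        (extendGrading (elimParts J (stabilizationNumber J))) p j := fun p j => by
    rw [gradedBetti_KTildeGrading_eq_zero_iff hJc, hs]
  have key : ∀ p j : ℕ, j ≠ s + 1 →
      (∀ i ≤ p, gradedBetti (Fin N) k (KTildeGrading J ((s : ℤ) - 1)) i j = 0) →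
      gradedBetti (Fin (N + 1)) k (idealGrading I) p j = 0 := by
    intro p j hj h
    rw [hR]
    refine koszulExact_of_elimParts hJc hq (by omega) ((hS p j).1 (h p le_rfl)) ?_
    rcases p with _ | p
    -- For `p = 0` the condition on `M` concerns homological degree `-1`, where there are no chains.
    · exact fun z hz _ => ⟨0, zero_mem _, by rw [map_zero, Kos.chains_of_neg (by omega) hz]⟩
    · rw [show ((p + 1 : ℕ) : ℤ) - 1 = p by push_cast; ring]
      exact (hS p j).1 (h p (by omega))
  have key' : ∀ p d : ℕ, s ≤ d →
      (∀ j, d < j → gradedBetti (Fin (N + 1)) k (idealGrading I) (p + 1) j = 0) →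
      ∀ j, d < j → gradedBetti (Fin N) k (KTildeGrading J ((s : ℤ) - 1)) p j = 0 :=
    fun p d hd h j hj => (hS p j).2
      (koszulExact_elimParts hJc hq (hs ▸ hd) (fun i hi => (hR (p + 1) i).1 (h i hi)) hj)
  refine ⟨fun d p₀ hd _ h p j hp => key' p d hd (fun i hi => h (p + 1) i hp hi) j,
    fun d p₀ hd _ h p j hp hj => key p j (by omega) fun i hi => h i j (by omega) hj, fun h0 => ?_⟩
  have hs1 : (((s + 1 : ℕ) : ℕ∞) : WithBot ℕ∞) ≤
      regularity (Fin (N + 1)) k (idealGrading I) := by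
    refine le_regularity (p := 0) fun h => ?_
    rw [hR, hs, Nat.cast_zero] at h
    exact not_koszulExact_stabilizationNumber hJc hq
      (fun e => h0 (changeCoords_eq_bot_iff.1 (hJ.symm.trans e))) h
  apply le_antisymm
  · refine regularity_le fun p j hpj => ?_
    by_contra hlt
    rw [le_max_iff, not_or] at hlt
    refine hpj (key p j (fun e => hlt.2 (e ▸ le_rfl)) fun i _ => ?_)
    by_contra hi
    exact hlt.1 (le_regularity hi)
  · refine max_le (regularity_le fun p j hpj => ?_) hs1
    by_contra hlt
    have hsj : s + 1 < j := by
      have := hs1.trans_lt (not_le.1 hlt)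
      exact_mod_cast this
    -- Take `d = j - 1`, which is at least `s`: were all rows `i ≥ j` of `I` zero in homological
    -- degree `p + 1`, row `j` of `K̃_{s-1}` would vanish in degree `p`. A nonzero one bounds `j` by
    -- the regularity of `I`.
    refine hpj (key' p (j - 1) (by omega) (fun i hi => ?_) j (by omega))
    by_contra hi'
    refine hlt (le_trans ?_ (le_regularity hi'))
    exact_mod_cast (by omega : j ≤ i)
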